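/- **Setting.** Let $(\Omega,\mathcal F,\mathbb P)$ be a probability space carrying a two-sided Brownian motion $B=(B_t)_{t\in\mathbb R}$ and an independent, strictly positive random variable $A$. Let $R_A\in[0,\infty]$ be the maximal radius such that the Laplace transform $z\mapsto\mathbb E[e^{-zA}]$ ($\operatorname{Re}z>0$) extends holomorphically to the disc $\{|z|<R_A\}\subset\mathbb C$, and assume $R_A>0$. Put $L^2_A=L^2(\Omega,\sigma(B,A),\mathbb P)$ and let $I(f)=\int_{\mathbb R} f\,dB$ be the Wiener integral of $f\in L^2(\mathbb R)$. Let $H\in(0,1)$ and $$K_H=\Gamma(H+\tfrac12)\Big(\int_0^\infty\big((1+s)^{H-1/2}-s^{H-1/2}\big)^2ds+\tfrac1{2H}\Big)^{-1/2}.$$ For $H>\frac12$ let $$(M^H_-f)(x)=\tfrac{K_H}{\Gamma(H-1/2)}\int_x^\infty f(t)(t-x)^{H-3/2}dt,\qquad (M^H_+f)(x)=\tfrac{K_H}{\Gamma(H-1/2)}\int_{-\infty}^x f(t)(x-t)^{H-3/2}dt;$$ for $H<\frac12$ let $$(M^H_\pm f)(x)=\lim_{\epsilon\downarrow0}\tfrac{K_H(1/2-H)}{\Gamma(1/2+H)}\int_\epsilon^\infty\frac{f(x)-f(x\mp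 t)}{t^{3/2-H}}dt;$$ and let $M_\pm^{1/2}$ be the identity. Let $\mathbf 1_{(s,t)}$ be the indicator of $[s,t)$ if $s\le t$, and minus the indicator of $[t,s)$ if $t<s$. Let $B^H$ be the continuous version of $t\mapsto I(M^H_-\mathbf 1_{(0,t)})$, a fractional Brownian motion, and $X=\sqrt A\,B^H$. Let $D_A=\{\eta\in\mathcal S(\mathbb R):2\|\eta\|_{L^2(\mathbb R)}^2<R_A\}$, let $W_A(\eta)=e^{\sqrt A I(\eta)}/\mathbb E[e^{\sqrt A I(\eta)}]$ for $\eta\in D_A$, and let $S_A[\Theta](\eta)=\mathbb E[\Theta W_A(\eta)]$. Let $M\subset\mathbb R$ be a Borel set and $(U_t)_{t\in M}$ a family of $\sigma(B,A)$-measurable random variables such that $A\,U_t\,W_A(\eta)$ is integrable for all $t\in M$, $\eta\in D_A$ (which is automatic if $U_t\in L^2_A$ or $AU_t\in L^2_A$). The fractional Itô integral $\int_MU_t\,dX_t$ exists and equals $\Theta\in L^2_A$ if, for all $\eta\in D_A$, the function $t\mapsto S_A[AU_t](\eta)\,(M^H_+\eta)(t)$ lies in $L^1(M)$ and $$S_A[\Theta](\eta)=\int_MS_A[AU_t](\eta)\,(M_+^H\eta)(t)\,dt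 .$$ We write $\int_0^t$ for $\int_{[0,t)}$. Integrals $\int\cdots dt$ of $L^2_A$-valued functions are Pettis integrals. **Theorem (Itô formula).** Let $T>0$ and let $\nu:[0,\infty)\to\mathbb R$ be continuous, and moreover constant if $H<\frac12$. Let $Z_t=\int_0^t\nu(s)\,dX_s$ for $t\in[0,T]$. Let $F=F(t,z,a)\in C^{1,2,0}([0,T],\mathbb R,(0,\infty))$, that is, $F,\partial_tF,\partial_zF,\partial_z^2F$ exist and are jointly continuous on $[0,T]\times\mathbb R\times(0,\infty)$. Assume that each $G\in\{F,\ \partial_tF,\ a\,\partial_zF,\ a\,\partial_z^2F\}$ satisfies, with constants $C,c,\lambda\ge0$ that may depend on $G$, $$|G(t,\sqrt a\,z,a)|\le C e^{ca+\lambda z^2}\qquad(t\in[0,T],\ z\in\mathbb R,\ a>0),$$ where $c<R_A/2$ and $\lambda\,\big(2T^H\max_{s\in[0,T]}|\nu(s)|\big)^2<1$. Then $F(T,Z_T,A)$ and $F(0,0,A)$ belong to $L^2_A$, the fractional Itô integral and both Pettis integrals (the last one over $(0,T)$) on the right-hand side below exist, and the following equality holds in $L^2_A$: $$F(T,Z_T,A)=F(0,0,A)+\int_0^T\partial_tF(t,Z_t,A)\,dt+\int_0^T\nu(t)\,\partial_zF(t,Z_t,A)\,dX_t+\int_0^T\frac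 A2\,\frac{d}{dt}\big\|M_-^H(\nu\mathbf 1_{(0,t)})\big\|_{L^2(\mathbb R)}^2\,\partial_z^2F(t,Z_t,A)\,dt .$$ Moreover, whenever $\int_0^T\frac{d}{dt}\|M_-^H(\nu\mathbf 1_{(0,t)})\|_{L^2(\mathbb R)}^2\,\partial_z^2F(t,Z_t,A)\,dt$ exists as a Pettis integral in $L^2_A$ over $(0,T)$, the last term equals $\frac A2$ times this integral. -/

import Mathlib

open MeasureTheory ProbabilityTheory Set Filter Topology
open scoped ENNReal SchwartzMap

namespace ScaledFBM

noncomputable section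

/-! ### Fractional operators on the real line -/

/-- The signed indicator `1_(s,t)`: it is `1` on `[s,t)` if `s ≤ t` and `-1` on `[t,s)` if `t < s`. -/
def ind (s t x : ℝ) : ℝ :=
  if s ≤ x ∧ x < t then 1 else if t ≤ x ∧ x < s then -1 else 0

/-- The normalising constant
`K_H = Γ(H+1/2) (∫_0^∞ ((1+s)^(H-1/2) - s^(H-1/2))² ds + 1/(2H))^(-1/2)`, for which the function
`M_-^H 1_(s,t)` has the `L²`-norm `|t-s|^H`. -/
def constK (H : ℝ) : ℝ :=
  Real.Gamma (H + 1 / 2) *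
    ((∫ s in Ioi (0 : ℝ), ((1 + s) ^ (H - 1 / 2) - s ^ (H - 1 / 2)) ^ 2) + 1 / (2 * H))
      ^ (-(1 / 2) : ℝ)

/-- The operator `M_-^H`: the Weyl fractional integral if `H > 1/2`, the Marchaud fractional
derivative if `H < 1/2`, and the identity if `H = 1/2`. -/
def opMinus (H : ℝ) (f : ℝ → ℝ) (x : ℝ) : ℝ :=
  if 1 / 2 < H then
    constK H / Real.Gamma (H - 1 / 2) * ∫ t in Ioi x, f t * (t - x) ^ (H - 3 / 2)
  else if H < 1 / 2 then
    limUnder (𝓝[>] (0 : ℝ)) fun ε : ℝ =>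
      constK H * (1 / 2 - H) / Real.Gamma (1 / 2 + H) *
        ∫ t in Ioi ε, (f x - f (x + t)) / t ^ (3 / 2 - H)
  else f x

/-- The operator `M_+^H`: the Weyl fractional integral if `H > 1/2`, the Marchaud fractional
derivative if `H < 1/2`, and the identity if `H = 1/2`. -/
def opPlus (H : ℝ) (f : ℝ → ℝ) (x : ℝ) : ℝ :=
  if 1 / 2 < H then
    constK H / Real.Gamma (H - 1 / 2) * ∫ t in Iio x, f t * (x - t) ^ (H - 3 / 2)
  else if H < 1 / 2 then
    limUnder (𝓝[>] (0 : ℝ)) fun ε : ℝ =>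
      constK H * (1 / 2 - H) / Real.Gamma (1 / 2 + H) *
        ∫ t in Ioi ε, (f x - f (x - t)) / t ^ (3 / 2 - H)
  else f x

/-- The squared norm `‖M_-^H(ν 1_(0,t))‖²` in `L²(ℝ)`. -/
def varianceFun (H : ℝ) (ν : ℝ → ℝ) (t : ℝ) : ℝ :=
  ∫ x, opMinus H (fun s => ν s * ind 0 t s) x ^ 2

/-! ### Brownian motion and the Wiener integral -/

variable {Ω : Type*} [MeasurableSpace Ω]

/-- A two-sided Brownian motion indexed by `ℝ`: a centred Gaussian process with continuous paths
and covariance `(|s| + |t| - |t - s|) / 2`. -/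
structure IsTwoSidedBrownianMotion (P : Measure Ω) (B : ℝ → Ω → ℝ) : Prop where
  measurable : ∀ t, Measurable (B t)
  gaussian : IsGaussianProcess B P
  centered : ∀ t, ∫ ω, B t ω ∂P = 0
  covariance : ∀ s t, cov[B s, B t; P] = (|s| + |t| - |t - s|) / 2
  continuous_paths : ∀ᵐ ω ∂P, Continuous fun t => B t ω

/-- `Y` is (a version of) the Wiener integral `∫ f dB`: for step functions
`∑ cᵢ 1_(sᵢ,tᵢ)` approximating `f` in `L²(ℝ)`, it is the `L²(P)`-limit of
`∑ cᵢ (B_{tᵢ} - B_{sᵢ})`. -/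
def IsWienerIntegral (P : Measure Ω) (B : ℝ → Ω → ℝ) (f : ℝ → ℝ) (Y : Ω → ℝ) : Prop :=
  MemLp Y 2 P ∧
    ∀ ε : ℝ≥0∞, 0 < ε →
      ∃ (n : ℕ) (c s t : Fin n → ℝ),
        eLpNorm (fun x => f x - ∑ i, c i * ind (s i) (t i) x) 2 volume ≤ ε ∧
        eLpNorm (fun ω => Y ω - ∑ i, c i * (B (t i) ω - B (s i) ω)) 2 P ≤ ε

open Classical in
/-- The Wiener integral `I(f) = ∫ f dB`, well defined up to null sets for `f ∈ L²(ℝ)`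
(and `0` if it does not exist). -/
def wienerIntegral (P : Measure Ω) (B : ℝ → Ω → ℝ) (f : ℝ → ℝ) : Ω → ℝ :=
  if h : ∃ Y, IsWienerIntegral P B f Y then h.choose else 0

/-! ### The randomly scaled fractional Brownian motion -/

/-- The data of a randomly scaled fractional Brownian motion `X = √A B^H`: a two-sided Brownian
motion `B`, an independent strictly positive random variable `A`, and the fractional Brownian
motion `B^H`, the continuous version of `t ↦ ∫ M_-^H 1_(0,t) dB`, with Hurst parameter
`H ∈ (0,1)`. -/
structure RandomlyScaledFBM (P : Measure Ω) where
  H : ℝ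
  H_pos : 0 < H
  H_lt_one : H < 1
  B : ℝ → Ω → ℝ
  isBrownian : IsTwoSidedBrownianMotion P B
  A : Ω → ℝ
  measurable_A : Measurable A
  A_pos : ∀ ω, 0 < A ω
  indep : IndepFun A (fun ω t => B t ω) P
  BH : ℝ → Ω → ℝ
  BH_version : ∀ t, BH t =ᵐ[P] wienerIntegral P B (opMinus H (ind 0 t))
  BH_continuous : ∀ᵐ ω ∂P, Continuous fun t => BH t ω

namespace RandomlyScaledFBM

variable {P : Measure Ω} (X : RandomlyScaledFBM P)

/-- The process `X_t = √A B^H_t` itself. -/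
def process (t : ℝ) (ω : Ω) : ℝ := √(X.A ω) * X.BH t ω

/-- The Laplace transform of `A` extends holomorphically to the open ball of radius `R` about
`0` in the complex plane. -/
def LaplaceExtends (R : ℝ) : Prop :=
  ∃ φ : ℂ → ℂ, DifferentiableOn ℂ φ (Metric.ball 0 R) ∧
    ∀ z ∈ Metric.ball (0 : ℂ) R, 0 < z.re → φ z = ∫ ω, Complex.exp (-z * (X.A ω : ℂ)) ∂P

/-- The maximal radius `R_A ∈ [0,∞]` such that the Laplace transform of `A` is holomorphic on
the open ball of radius `R_A` about `0`. -/
def radius : ℝ≥0∞ := ⨆ (R : ℝ) (_ : 0 < R ∧ X.LaplaceExtends R), ENNReal.ofReal R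

/-- The `σ`-algebra `σ(B, A)`. -/
abbrev sigmaBA : MeasurableSpace Ω :=
  (⨆ t : ℝ, MeasurableSpace.comap (X.B t) inferInstance) ⊔
    MeasurableSpace.comap X.A inferInstance

/-- `Θ` belongs to `L²_A = L²(Ω, σ(B,A), P)`. -/
def MemL2A (Θ : Ω → ℝ) : Prop :=
  AEStronglyMeasurable[X.sigmaBA] Θ P ∧ MemLp Θ 2 P

/-- The set `D_A` of admissible test functions. -/
def testFunctions : Set 𝓢(ℝ, ℝ) :=
  {η | ENNReal.ofReal (2 * ∫ x, η x ^ 2) < X.radius}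

/-- The Wick-`A` exponential `W_A(η)`. -/
def wickExp (η : 𝓢(ℝ, ℝ)) (ω : Ω) : ℝ :=
  Real.exp (√(X.A ω) * wienerIntegral P X.B (fun x => η x) ω) /
    ∫ ω', Real.exp (√(X.A ω') * wienerIntegral P X.B (fun x => η x) ω') ∂P

/-- The `S_A`-transform `S_A[Θ](η) = E[Θ W_A(η)]`. -/
def sTransform (Θ : Ω → ℝ) (η : 𝓢(ℝ, ℝ)) : ℝ := ∫ ω, Θ ω * X.wickExp η ω ∂P

/-- `Θ` is the fractional Itô integral `∫_M U_t dX_t`. The process `U` consists of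
`σ(B,A)`-measurable random variables for which the expectations defining `S_A[A U_t](η)` exist;
this includes every process with `U_t ∈ L²_A`, and every process with `A U_t ∈ L²_A`. -/
structure IsFracItoIntegral (M : Set ℝ) (U : ℝ → Ω → ℝ) (Θ : Ω → ℝ) : Prop where
  measurableSet : MeasurableSet M
  measurable : ∀ t ∈ M, AEStronglyMeasurable[X.sigmaBA] (U t) P
  integrable : ∀ t ∈ M, ∀ η ∈ X.testFunctions,
    Integrable (fun ω => X.A ω * U t ω * X.wickExp η ω) P
  integrableOn : ∀ η ∈ X.testFunctions,
    IntegrableOn (fun t => X.sTransform (fun ω => X.A ω * U t ω) η * opPlus X.H (fun x => η x) t) M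
  memL2A : X.MemL2A Θ
  sTransform_eq : ∀ η ∈ X.testFunctions,
    X.sTransform Θ η =
      ∫ t in M, X.sTransform (fun ω => X.A ω * U t ω) η * opPlus X.H (fun x => η x) t

/-- `Θ` is the Pettis integral `∫_M f(t) dt` of the `L²_A`-valued function `f`. -/
structure IsPettisIntegral (M : Set ℝ) (f : ℝ → Ω → ℝ) (Θ : Ω → ℝ) : Prop where
  measurableSet : MeasurableSet M
  memL2A_fun : ∀ t ∈ M, X.MemL2A (f t)
  measurable : ∀ ψ, X.MemL2A ψ → Measurable fun t : M => ∫ ω, f t ω * ψ ω ∂P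
  integrableOn : ∀ ψ, X.MemL2A ψ → IntegrableOn (fun t => ∫ ω, f t ω * ψ ω ∂P) M
  memL2A : X.MemL2A Θ
  inner_eq : ∀ ψ, X.MemL2A ψ → ∫ ω, Θ ω * ψ ω ∂P = ∫ t in M, ∫ ω, f t ω * ψ ω ∂P

/-- The class of deterministic integrands on `[0,∞)`: continuous functions, which are moreover
constant if `H < 1/2`. -/
def IsGoodIntegrand (ν : ℝ → ℝ) : Prop :=
  ContinuousOn ν (Ici 0) ∧ (X.H < 1 / 2 → ∃ k, ∀ s, 0 ≤ s → ν s = k)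

/-- The growth bound of an admissible functional of `Z = ∫ ν dX` on `[0,T]`:
`|G(t, √a z, a)| ≤ C exp(c a + l z²)` with `c < R_A / 2` and
`l < (2 T^H max_{[0,T]} |ν|)^(-2)`, read as no restriction on `l` if `ν = 0` on `[0,T]`. -/
def AdmissibleGrowth (ν : ℝ → ℝ) (T : ℝ) (G : ℝ → ℝ → ℝ → ℝ) : Prop :=
  ∃ C c l : ℝ, 0 ≤ C ∧ 0 ≤ c ∧ 0 ≤ l ∧
    ENNReal.ofReal (2 * c) < X.radius ∧
    l * (2 * T ^ X.H * sSup ((fun s => |ν s|) '' Icc 0 T)) ^ 2 < 1 ∧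
    ∀ t ∈ Icc 0 T, ∀ z : ℝ, ∀ a : ℝ, 0 < a →
      |G t (√a * z) a| ≤ C * Real.exp (c * a + l * z ^ 2)

end RandomlyScaledFBM

/-- `F ∈ C^{1,2,0}([0,T], ℝ, (0,∞))` with the partial derivatives `Ft = ∂F/∂t` (one-sided at the
ends of `[0,T]`), `Fz = ∂F/∂z` and `Fzz = ∂²F/∂z²`: they exist, and all four functions are jointly
continuous. -/
structure IsC120 (T : ℝ) (F Ft Fz Fzz : ℝ → ℝ → ℝ → ℝ) : Prop where
  hasDeriv_t : ∀ t ∈ Icc 0 T, ∀ z a : ℝ, 0 < a →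
    HasDerivWithinAt (fun s => F s z a) (Ft t z a) (Icc 0 T) t
  hasDeriv_z : ∀ t ∈ Icc 0 T, ∀ z a : ℝ, 0 < a → HasDerivAt (fun y => F t y a) (Fz t z a) z
  hasDeriv_zz : ∀ t ∈ Icc 0 T, ∀ z a : ℝ, 0 < a → HasDerivAt (fun y => Fz t y a) (Fzz t z a) z
  continuousOn_F :
    ContinuousOn (fun p : ℝ × ℝ × ℝ => F p.1 p.2.1 p.2.2) (Icc 0 T ×ˢ univ ×ˢ Ioi 0)
  continuousOn_Ft :
    ContinuousOn (fun p : ℝ × ℝ × ℝ => Ft p.1 p.2.1 p.2.2) (Icc 0 T ×ˢ univ ×ˢ Ioi 0)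
  continuousOn_Fz :
    ContinuousOn (fun p : ℝ × ℝ × ℝ => Fz p.1 p.2.1 p.2.2) (Icc 0 T ×ˢ univ ×ˢ Ioi 0)
  continuousOn_Fzz :
    ContinuousOn (fun p : ℝ × ℝ × ℝ => Fzz p.1 p.2.1 p.2.2) (Icc 0 T ×ˢ univ ×ˢ Ioi 0)

end

end ScaledFBM

open MeasureTheory ProbabilityTheory Set Filter Topology
open scoped ENNReal SchwartzMap RealInnerProductSpace

namespace ScaledFBM

noncomputable section

set_option linter.unusedSectionVars false

variable {Ω : Type*} [MeasurableSpace Ω]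


/-! The argument runs entirely on transforms. Since `A` and `B` are independent, tilting `P` by
exp(√A I(η)) is a Girsanov shift (`lintegral_mul_exp`): up to the weight exp(A‖η‖²/2), the law of
`A` is kept and I(f) moves by √A⟨f, η⟩. The variable Z_t is √A I(f_t) with f_t = M_-^H(ν 1_(0,t)).
Put v(t) = ‖f_t‖² and m(t) = ⟨f_t, η⟩; as M_-^H and M_+^H are adjoint, m(t) = ∫_0^t ν M_+^H η
(`integral_opMinus_mul_schwartz`). Up to a factor depending only on η, the transform of G(t, Z_t, A)
at η is therefore the integral of G(t, √a √v(t) x + a m(t), a) exp(a‖η‖²/2), where a has the law of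
`A` and x is standard Gaussian.

For fixed a and G = F, the derivative in t has three terms: ∂_t F, then a m'(t) ∂_z F with m' = ν
M_+^H η, and a term linear in x, which Gaussian integration by parts turns into (a/2) v'(t) ∂_z² F
(`gaussian_ito`). These are the transforms of the integrands of the three integrals in the formula.
Integration over t and a gives `sTransform_ito`.

An element of L²_A is determined by its transform (`ae_eq_zero_of_sTransform_eq_zero`). If the
transform of Θ vanishes, analytic continuation of moment generating functions shows that √A B has
the same law under Θ⁺ dP and Θ⁻ dP. Moreover √A B generates σ(B, A) up to null sets, because its
averaged squared unit increments converge to `A`. Hence Θ = 0, and the identity of transforms is the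
Itô formula. The same principle identifies Z_t. It also yields the fractional Itô integral without
any construction: the formula is solved for it (`exists_isFracItoIntegral_ito`). The Pettis
integrals come from the Riesz representation theorem.

The analytic input is as follows. Landau's theorem converts the radius of holomorphy into
exponential moments of `A`. The function v is absolutely continuous (`exists_density_varianceFun`),
although v' may be singular at 0 and v may vanish. Finally v ≤ T^(2H) max|ν|², so the growth
condition says 4λv < 1 and 2c < R_A, which is what square integrability requires. -/

/-! ### Exponential moments of the scaling variable -/

/-- Landau's theorem: if the Laplace transform of a positive random variable extends
holomorphically to the disc of radius `R`, then the exponential moments of order less than `R`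
are finite. -/
theorem integrable_exp_of_laplaceExtends {P : Measure Ω} [IsProbabilityMeasure P]
    (X : RandomlyScaledFBM P) {R r : ℝ} (hr : 0 ≤ r) (hrR : r < R) (h : X.LaplaceExtends R) :
    Integrable (fun ω => Real.exp (r * X.A ω)) P := by
  obtain ⟨φ, hφ, hφ'⟩ := h
  set Y : Ω → ℝ := fun ω => -X.A ω with hY
  have hYm : Measurable Y := X.measurable_A.neg
  have hint : ∀ s : ℝ, 0 ≤ s → Integrable (fun ω => Real.exp (s * Y ω)) P := by
    intro s hs
    refine Integrable.of_bound (C := 1) (by fun_prop) (ae_of_all _ fun ω => ?_)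
    rw [Real.norm_eq_abs, abs_of_pos (Real.exp_pos _), Real.exp_le_one_iff]
    have := X.A_pos ω
    simp only [hY]; nlinarith
  -- The Taylor series is centred at a point `s > 0`, where φ is the Laplace transform. The disc
  -- about `s` of radius `R - s` lies in the disc of φ and contains `-r`, because r + s < R - s.
  obtain ⟨s, hs⟩ : ∃ s : ℝ, s = (R - r) / 4 := ⟨_, rfl⟩
  have hs0 : 0 < s := by rw [hs]; linarith
  have hsint : ((s : ℂ)).re ∈ interior (integrableExpSet Y P) := by
    have : Ioi (0 : ℝ) ⊆ integrableExpSet Y P := fun x hx => hint x (le_of_lt hx)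
    exact interior_maximal this isOpen_Ioi (by simpa using hs0)
  have heq : φ =ᶠ[𝓝 (s : ℂ)] complexMGF Y P := by
    have h1 : Metric.ball (0 : ℂ) R ∈ 𝓝 (s : ℂ) := by
      refine Metric.isOpen_ball.mem_nhds ?_
      rw [mem_ball_zero_iff, Complex.norm_real, Real.norm_eq_abs, abs_of_pos hs0]
      rw [hs]; linarith
    have h2 : {z : ℂ | 0 < z.re} ∈ 𝓝 (s : ℂ) :=
      (isOpen_lt continuous_const Complex.continuous_re).mem_nhds (by simpa using hs0)
    filter_upwards [h1, h2] with z hz hz'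
    rw [hφ' z hz hz', complexMGF]
    refine integral_congr_ae (ae_of_all _ fun ω => ?_)
    simp only [hY]; push_cast; ring_nf
  have hball : Metric.ball (s : ℂ) (R - s) ⊆ Metric.ball 0 R := by
    refine Metric.ball_subset_ball' ?_
    rw [dist_zero_right, Complex.norm_real, Real.norm_eq_abs, abs_of_pos hs0]; linarith
  have hz : ((-r : ℝ) : ℂ) ∈ Metric.ball (s : ℂ) (R - s) := by
    rw [mem_ball_iff_norm, ← Complex.ofReal_sub, Complex.norm_real, Real.norm_eq_abs, abs_lt]
    constructor <;> linarith
  have hsum := (Complex.hasSum_taylorSeries_on_ball (hφ.mono hball) hz).summable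
  -- The sign (-1)^n of the n-th derivative cancels the sign of (-r - s)^n. The series at `-r` thus
  -- has nonnegative terms, and its summability is an honest bound.
  have hterm : ∀ n : ℕ, (n.factorial : ℂ)⁻¹ • (((-r : ℝ) : ℂ) - s) ^ n • iteratedDeriv n φ s
      = ((∫ ω, (n.factorial : ℝ)⁻¹ * ((r + s) * X.A ω) ^ n * Real.exp (-(s * X.A ω)) ∂P : ℝ) : ℂ) := by
    intro n
    rw [heq.iteratedDeriv_eq n, iteratedDeriv_complexMGF hsint n, ← integral_complex_ofReal]
    simp only [smul_eq_mul]
    rw [← integral_const_mul, ← integral_const_mul]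
    refine integral_congr_ae (ae_of_all _ fun ω => ?_)
    simp only [hY]
    push_cast
    rw [mul_pow, show (-(r : ℂ) - s) = -1 * (r + s) by ring, mul_pow, neg_pow (X.A ω : ℂ)]
    have h1 : ((-1 : ℂ) ^ n) * (-1) ^ n = 1 := by rw [← mul_pow]; simp
    linear_combination (norm := ring_nf) ((n.factorial : ℂ)⁻¹ * (r + s) ^ n * (X.A ω) ^ n *
      Complex.exp (s * -X.A ω)) * h1
  simp_rw [hterm] at hsum
  have hg0 : ∀ n ω, 0 ≤ (n.factorial : ℝ)⁻¹ * ((r + s) * X.A ω) ^ n * Real.exp (-(s * X.A ω)) := by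
    intro n ω
    have := X.A_pos ω
    positivity
  have hgi : ∀ n : ℕ, Integrable (fun ω => (n.factorial : ℝ)⁻¹ * ((r + s) * X.A ω) ^ n *
      Real.exp (-(s * X.A ω))) P := by
    intro n
    have := (integrable_pow_mul_exp_of_mem_interior_integrableExpSet hsint n).const_mul
      ((n.factorial : ℝ)⁻¹ * (-(r + s)) ^ n)
    refine this.congr (ae_of_all _ fun ω => ?_)
    simp only [hY, Complex.ofReal_re]
    rw [show (r + s) * X.A ω = -(r + s) * -X.A ω by ring, mul_pow (-(r + s))]
    ring_nf
  have hpt : ∀ ω, HasSum (fun n : ℕ => (n.factorial : ℝ)⁻¹ * ((r + s) * X.A ω) ^ n *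
      Real.exp (-(s * X.A ω))) (Real.exp (r * X.A ω)) := by
    intro ω
    have h1 : HasSum (fun n : ℕ => ((r + s) * X.A ω) ^ n / (n.factorial : ℝ))
        (Real.exp ((r + s) * X.A ω)) := by
      rw [Real.exp_eq_exp_ℝ]; exact NormedSpace.expSeries_div_hasSum_exp _
    have h2 : Real.exp (r * X.A ω) = Real.exp ((r + s) * X.A ω) * Real.exp (-(s * X.A ω)) := by
      rw [← Real.exp_add]; ring_nf
    rw [h2]
    simp only [div_eq_inv_mul] at h1
    exact h1.mul_right (Real.exp (-(s * X.A ω)))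
  refine ⟨by have := X.measurable_A; fun_prop, ?_⟩
  -- Nonnegativity allows the sum and the expectation to be exchanged before integrability of the
  -- limit is known.
  have : ∫⁻ ω, ‖Real.exp (r * X.A ω)‖ₑ ∂P = ∑' n : ℕ, ENNReal.ofReal
      (∫ ω, (n.factorial : ℝ)⁻¹ * ((r + s) * X.A ω) ^ n * Real.exp (-(s * X.A ω)) ∂P) := by
    simp_rw [fun n => ofReal_integral_eq_lintegral_ofReal (hgi n) (ae_of_all _ (hg0 n))]
    rw [← lintegral_tsum fun n => (hgi n).aemeasurable.ennreal_ofReal]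
    refine lintegral_congr fun ω => ?_
    rw [← ENNReal.ofReal_tsum_of_nonneg (fun n => hg0 n ω) (hpt ω).summable, (hpt ω).tsum_eq,
      Real.enorm_eq_ofReal (Real.exp_pos _).le]
  rw [hasFiniteIntegral_iff_enorm, this]
  exact (Complex.summable_ofReal.mp hsum).tsum_ofReal_lt_top

/-- Exponential moments below the radius are finite. -/
theorem integrable_exp_of_lt_radius {P : Measure Ω} [IsProbabilityMeasure P]
    (X : RandomlyScaledFBM P) {r : ℝ} (hr : 0 ≤ r) (h : ENNReal.ofReal r < X.radius) :
    Integrable (fun ω => Real.exp (r * X.A ω)) P := by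
  obtain ⟨R, hR⟩ := lt_iSup_iff.mp h
  obtain ⟨⟨hR0, hR1⟩, hR2⟩ := lt_iSup_iff.mp hR
  exact integrable_exp_of_laplaceExtends X hr ((ENNReal.ofReal_lt_ofReal_iff hR0).mp hR2) hR1


/-! ### The Wiener integral -/

/-- The norm of a finite linear combination depends only on the Gram matrix of the vectors, so
matching Gram matrices give an isometry on the span of `e`, which extends by density. -/
theorem exists_linearIsometry_of_inner_eq {ι E K : Type*} [NormedAddCommGroup E]
    [InnerProductSpace ℝ E] [NormedAddCommGroup K] [InnerProductSpace ℝ K] [CompleteSpace K]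
    (e : ι → E) (b : ι → K) (h : ∀ i j, ⟪e i, e j⟫ = ⟪b i, b j⟫)
    (hd : (Submodule.span ℝ (range e)).topologicalClosure = ⊤) :
    ∃ J : E →ₗᵢ[ℝ] K, ∀ i, J (e i) = b i := by
  set Le := Finsupp.linearCombination ℝ e
  set Lb := Finsupp.linearCombination ℝ b
  have hn : ∀ x, ‖Lb x‖ = ‖Le x‖ := by
    intro x
    have : ⟪Lb x, Lb x⟫ = ⟪Le x, Le x⟫ := by
      simp only [Le, Lb, Finsupp.linearCombination_apply, Finsupp.sum, sum_inner, inner_sum,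
        real_inner_smul_left, real_inner_smul_right, h]
    rw [real_inner_self_eq_norm_sq, real_inner_self_eq_norm_sq] at this
    exact (sq_eq_sq₀ (norm_nonneg _) (norm_nonneg _)).mp this
  have hdr : DenseRange Le := by
    rw [DenseRange, ← LinearMap.coe_range, Finsupp.range_linearCombination]
    exact Submodule.dense_iff_topologicalClosure_eq_top.mpr hd
  have hC : ∃ C, ∀ x, ‖Lb x‖ ≤ C * ‖Le x‖ := ⟨1, fun x => by rw [hn, one_mul]⟩
  set J := Lb.extendOfNorm Le
  have hJ : ∀ x, J (Le x) = Lb x := Lb.extendOfNorm_eq hdr hC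
  have hJn : ∀ y, ‖J y‖ = ‖y‖ := by
    intro y
    refine hdr.induction_on (p := fun y => ‖J y‖ = ‖y‖) y ?_ fun x => by rw [hJ, hn]
    exact isClosed_eq J.continuous.norm continuous_norm
  refine ⟨⟨J.toLinearMap, hJn⟩, fun i => ?_⟩
  have := hJ (Finsupp.single i 1)
  simpa [Le, Lb] using this

theorem ind_eq_sub (s t x : ℝ) : ind s t x = ind 0 t x - ind 0 s x := by
  unfold ind
  split_ifs <;> grind

theorem measurable_ind (s t : ℝ) : Measurable (ind s t) := by
  unfold ind
  refine Measurable.ite ?_ measurable_const (Measurable.ite ?_ measurable_const measurable_const)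
  · exact measurableSet_Ico
  · exact measurableSet_Ico

theorem ind_eq_indicator {s t : ℝ} (h : s ≤ t) : ind s t = (Ico s t).indicator 1 := by
  ext x
  unfold ind
  by_cases hx : x ∈ Ico s t
  · rw [indicator_of_mem hx]; exact if_pos hx
  · rw [indicator_of_notMem hx]
    refine (if_neg hx).trans (if_neg ?_)
    rintro ⟨h1, h2⟩; linarith

theorem ind_eq_neg_indicator {s t : ℝ} (h : t ≤ s) : ind s t = -(Ico t s).indicator 1 := by
  rw [← ind_eq_indicator h]
  ext x
  simp only [Pi.neg_apply]
  rw [ind_eq_sub s t, ind_eq_sub t s]; ring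

theorem memLp_ind (s t : ℝ) (p : ℝ≥0∞) : MemLp (ind s t) p volume := by
  rcases le_total s t with h | h
  · rw [ind_eq_indicator h]
    exact memLp_indicator_const p measurableSet_Ico 1 (Or.inr (by simp))
  · rw [ind_eq_neg_indicator h]
    exact (memLp_indicator_const p measurableSet_Ico 1 (Or.inr (by simp))).neg

/-- The Gram matrix of the indicators is the Brownian covariance; this makes the map from 1_(0,t) to
B_t isometric. -/
theorem integral_ind_mul_ind (s t : ℝ) :
    ∫ x, ind 0 s x * ind 0 t x = (|s| + |t| - |t - s|) / 2 := by
  wlog hst : s ≤ t generalizing s t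
  · have := this t s (by linarith)
    simp_rw [mul_comm (ind 0 s _)]
    rw [this, abs_sub_comm]; ring
  rw [abs_of_nonneg (sub_nonneg.mpr hst)]
  rcases le_total 0 s with h0 | h0
  · rw [ind_eq_indicator h0, ind_eq_indicator (h0.trans hst)]
    have : (fun x => (Ico 0 s).indicator (1 : ℝ → ℝ) x * (Ico 0 t).indicator 1 x)
        = (Ico 0 s).indicator 1 := by
      ext x
      rw [← Set.inter_indicator_mul]
      rw [inter_eq_left.mpr (Ico_subset_Ico_right hst)]; simp [indicator]
    rw [this, integral_indicator_one measurableSet_Ico, abs_of_nonneg h0,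
      abs_of_nonneg (h0.trans hst)]
    simp [h0]; ring
  · rcases le_total 0 t with h1 | h1
    · have : ∀ x, ind 0 s x * ind 0 t x = 0 := by
        intro x; unfold ind; split_ifs <;> grind
      simp_rw [this, abs_of_nonpos h0, abs_of_nonneg h1]; simp; ring
    · rw [ind_eq_neg_indicator h0, ind_eq_neg_indicator h1]
      have : (fun x => (-(Ico s 0).indicator (1 : ℝ → ℝ)) x * (-(Ico t 0).indicator 1) x)
          = (Ico t 0).indicator 1 := by
        ext x
        simp only [Pi.neg_apply, neg_mul_neg]
        rw [← Set.inter_indicator_mul, inter_comm]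
        rw [inter_eq_left.mpr (Ico_subset_Ico_left hst)]; simp [indicator]
      rw [this, integral_indicator_one measurableSet_Ico, abs_of_nonpos h0, abs_of_nonpos h1]
      simp [h1]; ring

/-- All primitives of `g` vanish, and Lebesgue's differentiation theorem recovers `g` from them
almost everywhere. -/
theorem ae_eq_zero_of_forall_integral_ind {g : ℝ → ℝ} (hg : LocallyIntegrable g volume)
    (h : ∀ t, ∫ x, ind 0 t x * g x = 0) : g =ᵐ[volume] 0 := by
  have key : ∀ a b : ℝ, ∫ x in a..b, g x = 0 := by
    have h0 : ∀ t : ℝ, ∫ x in (0:ℝ)..t, g x = 0 := by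
      intro t
      have := h t
      rcases le_total 0 t with h1 | h1
      · rw [ind_eq_indicator h1] at this
        rw [intervalIntegral.integral_of_le h1, ← integral_Ico_eq_integral_Ioc,
          ← integral_indicator measurableSet_Ico]
        refine Eq.trans (congrArg _ (funext fun x => ?_)) this
        simp [indicator]
      · rw [ind_eq_neg_indicator h1] at this
        rw [intervalIntegral.integral_of_ge h1, ← integral_Ico_eq_integral_Ioc,
          ← integral_indicator measurableSet_Ico, ← integral_neg]
        refine Eq.trans (congrArg _ (funext fun x => ?_)) this
        simp [indicator]
    intro a b
    have hi : ∀ c d : ℝ, IntervalIntegrable g volume c d := fun c d =>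
      intervalIntegrable_iff.mpr <|
        (hg.integrableOn_isCompact isCompact_uIcc).mono_set uIoc_subset_uIcc
    rw [← intervalIntegral.integral_add_adjacent_intervals (hi a 0) (hi 0 b), h0 b,
      intervalIntegral.integral_symm, h0 a]; simp
  have := hg
  filter_upwards [LocallyIntegrable.ae_hasDerivAt_integral hg] with x hx
  have := hx 0
  simp_rw [key] at this
  exact (this.unique (hasDerivAt_const _ _))

theorem span_ind_dense : (Submodule.span ℝ
    (range fun t : ℝ => (memLp_ind 0 t 2).toLp (ind 0 t))).topologicalClosure = ⊤ := by
  rw [Submodule.topologicalClosure_eq_top_iff, Submodule.eq_bot_iff]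
  intro g hg
  have : ⇑g =ᵐ[volume] 0 := by
    refine ae_eq_zero_of_forall_integral_ind ((Lp.memLp g).locallyIntegrable (by norm_num)) ?_
    intro t
    have := (Submodule.mem_orthogonal _ _).mp hg _ (Submodule.subset_span (mem_range_self t))
    rw [L2.inner_def] at this
    refine Eq.trans (integral_congr_ae ?_) this
    filter_upwards [(memLp_ind 0 t 2).coeFn_toLp] with x hx
    rw [hx]; simp [mul_comm]
  exact (Lp.eq_zero_iff_ae_eq_zero).mpr this


theorem toLp_finsetSum {α ι : Type*} [MeasurableSpace α] {μ : Measure α} {p : ℝ≥0∞} (s : Finset ι)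
    (f : ι → α → ℝ) (hf : ∀ i, MemLp (f i) p μ) :
    ∑ i ∈ s, (hf i).toLp (f i) =
      (memLp_finsetSum s fun i _ => hf i).toLp (fun x => ∑ i ∈ s, f i x) := by
  classical
  induction s using Finset.induction_on with
  | empty =>
    simp only [Finset.sum_empty]
    exact (MemLp.toLp_zero _).symm
  | insert a s ha ih =>
    simp only [Finset.sum_insert ha, ih]
    rw [← MemLp.toLp_add]
    rfl

namespace IsTwoSidedBrownianMotion

variable {P : Measure Ω} {B : ℝ → Ω → ℝ}

theorem memLp (hB : IsTwoSidedBrownianMotion P B) (t : ℝ) : MemLp (B t) 2 P :=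
  (hB.gaussian.hasGaussianLaw_eval t).memLp_two

variable [IsProbabilityMeasure P]

theorem integral_mul (hB : IsTwoSidedBrownianMotion P B) (s t : ℝ) :
    ∫ ω, B s ω * B t ω ∂P = (|s| + |t| - |t - s|) / 2 := by
  rw [← hB.covariance s t, covariance_eq_sub (hB.memLp s) (hB.memLp t), hB.centered, hB.centered]
  simp

theorem exists_isometry (hB : IsTwoSidedBrownianMotion P B) :
    ∃ J : Lp ℝ 2 (volume : Measure ℝ) →ₗᵢ[ℝ] Lp ℝ 2 P,
      ∀ t, J ((memLp_ind 0 t 2).toLp (ind 0 t)) = (hB.memLp t).toLp (B t) := by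
  refine exists_linearIsometry_of_inner_eq _ _ (fun s t => ?_) span_ind_dense
  rw [L2.inner_def, L2.inner_def]
  trans (|s| + |t| - |t - s|) / 2
  · rw [← integral_ind_mul_ind]
    refine integral_congr_ae ?_
    filter_upwards [(memLp_ind 0 s 2).coeFn_toLp, (memLp_ind 0 t 2).coeFn_toLp] with x hx hx'
    rw [hx, hx']; simp [mul_comm]
  · rw [← hB.integral_mul]
    refine integral_congr_ae ?_
    filter_upwards [(hB.memLp s).coeFn_toLp, (hB.memLp t).coeFn_toLp] with x hx hx'
    rw [hx, hx']; simp [mul_comm]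

/-- The isometry `L²(ℝ) → L²(P)` extending `1_(0,t) ↦ B_t`. -/
def isometry (hB : IsTwoSidedBrownianMotion P B) :
    Lp ℝ 2 (volume : Measure ℝ) →ₗᵢ[ℝ] Lp ℝ 2 P := hB.exists_isometry.choose

theorem isometry_ind (hB : IsTwoSidedBrownianMotion P B) (t : ℝ) :
    hB.isometry ((memLp_ind 0 t 2).toLp (ind 0 t)) = (hB.memLp t).toLp (B t) :=
  hB.exists_isometry.choose_spec t

theorem memLp_stepSum {n : ℕ} (c s t : Fin n → ℝ) :
    MemLp (fun x => ∑ i, c i * ind (s i) (t i) x) 2 volume :=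
  memLp_finsetSum _ fun i _ => (memLp_ind (s i) (t i) 2).const_mul (c i)

theorem memLp_incrementSum (hB : IsTwoSidedBrownianMotion P B) {n : ℕ} (c s t : Fin n → ℝ) :
    MemLp (fun ω => ∑ i, c i * (B (t i) ω - B (s i) ω)) 2 P :=
  memLp_finsetSum _ fun i _ => ((hB.memLp (t i)).sub (hB.memLp (s i))).const_mul (c i)

theorem isometry_stepSum (hB : IsTwoSidedBrownianMotion P B) {n : ℕ} (c s t : Fin n → ℝ) :
    hB.isometry ((memLp_stepSum c s t).toLp _) = (hB.memLp_incrementSum c s t).toLp _ := by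
  have h1 : (memLp_stepSum c s t).toLp _ = ∑ i, c i • ((memLp_ind 0 (t i) 2).toLp (ind 0 (t i))
      - (memLp_ind 0 (s i) 2).toLp (ind 0 (s i))) := by
    simp_rw [← MemLp.toLp_sub, ← MemLp.toLp_const_smul]
    rw [toLp_finsetSum]
    · refine MemLp.toLp_congr _ _ (ae_of_all _ fun x => ?_)
      simp only [Pi.smul_apply, Pi.sub_apply, smul_eq_mul]
      exact Finset.sum_congr rfl fun i _ => by rw [ind_eq_sub]
  have h2 : (hB.memLp_incrementSum c s t).toLp _
      = ∑ i, c i • ((hB.memLp (t i)).toLp (B (t i)) - (hB.memLp (s i)).toLp (B (s i))) := by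
    simp_rw [← MemLp.toLp_sub, ← MemLp.toLp_const_smul]
    rw [toLp_finsetSum]
    · refine MemLp.toLp_congr _ _ (ae_of_all _ fun x => ?_)
      simp
  rw [h1, h2, map_sum]
  simp only [map_smul, map_sub, isometry_ind]

/-- Step functions close to `f` force `Y` and the isometric image to be close to the same sum of
increments. Hence the choice made in `wienerIntegral` is harmless. -/
theorem ae_eq_isometry (hB : IsTwoSidedBrownianMotion P B) {f : ℝ → ℝ} (hf : MemLp f 2 volume)
    {Y : Ω → ℝ} (h : IsWienerIntegral P B f Y) : Y =ᵐ[P] hB.isometry (hf.toLp f) := by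
  obtain ⟨hY, h⟩ := h
  suffices hs : hY.toLp Y = hB.isometry (hf.toLp f) by
    rw [← hs]; exact hY.coeFn_toLp.symm
  refine eq_of_forall_dist_le fun ε hε => ?_
  obtain ⟨n, c, s, t, h1, h2⟩ := h (ENNReal.ofReal (ε / 2)) (by simpa using hε)
  set g := (memLp_stepSum c s t).toLp _
  set y := (hB.memLp_incrementSum c s t).toLp _
  have hg : hB.isometry g = y := hB.isometry_stepSum c s t
  have d1 : dist (hf.toLp f) g ≤ ε / 2 := by
    rw [dist_eq_norm, ← MemLp.toLp_sub, Lp.norm_toLp]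
    exact ENNReal.toReal_le_of_le_ofReal (by positivity) h1
  have d2 : dist (hY.toLp Y) y ≤ ε / 2 := by
    rw [dist_eq_norm, ← MemLp.toLp_sub, Lp.norm_toLp]
    exact ENNReal.toReal_le_of_le_ofReal (by positivity) h2
  have d3 : dist (hB.isometry (hf.toLp f)) y ≤ ε / 2 := by
    rw [← hg, hB.isometry.dist_map]; exact d1
  linarith [dist_triangle_right (hY.toLp Y) (hB.isometry (hf.toLp f)) y]

theorem isWienerIntegral_isometry (hB : IsTwoSidedBrownianMotion P B) {f : ℝ → ℝ}
    (hf : MemLp f 2 volume) : IsWienerIntegral P B f (hB.isometry (hf.toLp f)) := by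
  refine ⟨Lp.memLp _, fun ε hε => ?_⟩
  -- The tolerance ε may be infinite, whereas the metric density argument needs a real radius.
  obtain ⟨δ, hδ0, hδ⟩ : ∃ δ : ℝ, 0 < δ ∧ ENNReal.ofReal δ ≤ ε := by
    rcases eq_or_ne ε ⊤ with rfl | h
    · exact ⟨1, one_pos, le_top⟩
    · exact ⟨ε.toReal, ENNReal.toReal_pos hε.ne' h, by rw [ENNReal.ofReal_toReal h]⟩
  have hd := Submodule.dense_iff_topologicalClosure_eq_top.mpr span_ind_dense
  obtain ⟨g, hg, hfg⟩ := Metric.dense_iff.mp hd (hf.toLp f) δ hδ0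
  rw [SetLike.mem_coe, Finsupp.mem_span_range_iff_exists_finsupp] at hfg
  obtain ⟨c, rfl⟩ := hfg
  set e := c.support.equivFin
  have hgs : (c.sum fun i a => a • (memLp_ind 0 i 2).toLp (ind 0 i)) =
      (memLp_stepSum (fun i => c (e.symm i)) (fun _ => 0) (fun i => e.symm i)).toLp _ := by
    rw [Finsupp.sum, ← Finset.sum_coe_sort, ← e.symm.sum_comp]
    simp_rw [← MemLp.toLp_const_smul]
    rw [toLp_finsetSum]
    refine MemLp.toLp_congr _ _ (ae_of_all _ fun x => ?_)
    simp
  rw [hgs] at hg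
  refine ⟨_, fun i => c (e.symm i), fun _ => 0, fun i => e.symm i, le_trans ?_ hδ, le_trans ?_ hδ⟩
  · rw [Metric.mem_ball, dist_comm, dist_eq_norm, ← MemLp.toLp_sub, Lp.norm_toLp] at hg
    refine (ENNReal.ofReal_toReal (hf.sub (memLp_stepSum _ _ _)).eLpNorm_ne_top).symm.trans_le ?_
    exact ENNReal.ofReal_le_ofReal hg.le
  · have h3 : dist (hB.isometry (hf.toLp f)) ((hB.memLp_incrementSum (fun i => c (e.symm i))
        (fun _ => 0) (fun i => e.symm i)).toLp _) < δ := by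
      rw [← hB.isometry_stepSum, hB.isometry.dist_map, dist_comm]; exact hg
    rw [dist_eq_norm, Lp.norm_def] at h3
    have h4 : eLpNorm (fun ω => hB.isometry (hf.toLp f) ω - ∑ i, c (e.symm i) *
        (B (e.symm i) ω - B 0 ω)) 2 P = eLpNorm (hB.isometry (hf.toLp f) -
        (hB.memLp_incrementSum (fun i => c (e.symm i)) (fun _ => 0) (fun i => e.symm i)).toLp _ :
        Lp ℝ 2 P) 2 P := by
      refine eLpNorm_congr_ae ?_
      filter_upwards [Lp.coeFn_sub (hB.isometry (hf.toLp f)) ((hB.memLp_incrementSum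
        (fun i => c (e.symm i)) (fun _ => 0) (fun i => e.symm i)).toLp _),
        (hB.memLp_incrementSum (fun i => c (e.symm i)) (fun _ => 0)
          (fun i => e.symm i)).coeFn_toLp] with ω h5 h6
      rw [h5, Pi.sub_apply, h6]
    rw [h4, ← ENNReal.ofReal_toReal (Lp.eLpNorm_ne_top _)]
    exact ENNReal.ofReal_le_ofReal h3.le

theorem wienerIntegral_ae_eq (hB : IsTwoSidedBrownianMotion P B) {f : ℝ → ℝ}
    (hf : MemLp f 2 volume) : wienerIntegral P B f =ᵐ[P] hB.isometry (hf.toLp f) := by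
  have h : ∃ Y, IsWienerIntegral P B f Y := ⟨_, hB.isWienerIntegral_isometry hf⟩
  rw [wienerIntegral, dif_pos h]
  exact hB.ae_eq_isometry hf h.choose_spec

/-- A property of elements of `L²(ℝ)` that is closed and holds for step functions holds
everywhere. -/
theorem _root_.ScaledFBM.Lp_induction_ind {p : Lp ℝ 2 (volume : Measure ℝ) → Prop}
    (hp : IsClosed {f | p f})
    (h : ∀ c : ℝ →₀ ℝ, p (c.sum fun t a => a • (memLp_ind 0 t 2).toLp (ind 0 t)))
    (f : Lp ℝ 2 (volume : Measure ℝ)) : p f := by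
  have hd := Submodule.dense_iff_topologicalClosure_eq_top.mpr span_ind_dense
  refine hd.induction (fun g hg => ?_) hp f
  rw [SetLike.mem_coe, Finsupp.mem_span_range_iff_exists_finsupp] at hg
  obtain ⟨c, rfl⟩ := hg
  exact h c

theorem isometry_sum_ae_eq (hB : IsTwoSidedBrownianMotion P B) (c : ℝ →₀ ℝ) :
    hB.isometry (c.sum fun t a => a • (memLp_ind 0 t 2).toLp (ind 0 t)) =ᵐ[P]
      fun ω => ∑ t ∈ c.support, c t • B t ω := by
  rw [Finsupp.sum, map_sum]
  simp_rw [map_smul, isometry_ind, ← MemLp.toLp_const_smul]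
  rw [toLp_finsetSum]
  refine (MemLp.coeFn_toLp _).trans (ae_of_all _ fun ω => ?_)
  simp

/-- Independence is assumed between `A` and the path of `B`, so Wiener integrals must be seen to be
measurable for the path alone. This holds for step functions and survives L² limits. -/
theorem aestronglyMeasurable_isometry (hB : IsTwoSidedBrownianMotion P B)
    (f : Lp ℝ 2 (volume : Measure ℝ)) :
    AEStronglyMeasurable[MeasurableSpace.comap (fun ω t => B t ω) inferInstance]
      (hB.isometry f) P := by
  have hm : MeasurableSpace.comap (fun ω t => B t ω) inferInstance ≤ ‹MeasurableSpace Ω› :=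
    (measurable_pi_lambda _ fun t => hB.measurable t).comap_le
  refine Lp_induction_ind (p := fun f => AEStronglyMeasurable[MeasurableSpace.comap
    (fun ω t => B t ω) inferInstance] (hB.isometry f) P) ?_ (fun c => ?_) f
  · exact (isClosed_aestronglyMeasurable (F := ℝ) (p := 2) (μ := P) hm).preimage
      hB.isometry.continuous
  · refine AEStronglyMeasurable.congr (StronglyMeasurable.aestronglyMeasurable ?_)
      (hB.isometry_sum_ae_eq c).symm
    refine Measurable.stronglyMeasurable ?_
    refine Finset.measurable_fun_sum _ fun t _ => Measurable.const_mul ?_ _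
    have ht : Measurable fun w : ℝ → ℝ => w t := measurable_pi_apply t
    exact ht.comp (comap_measurable _)

theorem _root_.ScaledFBM.norm_cexp_mul_I_sub_le (x y : ℝ) :
    ‖Complex.exp (x * Complex.I) - Complex.exp (y * Complex.I)‖ ≤ |x - y| := by
  have h : Complex.exp (x * Complex.I) - Complex.exp (y * Complex.I)
      = Complex.exp (y * Complex.I) * (Complex.exp (Complex.I * ((x - y : ℝ) : ℂ)) - 1) := by
    rw [mul_sub, ← Complex.exp_add]; push_cast; ring_nf
  rw [h, norm_mul, Complex.norm_exp_ofReal_mul_I, one_mul]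
  exact Real.norm_exp_I_mul_ofReal_sub_one_le

/-- The map x ↦ exp(ix) is 1-Lipschitz, and the L¹ norm is at most the L² norm on a probability
space. -/
theorem _root_.ScaledFBM.continuous_integral_cexp :
    Continuous fun g : Lp ℝ 2 P => ∫ ω, Complex.exp (g ω * Complex.I) ∂P := by
  have hi : ∀ g : Lp ℝ 2 P, Integrable (fun ω => Complex.exp (g ω * Complex.I)) P := by
    intro g
    refine Integrable.of_bound (C := 1) ?_ (ae_of_all _ fun ω => ?_)
    · have := Lp.aestronglyMeasurable g
      exact (Complex.continuous_exp.comp_aestronglyMeasurable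
        ((Complex.continuous_ofReal.comp_aestronglyMeasurable this).mul_const _))
    · rw [Complex.norm_exp_ofReal_mul_I]
  refine LipschitzWith.continuous (K := 1) (LipschitzWith.of_dist_le_mul fun g h => ?_)
  rw [dist_eq_norm, ← integral_sub (hi g) (hi h), NNReal.coe_one, one_mul, dist_eq_norm]
  calc _ ≤ ∫ ω, ‖(g - h : Lp ℝ 2 P) ω‖ ∂P := by
        refine norm_integral_le_of_norm_le ((Lp.memLp (g - h)).integrable (by norm_num)).norm ?_
        filter_upwards [Lp.coeFn_sub g h] with ω hω
        rw [hω]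
        exact norm_cexp_mul_I_sub_le _ _
    _ = (eLpNorm (g - h : Lp ℝ 2 P) 1 P).toReal := by
        rw [integral_norm_eq_lintegral_enorm (Lp.aestronglyMeasurable _),
          eLpNorm_one_eq_lintegral_enorm]
    _ ≤ ‖g - h‖ := by
        rw [Lp.norm_def]
        exact ENNReal.toReal_mono (Lp.eLpNorm_ne_top _)
          (eLpNorm_le_eLpNorm_of_exponent_le (by norm_num) (Lp.aestronglyMeasurable _))

/-- For step functions this is the Gaussian law of a linear combination of Brownian values. Both
sides are continuous in `f`. -/
theorem charFun_isometry (hB : IsTwoSidedBrownianMotion P B) (f : Lp ℝ 2 (volume : Measure ℝ)) :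
    ∫ ω, Complex.exp (hB.isometry f ω * Complex.I) ∂P = Complex.exp (-(‖f‖ ^ 2 / 2 : ℝ)) := by
  refine Lp_induction_ind (p := fun f => ∫ ω, Complex.exp (hB.isometry f ω * Complex.I) ∂P =
    Complex.exp (-(‖f‖ ^ 2 / 2 : ℝ))) ?_ (fun c => ?_) f
  · refine isClosed_eq (continuous_integral_cexp.comp hB.isometry.continuous) ?_
    fun_prop
  · set g := c.sum fun t a => a • (memLp_ind 0 t 2).toLp (ind 0 t)
    have hG : HasGaussianLaw (hB.isometry g) P :=
      (hB.gaussian.smul (fun t => c t)).hasGaussianLaw_fun_sum.congr (hB.isometry_sum_ae_eq c).symm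
    have h0 : ∫ ω, hB.isometry g ω ∂P = 0 := by
      rw [integral_congr_ae (hB.isometry_sum_ae_eq c), integral_finsetSum]
      · simp [integral_const_mul, hB.centered]
      · exact fun t _ => ((hB.memLp t).integrable (by norm_num)).const_mul (c t)
    have h1 : Var[hB.isometry g; P] = ‖g‖ ^ 2 := by
      rw [variance_of_integral_eq_zero (Lp.aestronglyMeasurable _).aemeasurable h0,
        ← hB.isometry.norm_map, ← real_inner_self_eq_norm_sq, L2.inner_def]
      simp [sq]
    have h2 := hG.map_eq_gaussianReal
    have h3 := charFun_gaussianReal (μ := P[hB.isometry g])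
      (v := Var[hB.isometry g; P].toNNReal) (1 : ℝ)
    rw [← h2, charFun_apply_real, integral_map (Lp.aestronglyMeasurable _).aemeasurable
      (by fun_prop), h0, h1] at h3
    simp only [Complex.ofReal_one, one_mul] at h3
    rw [h3, Real.coe_toNNReal _ (by positivity)]
    congr 1
    push_cast; ring

theorem map_isometry (hB : IsTwoSidedBrownianMotion P B) (f : Lp ℝ 2 (volume : Measure ℝ)) :
    P.map (hB.isometry f) = gaussianReal 0 (‖f‖ ^ 2).toNNReal := by
  have hm := (Lp.aestronglyMeasurable (hB.isometry f)).aemeasurable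
  have := Measure.isProbabilityMeasure_map hm
  refine Measure.ext_of_charFun (funext fun t => ?_)
  rw [charFun_gaussianReal, charFun_apply_real, integral_map hm (by fun_prop),
    Real.coe_toNNReal _ (by positivity)]
  have h := hB.charFun_isometry (t • f)
  rw [map_smul] at h
  rw [integral_congr_ae (g := fun ω => Complex.exp ((t • hB.isometry f : Lp ℝ 2 P) ω * Complex.I)),
    h, norm_smul, Real.norm_eq_abs, mul_pow, sq_abs]
  · congr 1; push_cast; ring
  · filter_upwards [Lp.coeFn_smul t (hB.isometry f)] with ω hω
    rw [hω]; simp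

/-- The formula for a f + b g gives the joint characteristic function, and orthogonality splits ‖a f
+ b g‖² into a²‖f‖² + b²‖g‖², so it factorises. -/
theorem indepFun_isometry (hB : IsTwoSidedBrownianMotion P B)
    {f g : Lp ℝ 2 (volume : Measure ℝ)} (h : ⟪f, g⟫ = 0) :
    IndepFun (hB.isometry f) (hB.isometry g) P := by
  have hm := fun f => (Lp.aestronglyMeasurable (hB.isometry f)).aemeasurable
  rw [indepFun_iff_charFun_prod (hm f) (hm g)]
  intro t
  obtain ⟨⟨a, b⟩, rfl⟩ := (WithLp.toLp_surjective 2) t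
  simp only
  rw [map_isometry, map_isometry, charFun_gaussianReal, charFun_gaussianReal, charFun_apply,
    integral_map (by have := hm f; have := hm g; fun_prop) (by fun_prop), ← Complex.exp_add,
    Real.coe_toNNReal _ (by positivity), Real.coe_toNNReal _ (by positivity)]
  have hs := hB.charFun_isometry (a • f + b • g)
  rw [map_add, map_smul, map_smul] at hs
  rw [integral_congr_ae (g := fun ω => Complex.exp ((a • hB.isometry f + b • hB.isometry g :
    Lp ℝ 2 P) ω * Complex.I)), hs, norm_add_sq_real, norm_smul, norm_smul, real_inner_smul_left,
    real_inner_smul_right, h, Real.norm_eq_abs, Real.norm_eq_abs, mul_pow, mul_pow, sq_abs, sq_abs]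
  · congr 1; push_cast; ring
  · filter_upwards [Lp.coeFn_add (a • hB.isometry f) (b • hB.isometry g),
      Lp.coeFn_smul a (hB.isometry f), Lp.coeFn_smul b (hB.isometry g)] with ω h1 h2 h3
    rw [h1, Pi.add_apply, h2, h3]
    simp [WithLp.prod_inner_apply]

end IsTwoSidedBrownianMotion


/-! ### The joint law of the scaling variable and Wiener integrals -/

/-- The one-dimensional Cameron–Martin formula: complete the square in the density and translate.
Translation invariance holds for arbitrary φ, so no measurability is needed. -/
theorem lintegral_gaussianReal_mul_exp (φ : ℝ → ℝ≥0∞) (s : ℝ) :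
    ∫⁻ x, φ x * ENNReal.ofReal (Real.exp (s * x)) ∂(gaussianReal 0 1) =
      ENNReal.ofReal (Real.exp (s ^ 2 / 2)) * ∫⁻ x, φ (x + s) ∂(gaussianReal 0 1) := by
  rw [gaussianReal_of_var_ne_zero _ one_ne_zero,
    lintegral_withDensity_eq_lintegral_mul_non_measurable _ (measurable_gaussianPDF _ _)
      (ae_of_all _ fun x => gaussianPDF_lt_top),
    lintegral_withDensity_eq_lintegral_mul_non_measurable _ (measurable_gaussianPDF _ _)
      (ae_of_all _ fun x => gaussianPDF_lt_top),
    ← lintegral_const_mul' _ _ ENNReal.ofReal_ne_top,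
    ← lintegral_add_right_eq_self _ s]
  refine lintegral_congr fun x => ?_
  simp only [Pi.mul_apply, gaussianPDF]
  have h : ENNReal.ofReal (gaussianPDFReal 0 1 (x + s)) * ENNReal.ofReal (Real.exp (s * (x + s))) =
      ENNReal.ofReal (Real.exp (s ^ 2 / 2)) * ENNReal.ofReal (gaussianPDFReal 0 1 x) := by
    rw [← ENNReal.ofReal_mul (gaussianPDFReal_nonneg _ _ _), ← ENNReal.ofReal_mul (Real.exp_pos _).le]
    congr 1
    simp only [gaussianPDFReal]
    rw [mul_assoc, mul_left_comm (Real.exp _), ← Real.exp_add, ← Real.exp_add]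
    congr 2
    push_cast; ring
  calc _ = φ (x + s) * (ENNReal.ofReal (gaussianPDFReal 0 1 (x + s)) *
        ENNReal.ofReal (Real.exp (s * (x + s)))) := by ring
    _ = _ := by rw [h]; ring

namespace RandomlyScaledFBM

variable {P : Measure Ω} [IsProbabilityMeasure P] (X : RandomlyScaledFBM P)

theorem indepFun_isometry (f g : Lp ℝ 2 (volume : Measure ℝ)) :
    IndepFun X.A (fun ω => (X.isBrownian.isometry f ω, X.isBrownian.isometry g ω)) P := by
  have h1 := X.isBrownian.aestronglyMeasurable_isometry f
  have h2 := X.isBrownian.aestronglyMeasurable_isometry g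
  have h3 : IndepFun X.A (fun ω => (h1.mk _ ω, h2.mk _ ω)) P := by
    rw [IndepFun_iff_Indep]
    refine indep_of_indep_of_le_right ((IndepFun_iff_Indep _ _ _).mp X.indep) ?_
    exact (h1.stronglyMeasurable_mk.measurable.prodMk h2.stronglyMeasurable_mk.measurable).comap_le
  refine h3.congr (ae_eq_refl _) ?_
  filter_upwards [h1.ae_eq_mk, h2.ae_eq_mk] with ω h4 h5
  rw [h4, h5]

theorem map_isometry_prod {f g : Lp ℝ 2 (volume : Measure ℝ)} (h : ⟪f, g⟫ = 0) :
    P.map (fun ω => (X.A ω, X.isBrownian.isometry f ω, X.isBrownian.isometry g ω)) =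
      (P.map X.A).prod (((gaussianReal 0 1).map (‖f‖ * ·)).prod
        ((gaussianReal 0 1).map (‖g‖ * ·))) := by
  have hm := fun f => (Lp.aestronglyMeasurable (X.isBrownian.isometry f)).aemeasurable
  rw [(indepFun_iff_map_prod_eq_prod_map_map X.measurable_A.aemeasurable
    ((hm f).prodMk (hm g))).mp (X.indepFun_isometry f g),
    (indepFun_iff_map_prod_eq_prod_map_map (hm f) (hm g)).mp (X.isBrownian.indepFun_isometry h),
    X.isBrownian.map_isometry, X.isBrownian.map_isometry, gaussianReal_map_const_mul,
    gaussianReal_map_const_mul]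
  congr <;> simp <;> ext <;> simp

/-- Girsanov's formula. Split g = β f + h with h orthogonal to f. The part along f shifts I(f) by
√a⟨f, g⟩, while I(h) is independent of I(f) and `A` and integrates to exp(a‖h‖²/2). -/
theorem lintegral_mul_exp (f g : Lp ℝ 2 (volume : Measure ℝ)) {G : ℝ × ℝ → ℝ≥0∞}
    (hG : Measurable G) :
    ∫⁻ ω, G (X.A ω, X.isBrownian.isometry f ω) *
        ENNReal.ofReal (Real.exp (√(X.A ω) * X.isBrownian.isometry g ω)) ∂P =
      ∫⁻ p, G (p.1, ‖f‖ * p.2 + √p.1 * ⟪f, g⟫) * ENNReal.ofReal (Real.exp (p.1 * ‖g‖ ^ 2 / 2))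
        ∂((P.map X.A).prod (gaussianReal 0 1)) := by
  -- If f = 0, division by zero gives β = 0, which is still the right coefficient.
  set β : ℝ := ⟪f, g⟫ / ‖f‖ ^ 2 with hβ
  set h := g - β • f with hh
  have hβf : β * ‖f‖ ^ 2 = ⟪f, g⟫ := by
    rcases eq_or_ne f 0 with h0 | h0
    · rw [h0]; simp
    · rw [hβ, div_mul_cancel₀]; positivity
  have hfh : ⟪f, h⟫ = 0 := by
    rw [hh, inner_sub_right, real_inner_smul_right, real_inner_self_eq_norm_sq, hβf, sub_self]
  have hn : ‖g‖ ^ 2 = ‖h‖ ^ 2 + β ^ 2 * ‖f‖ ^ 2 := by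
    have : g = h + β • f := by rw [hh]; abel
    rw [this, norm_add_sq_real, real_inner_smul_right, real_inner_comm, hfh, norm_smul, mul_pow,
      Real.norm_eq_abs, sq_abs]
    ring
  have hJ : X.isBrownian.isometry g =ᵐ[P] fun ω =>
      β * X.isBrownian.isometry f ω + X.isBrownian.isometry h ω := by
    have : X.isBrownian.isometry g = β • X.isBrownian.isometry f + X.isBrownian.isometry h := by
      rw [← map_smul, ← map_add]; congr 1; rw [hh]; abel
    rw [this]
    filter_upwards [Lp.coeFn_add (β • X.isBrownian.isometry f) (X.isBrownian.isometry h),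
      Lp.coeFn_smul β (X.isBrownian.isometry f)] with ω h1 h2
    rw [h1, Pi.add_apply, h2]; rfl
  have hm := fun f => (Lp.aestronglyMeasurable (X.isBrownian.isometry f)).aemeasurable
  have hA := X.measurable_A
  have hfm := hm f
  have hhm := hm h
  have : SFinite (P.map X.A) := inferInstance
  trans ∫⁻ q, G (q.1, q.2.1) * ENNReal.ofReal (Real.exp (√q.1 * (β * q.2.1 + q.2.2)))
      ∂(P.map (fun ω => (X.A ω, X.isBrownian.isometry f ω, X.isBrownian.isometry h ω)))
  · rw [lintegral_map' (by fun_prop) (by fun_prop)]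
    refine lintegral_congr_ae ?_
    filter_upwards [hJ] with ω hω
    rw [hω]
  rw [X.map_isometry_prod hfh, lintegral_prod _ (by fun_prop), lintegral_prod _ (by fun_prop)]
  have hpos : ∀ᵐ a ∂(P.map X.A), 0 < a :=
    (ae_map_iff hA.aemeasurable measurableSet_Ioi).mpr (ae_of_all _ X.A_pos)
  refine lintegral_congr_ae ?_
  filter_upwards [hpos] with a ha
  rw [lintegral_prod _ (by fun_prop), lintegral_map (by fun_prop) (by fun_prop)]
  -- The h-component is integrated out first, by the one-dimensional formula for a function that
  -- does not depend on it.
  have hin : ∀ x, ∫⁻ y, G (a, ‖f‖ * x) * ENNReal.ofReal (Real.exp (√a * (β * (‖f‖ * x) + y)))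
      ∂((gaussianReal 0 1).map (‖h‖ * ·)) = ENNReal.ofReal (Real.exp (a * ‖h‖ ^ 2 / 2)) *
        (G (a, ‖f‖ * x) * ENNReal.ofReal (Real.exp ((√a * β * ‖f‖) * x))) := by
    intro x
    rw [lintegral_map (by fun_prop) (by fun_prop)]
    have := lintegral_gaussianReal_mul_exp (fun _ => G (a, ‖f‖ * x) *
      ENNReal.ofReal (Real.exp ((√a * β * ‖f‖) * x))) (√a * ‖h‖)
    rw [lintegral_const, measure_univ, mul_one, mul_pow, Real.sq_sqrt ha.le] at this
    rw [← this]
    refine lintegral_congr fun y => ?_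
    rw [mul_assoc, ← ENNReal.ofReal_mul (Real.exp_pos _).le, ← Real.exp_add]
    ring_nf
  simp_rw [hin]
  rw [lintegral_const_mul _ (by fun_prop), lintegral_gaussianReal_mul_exp, ← mul_assoc,
    ← ENNReal.ofReal_mul (Real.exp_pos _).le, ← Real.exp_add,
    lintegral_mul_const _ (by fun_prop), mul_comm]
  congr 1
  · refine lintegral_congr fun x => ?_
    congr 2
    rw [← hβf]; ring
  · rw [hn, mul_pow, mul_pow, Real.sq_sqrt ha.le]; congr 2; ring

/-- The identity for all nonnegative `G` is an equality of measures; in this form it yields both the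
integrability criterion and the integral of a signed `G`. -/
theorem map_withDensity_exp (f g : Lp ℝ 2 (volume : Measure ℝ)) :
    (P.withDensity fun ω => ENNReal.ofReal
        (Real.exp (√(X.A ω) * X.isBrownian.isometry g ω))).map
        (fun ω => (X.A ω, X.isBrownian.isometry f ω)) =
      (((P.map X.A).prod (gaussianReal 0 1)).withDensity fun p =>
        ENNReal.ofReal (Real.exp (p.1 * ‖g‖ ^ 2 / 2))).map
          fun p => (p.1, ‖f‖ * p.2 + √p.1 * ⟪f, g⟫) := by
  have hm := fun f => (Lp.aestronglyMeasurable (X.isBrownian.isometry f)).aemeasurable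
  have hA := X.measurable_A
  have hfm := hm f
  have hgm := hm g
  have hac : (P.withDensity fun ω => ENNReal.ofReal
        (Real.exp (√(X.A ω) * X.isBrownian.isometry g ω))) ≪ P := withDensity_absolutelyContinuous _ _
  have hpm : AEMeasurable (fun ω => (X.A ω, X.isBrownian.isometry f ω)) P := by fun_prop
  refine Measure.ext_of_lintegral _ fun G hG => ?_
  rw [lintegral_map' (by fun_prop) (hpm.mono_ac hac), lintegral_map (by fun_prop) (by fun_prop),
    lintegral_withDensity_eq_lintegral_mul₀ (g := fun ω => G (X.A ω, X.isBrownian.isometry f ω))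
      (by fun_prop) (hG.comp_aemeasurable hpm),
    lintegral_withDensity_eq_lintegral_mul₀ (by fun_prop) (by fun_prop)]
  simp only [Pi.mul_apply]
  simp_rw [mul_comm (ENNReal.ofReal _)]
  exact X.lintegral_mul_exp f g hG

theorem integrable_mul_exp_iff (f g : Lp ℝ 2 (volume : Measure ℝ)) {G : ℝ × ℝ → ℝ}
    (hG : Measurable G) :
    Integrable (fun ω => G (X.A ω, X.isBrownian.isometry f ω) *
        Real.exp (√(X.A ω) * X.isBrownian.isometry g ω)) P ↔
      Integrable (fun p : ℝ × ℝ => G (p.1, ‖f‖ * p.2 + √p.1 * ⟪f, g⟫) *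
        Real.exp (p.1 * ‖g‖ ^ 2 / 2)) ((P.map X.A).prod (gaussianReal 0 1)) := by
  have hm := fun f => (Lp.aestronglyMeasurable (X.isBrownian.isometry f)).aemeasurable
  have hA := X.measurable_A
  have hfm := hm f
  have hgm := hm g
  have hpm : AEMeasurable (fun ω => (X.A ω, X.isBrownian.isometry f ω)) P := by fun_prop
  have h := X.map_withDensity_exp f g
  have h1 := iff_of_eq (congrArg (fun μ => Integrable G μ) h)
  beta_reduce at h1
  rw [integrable_map_measure hG.aestronglyMeasurable
    (hpm.mono_ac (withDensity_absolutelyContinuous _ _)),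
    integrable_map_measure hG.aestronglyMeasurable (by fun_prop),
    integrable_withDensity_iff_integrable_smul₀' (by fun_prop) (ae_of_all _ fun _ => ENNReal.ofReal_lt_top),
    integrable_withDensity_iff_integrable_smul₀' (by fun_prop) (ae_of_all _ fun _ => ENNReal.ofReal_lt_top)] at h1
  simp only [ENNReal.toReal_ofReal (Real.exp_pos _).le, smul_eq_mul, Function.comp] at h1
  simpa only [mul_comm (Real.exp _)] using h1

theorem integral_mul_exp (f g : Lp ℝ 2 (volume : Measure ℝ)) {G : ℝ × ℝ → ℝ}
    (hG : Measurable G) :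
    ∫ ω, G (X.A ω, X.isBrownian.isometry f ω) *
        Real.exp (√(X.A ω) * X.isBrownian.isometry g ω) ∂P =
      ∫ p : ℝ × ℝ, G (p.1, ‖f‖ * p.2 + √p.1 * ⟪f, g⟫) *
        Real.exp (p.1 * ‖g‖ ^ 2 / 2) ∂((P.map X.A).prod (gaussianReal 0 1)) := by
  have hm := fun f => (Lp.aestronglyMeasurable (X.isBrownian.isometry f)).aemeasurable
  have hA := X.measurable_A
  have hfm := hm f
  have hgm := hm g
  have hpm : AEMeasurable (fun ω => (X.A ω, X.isBrownian.isometry f ω)) P := by fun_prop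
  have h := X.map_withDensity_exp f g
  have h1 := congrArg (fun μ => ∫ p, G p ∂μ) h
  beta_reduce at h1
  rw [integral_map (hpm.mono_ac (withDensity_absolutelyContinuous _ _)) hG.aestronglyMeasurable,
    integral_map (by fun_prop) hG.aestronglyMeasurable,
    integral_withDensity_eq_integral_toReal_smul₀ (by fun_prop) (ae_of_all _ fun _ => ENNReal.ofReal_lt_top),
    integral_withDensity_eq_integral_toReal_smul₀ (by fun_prop) (ae_of_all _ fun _ => ENNReal.ofReal_lt_top)] at h1
  simp only [ENNReal.toReal_ofReal (Real.exp_pos _).le, smul_eq_mul] at h1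
  simpa only [mul_comm (Real.exp _)] using h1

end RandomlyScaledFBM


/-! ### Totality of the Wick exponentials -/

/-- Both complex moment generating functions are analytic on the strip |Re z| < ε and agree on a
real interval. By the identity theorem they agree at z = i. -/
theorem integral_cexp_mul_I_eq_of_mgf_eq {μ ν : Measure Ω} {Y : Ω → ℝ} {ε : ℝ} (hε : 0 < ε)
    (hμ : ∀ t, |t| < ε → Integrable (fun ω => Real.exp (t * Y ω)) μ)
    (hν : ∀ t, |t| < ε → Integrable (fun ω => Real.exp (t * Y ω)) ν)
    (h : ∀ t, |t| < ε → ∫ ω, Real.exp (t * Y ω) ∂μ = ∫ ω, Real.exp (t * Y ω) ∂ν) :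
    ∫ ω, Complex.exp (Y ω * Complex.I) ∂μ = ∫ ω, Complex.exp (Y ω * Complex.I) ∂ν := by
  have hsub : ∀ ρ : Measure Ω, (∀ t, |t| < ε → Integrable (fun ω => Real.exp (t * Y ω)) ρ) →
      {z : ℂ | |z.re| < ε} ⊆ {z | z.re ∈ interior (integrableExpSet Y ρ)} := by
    intro ρ hρ z hz
    exact interior_maximal (s := integrableExpSet Y ρ) (t := {t | |t| < ε}) (fun t ht => hρ t ht)
      (isOpen_lt continuous_abs continuous_const) hz
  have hconv : IsPreconnected {z : ℂ | |z.re| < ε} := by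
    refine Convex.isPreconnected ?_
    have : {z : ℂ | |z.re| < ε} = Complex.reLm ⁻¹' (Ioo (-ε) ε) := by
      ext z; simp [abs_lt]
    rw [this]
    exact (convex_Ioo _ _).linear_preimage _
  have hfreq : ∃ᶠ z : ℂ in 𝓝[≠] 0, complexMGF Y μ z = complexMGF Y ν z := by
    have ht : Tendsto (fun x : ℝ => (x : ℂ)) (𝓝[≠] 0) (𝓝[≠] 0) := by
      refine tendsto_nhdsWithin_of_tendsto_nhds_of_eventually_within _ ?_ ?_
      · exact (Complex.continuous_ofReal.tendsto' 0 0 (by simp)).mono_left nhdsWithin_le_nhds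
      · filter_upwards [self_mem_nhdsWithin] with x hx
        simpa using hx
    refine ht.frequently (Eventually.frequently ?_)
    have h1 : ∀ᶠ x : ℝ in 𝓝[≠] 0, |x| < ε :=
      nhdsWithin_le_nhds ((isOpen_lt continuous_abs continuous_const).mem_nhds (by simpa using hε))
    filter_upwards [h1] with x hx
    rw [complexMGF_ofReal, complexMGF_ofReal, mgf, mgf, h x hx]
  have := (analyticOnNhd_complexMGF.mono (hsub μ hμ)).eqOn_of_preconnected_of_frequently_eq
    (analyticOnNhd_complexMGF.mono (hsub ν hν)) hconv (z₀ := 0) (by simpa using hε) hfreq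
    (show Complex.I ∈ {z : ℂ | |z.re| < ε} by simpa using hε)
  simpa [complexMGF, mul_comm Complex.I] using this

theorem integrable_withDensity_ofReal {P : Measure Ω} {Θ φ : Ω → ℝ} (hΘ : AEMeasurable Θ P)
    (hφ : AEStronglyMeasurable φ P) (h : Integrable (fun ω => Θ ω * φ ω) P) :
    Integrable φ (P.withDensity fun ω => ENNReal.ofReal (Θ ω)) := by
  rw [integrable_withDensity_iff_integrable_smul₀' hΘ.ennreal_ofReal
    (ae_of_all _ fun _ => ENNReal.ofReal_lt_top)]
  refine h.mono (by have := hφ.aemeasurable; exact AEMeasurable.aestronglyMeasurable (by fun_prop))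
    (ae_of_all _ fun ω => ?_)
  rw [smul_eq_mul, norm_mul, norm_mul, ENNReal.toReal_ofReal']
  gcongr
  rw [Real.norm_eq_abs, Real.norm_eq_abs, abs_of_nonneg (le_max_right _ _)]
  exact max_le (le_abs_self _) (abs_nonneg _)

/-- The signed measure Θ dP is handled as the difference of the positive measures Θ⁺ dP and Θ⁻ dP.
-/
theorem integral_withDensity_sub {P : Measure Ω} {Θ φ : Ω → ℝ} (hΘ : AEMeasurable Θ P)
    (hφ : AEStronglyMeasurable φ P) (h : Integrable (fun ω => Θ ω * φ ω) P) :
    ∫ ω, φ ω ∂(P.withDensity fun ω => ENNReal.ofReal (Θ ω)) -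
      ∫ ω, φ ω ∂(P.withDensity fun ω => ENNReal.ofReal (-Θ ω)) = ∫ ω, Θ ω * φ ω ∂P := by
  have hΘ' : AEMeasurable (fun ω => -Θ ω) P := hΘ.neg
  have h1 := integrable_withDensity_ofReal hΘ hφ h
  have h2 := integrable_withDensity_ofReal hΘ' hφ (by simpa using h.neg)
  rw [integrable_withDensity_iff_integrable_smul₀' hΘ.ennreal_ofReal
    (ae_of_all _ fun _ => ENNReal.ofReal_lt_top)] at h1
  rw [integrable_withDensity_iff_integrable_smul₀' hΘ'.ennreal_ofReal
    (ae_of_all _ fun _ => ENNReal.ofReal_lt_top)] at h2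
  rw [integral_withDensity_eq_integral_toReal_smul₀ hΘ.ennreal_ofReal
    (ae_of_all _ fun _ => ENNReal.ofReal_lt_top), integral_withDensity_eq_integral_toReal_smul₀
    hΘ'.ennreal_ofReal (ae_of_all _ fun _ => ENNReal.ofReal_lt_top), ← integral_sub h1 h2]
  refine integral_congr_ae (ae_of_all _ fun ω => ?_)
  simp only [smul_eq_mul, ENNReal.toReal_ofReal']
  rcases le_total 0 (Θ ω) with h0 | h0
  · rw [max_eq_left h0, max_eq_right (by linarith)]; ring
  · rw [max_eq_right h0, max_eq_left (by linarith)]; ring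

/-- Two finite laws on a product of real lines agree if all linear combinations of coordinates
have the same characteristic function at `1`. -/
theorem map_eq_of_integral_cexp_eq {ι : Type*} {μ ν : Measure Ω} [IsFiniteMeasure μ]
    [IsFiniteMeasure ν] {Φ : Ω → ι → ℝ} (hΦ : Measurable Φ)
    (h : ∀ (I : Finset ι) (c : ι → ℝ),
      ∫ ω, Complex.exp ((∑ i ∈ I, c i * Φ ω i : ℝ) * Complex.I) ∂μ =
      ∫ ω, Complex.exp ((∑ i ∈ I, c i * Φ ω i : ℝ) * Complex.I) ∂ν) :
    μ.map Φ = ν.map Φ := by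
  classical
  have key : ∀ I : Finset ι, (μ.map Φ).map I.restrict = (ν.map Φ).map I.restrict := by
    intro I
    rw [Measure.map_map (by fun_prop) hΦ, Measure.map_map (by fun_prop) hΦ]
    have hm : Measurable (I.restrict ∘ Φ) := (Finset.measurable_restrict I).comp hΦ
    refine Measure.ext_of_charFunDual (funext fun L => ?_)
    rw [charFunDual_apply, charFunDual_apply, integral_map hm.aemeasurable (by fun_prop),
      integral_map hm.aemeasurable (by fun_prop)]
    have hL : ∀ v : I → ℝ, L v = ∑ i : I, L (Pi.single i 1) * v i := by
      intro v
      conv_lhs => rw [pi_eq_sum_univ' v, map_sum]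
      refine Finset.sum_congr rfl fun i _ => ?_
      rw [map_smul, smul_eq_mul, mul_comm]
    have h1 := h I fun i => if hi : i ∈ I then L (Pi.single ⟨i, hi⟩ 1) else 0
    have h2 : ∀ ω, ∑ i ∈ I, (if hi : i ∈ I then L (Pi.single ⟨i, hi⟩ 1) else 0) * Φ ω i =
        L ((I.restrict ∘ Φ) ω) := by
      intro ω
      rw [hL, ← Finset.sum_coe_sort]
      refine Finset.sum_congr rfl fun i _ => ?_
      simp
    simp_rw [h2] at h1
    exact h1
  -- A finite measure on an arbitrary product is determined by its finite-dimensional marginals.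
  have h1 : IsProjectiveLimit (μ.map Φ) (fun I => (μ.map Φ).map I.restrict) := fun I => rfl
  have h2 : IsProjectiveLimit (ν.map Φ) (fun I => (μ.map Φ).map I.restrict) :=
    fun I => (key I).symm
  exact h1.unique h2

theorem mem_closure_range_toLp (f : Lp ℝ 2 (volume : Measure ℝ)) :
    f ∈ closure (range fun η : 𝓢(ℝ, ℝ) => η.toLp 2 volume) :=
  (SchwartzMap.denseRange_toLpCLM (E := ℝ) (F := ℝ) (p := 2) (μ := volume) (by norm_num)) f


/-! ### Wick exponentials, their integrability and analytic continuation of the transform. -/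

namespace RandomlyScaledFBM

variable {P : Measure Ω} [IsProbabilityMeasure P] (X : RandomlyScaledFBM P)

/-- The Wiener integral of an element of `L²(ℝ)`. -/
abbrev wiener (f : Lp ℝ 2 (volume : Measure ℝ)) : Lp ℝ 2 P := X.isBrownian.isometry f

theorem aemeasurable_wiener (f : Lp ℝ 2 (volume : Measure ℝ)) : AEMeasurable (X.wiener f) P :=
  (Lp.aestronglyMeasurable _).aemeasurable

theorem norm_toLp_sq (η : 𝓢(ℝ, ℝ)) : ‖η.toLp 2 volume‖ ^ 2 = ∫ x, η x ^ 2 := by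
  rw [← real_inner_self_eq_norm_sq, L2.inner_def]
  refine integral_congr_ae ?_
  filter_upwards [η.coeFn_toLp 2 volume] with x hx
  rw [hx]; simp [sq]

theorem wienerIntegral_schwartz (η : 𝓢(ℝ, ℝ)) :
    wienerIntegral P X.B (fun x => η x) =ᵐ[P] X.wiener (η.toLp 2 volume) :=
  X.isBrownian.wienerIntegral_ae_eq (η.memLp 2 volume)

theorem sigmaBA_le : X.sigmaBA ≤ ‹MeasurableSpace Ω› :=
  sup_le (iSup_le fun t => (X.isBrownian.measurable t).comap_le) X.measurable_A.comap_le

theorem measurable_A_sigmaBA : Measurable[X.sigmaBA] X.A :=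
  (comap_measurable X.A).mono le_sup_right le_rfl

theorem aestronglyMeasurable_wiener (f : Lp ℝ 2 (volume : Measure ℝ)) :
    AEStronglyMeasurable[X.sigmaBA] (X.wiener f) P := by
  refine (X.isBrownian.aestronglyMeasurable_isometry f).mono ?_
  rw [MeasurableSpace.pi, MeasurableSpace.comap_iSup]
  refine iSup_le fun t => ?_
  rw [MeasurableSpace.comap_comp]
  exact (le_iSup (fun t : ℝ => MeasurableSpace.comap (X.B t) inferInstance) t).trans le_sup_left

/-- Given `A`, the exponent is centred Gaussian, so the expectation is that of exp(A‖f‖²/2). The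
shift formula is used with first argument 0 and `G` = 1. -/
theorem integrable_exp_wiener (f : Lp ℝ 2 (volume : Measure ℝ))
    (h : ENNReal.ofReal (‖f‖ ^ 2 / 2) < X.radius) :
    Integrable (fun ω => Real.exp (√(X.A ω) * X.wiener f ω)) P := by
  have h1 := (X.integrable_mul_exp_iff 0 f (G := fun _ => 1) measurable_const).mpr ?_
  · simpa using h1
  · have h2 := integrable_exp_of_lt_radius X (by positivity) h
    simp only [one_mul]
    have h3 : Integrable (fun a => Real.exp (a * ‖f‖ ^ 2 / 2)) (P.map X.A) := by
      rw [integrable_map_measure (by fun_prop) X.measurable_A.aemeasurable]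
      refine h2.congr (ae_of_all _ fun ω => ?_)
      simp only [Function.comp]; congr 1; ring
    exact h3.comp_fst _

/-- The Wick exponential before normalisation. -/
def rawExp (η : 𝓢(ℝ, ℝ)) (ω : Ω) : ℝ := Real.exp (√(X.A ω) * X.wiener (η.toLp 2 volume) ω)

/-- Squaring replaces η by 2η, and ‖2η‖²/2 = 2‖η‖². This explains the factor 2 in `testFunctions`.
-/
theorem memLp_rawExp {η : 𝓢(ℝ, ℝ)} (hη : η ∈ X.testFunctions) : MemLp (X.rawExp η) 2 P := by
  have hm := X.aemeasurable_wiener (η.toLp 2 volume)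
  have hA := X.measurable_A
  rw [memLp_two_iff_integrable_sq (by unfold rawExp; exact AEMeasurable.aestronglyMeasurable (by fun_prop))]
  have h1 := X.integrable_exp_wiener ((2 : ℝ) • η.toLp 2 volume) ?_
  · refine h1.congr ?_
    have : X.wiener ((2 : ℝ) • η.toLp 2 volume) = (2 : ℝ) • X.wiener (η.toLp 2 volume) := map_smul _ _ _
    rw [this]
    filter_upwards [Lp.coeFn_smul (2 : ℝ) (X.wiener (η.toLp 2 volume))] with ω hω
    rw [hω, rawExp, sq, ← Real.exp_add]
    congr 1
    simp only [Pi.smul_apply, smul_eq_mul]; ring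
  · rw [norm_smul, mul_pow, norm_toLp_sq]
    refine lt_of_eq_of_lt (congrArg _ ?_) hη
    norm_num; ring

/-- The normalising constant of the Wick exponential. -/
def wickConst (η : 𝓢(ℝ, ℝ)) : ℝ := ∫ ω, X.rawExp η ω ∂P

theorem wickConst_pos {η : 𝓢(ℝ, ℝ)} (hη : η ∈ X.testFunctions) : 0 < X.wickConst η :=
  integral_exp_pos ((X.memLp_rawExp hη).integrable (by norm_num))

theorem wickExp_ae_eq (η : 𝓢(ℝ, ℝ)) :
    X.wickExp η =ᵐ[P] fun ω => X.rawExp η ω / X.wickConst η := by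
  have h := X.wienerIntegral_schwartz η
  have h1 : ∫ ω', Real.exp (√(X.A ω') * wienerIntegral P X.B (fun x => η x) ω') ∂P =
      X.wickConst η := by
    refine integral_congr_ae ?_
    filter_upwards [h] with ω hω
    rw [hω, rawExp]
  filter_upwards [h] with ω hω
  rw [wickExp, h1, hω, rawExp]

theorem memLp_wickExp {η : 𝓢(ℝ, ℝ)} (hη : η ∈ X.testFunctions) : MemLp (X.wickExp η) 2 P := by
  refine MemLp.ae_eq (X.wickExp_ae_eq η).symm ?_
  simp_rw [div_eq_inv_mul]
  exact (X.memLp_rawExp hη).const_mul _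

theorem memL2A_wickExp {η : 𝓢(ℝ, ℝ)} (hη : η ∈ X.testFunctions) : X.MemL2A (X.wickExp η) := by
  refine ⟨AEStronglyMeasurable.congr ?_ (X.wickExp_ae_eq η).symm, X.memLp_wickExp hη⟩
  have h := X.aestronglyMeasurable_wiener (η.toLp 2 volume)
  have hA := X.measurable_A_sigmaBA
  have h2 : StronglyMeasurable[X.sigmaBA] fun ω => √(X.A ω) :=
    (Real.continuous_sqrt.measurable.comp hA).stronglyMeasurable
  have h3 := Real.continuous_exp.comp_aestronglyMeasurable (h2.aestronglyMeasurable.mul h)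
  simp_rw [div_eq_mul_inv]
  exact h3.mul_const _

theorem sTransform_eq_div (Θ : Ω → ℝ) (η : 𝓢(ℝ, ℝ)) :
    X.sTransform Θ η = (∫ ω, Θ ω * X.rawExp η ω ∂P) / X.wickConst η := by
  rw [sTransform, ← integral_div]
  refine integral_congr_ae ?_
  filter_upwards [X.wickExp_ae_eq η] with ω hω
  rw [hω, mul_div_assoc]

/-- The test functions are not a vector space, but they contain all small multiples of every
Schwartz function, which suffices for analytic continuation along a line. -/
theorem exists_smul_mem_testFunctions (hR : 0 < X.radius) (η : 𝓢(ℝ, ℝ)) :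
    ∃ ε : ℝ, 0 < ε ∧ ∀ t : ℝ, |t| < ε → t • η ∈ X.testFunctions := by
  have h1 : Tendsto (fun t : ℝ => ENNReal.ofReal (2 * ∫ x, (t • η) x ^ 2)) (𝓝 0) (𝓝 0) := by
    have h2 : ∀ t : ℝ, 2 * ∫ x, (t • η) x ^ 2 = t ^ 2 * (2 * ∫ x, η x ^ 2) := by
      intro t
      simp_rw [smul_apply, smul_eq_mul, mul_pow]
      rw [integral_const_mul]; ring
    simp_rw [h2]
    have : Tendsto (fun t : ℝ => t ^ 2 * (2 * ∫ x, η x ^ 2)) (𝓝 0) (𝓝 0) :=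
      Continuous.tendsto' (by fun_prop) _ _ (by simp)
    simpa using ENNReal.tendsto_ofReal this
  obtain ⟨ε, hε, h⟩ := Metric.eventually_nhds_iff.mp (h1.eventually_lt_const hR)
  exact ⟨ε, hε, fun t ht => h (by simpa using ht)⟩

section Totality

variable {Θ : Ω → ℝ}

/-- The positive and negative parts of `Θ dP`. -/
abbrev densityMeasure (P : Measure Ω) (Θ : Ω → ℝ) : Measure Ω :=
  P.withDensity fun ω => ENNReal.ofReal (Θ ω)

theorem isFiniteMeasure_densityMeasure (h : MemLp Θ 2 P) :
    IsFiniteMeasure (densityMeasure P Θ) :=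
  isFiniteMeasure_withDensity_ofReal (h.integrable (by norm_num)).hasFiniteIntegral

theorem rawExp_smul (t : ℝ) (η : 𝓢(ℝ, ℝ)) : X.rawExp (t • η) =ᵐ[P]
    fun ω => Real.exp (t * (√(X.A ω) * X.wiener (η.toLp 2 volume) ω)) := by
  have h1 : (t • η).toLp 2 volume = t • η.toLp 2 volume :=
    map_smul (SchwartzMap.toLpCLM ℝ ℝ 2 volume) t η
  have : X.wiener ((t • η).toLp 2 volume) = t • X.wiener (η.toLp 2 volume) := by
    rw [h1]; exact map_smul _ _ _
  filter_upwards [Lp.coeFn_smul t (X.wiener (η.toLp 2 volume))] with ω hω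
  rw [rawExp, this, hω]
  congr 1
  simp only [Pi.smul_apply, smul_eq_mul]; ring

/-- The transform at tη is, up to normalisation, the moment generating function of √A I(η) at t
under Θ dP. Its vanishing for small t makes those under Θ⁺ dP and Θ⁻ dP agree near 0, hence also at
i. -/
theorem integral_cexp_schwartz_eq (hR : 0 < X.radius) (hΘ : MemLp Θ 2 P)
    (h : ∀ η ∈ X.testFunctions, X.sTransform Θ η = 0) (η : 𝓢(ℝ, ℝ)) :
    ∫ ω, Complex.exp ((√(X.A ω) * X.wiener (η.toLp 2 volume) ω : ℝ) * Complex.I)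
        ∂(densityMeasure P Θ) =
      ∫ ω, Complex.exp ((√(X.A ω) * X.wiener (η.toLp 2 volume) ω : ℝ) * Complex.I)
        ∂(densityMeasure P fun ω => -Θ ω) := by
  obtain ⟨ε, hε, hη⟩ := X.exists_smul_mem_testFunctions hR η
  have hm := X.aemeasurable_wiener (η.toLp 2 volume)
  have hA := X.measurable_A
  have hΘm := hΘ.aestronglyMeasurable.aemeasurable
  have hi : ∀ t : ℝ, |t| < ε → Integrable (fun ω => Θ ω * Real.exp (t * (√(X.A ω) *
      X.wiener (η.toLp 2 volume) ω))) P := by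
    intro t ht
    refine (hΘ.integrable_mul (X.memLp_rawExp (hη t ht))).congr ?_
    filter_upwards [X.rawExp_smul t η] with ω hω
    rw [Pi.mul_apply, hω]
  have hem : ∀ t : ℝ, AEStronglyMeasurable (fun ω => Real.exp (t * (√(X.A ω) *
      X.wiener (η.toLp 2 volume) ω))) P := fun t => AEMeasurable.aestronglyMeasurable (by fun_prop)
  refine integral_cexp_mul_I_eq_of_mgf_eq hε
    (fun t ht => integrable_withDensity_ofReal hΘm (hem t) (hi t ht))
    (fun t ht => integrable_withDensity_ofReal hΘm.neg (hem t) ?_) fun t ht => ?_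
  · simpa using (hi t ht).neg
  · rw [← sub_eq_zero, integral_withDensity_sub hΘm (hem t) (hi t ht)]
    have h1 := h _ (hη t ht)
    rw [sTransform_eq_div, div_eq_zero_iff, or_iff_left (X.wickConst_pos (hη t ht)).ne'] at h1
    rw [← h1]
    refine integral_congr_ae ?_
    filter_upwards [X.rawExp_smul t η] with ω hω
    rw [hω]

theorem integral_cexp_wiener_eq (hR : 0 < X.radius) (hΘ : MemLp Θ 2 P)
    (h : ∀ η ∈ X.testFunctions, X.sTransform Θ η = 0) (f : Lp ℝ 2 (volume : Measure ℝ)) :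
    ∫ ω, Complex.exp ((√(X.A ω) * X.wiener f ω : ℝ) * Complex.I) ∂(densityMeasure P Θ) =
      ∫ ω, Complex.exp ((√(X.A ω) * X.wiener f ω : ℝ) * Complex.I)
        ∂(densityMeasure P fun ω => -Θ ω) := by
  obtain ⟨u, hu, hlim⟩ := mem_closure_iff_seq_limit.mp (mem_closure_range_toLp f)
  choose η hη using hu
  have h1 : Tendsto (fun n => X.wiener (u n)) atTop (𝓝 (X.wiener f)) :=
    (X.isBrownian.isometry.continuous.tendsto f).comp hlim
  -- The densities of the two measures are not bounded, so L² convergence is first replaced by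
  -- almost sure convergence along a subsequence; the exponentials are bounded by 1.
  obtain ⟨ns, -, hns⟩ := (tendstoInMeasure_of_tendsto_Lp h1).exists_seq_tendsto_ae
  have hA := X.measurable_A
  have key : ∀ Ψ : Ω → ℝ, MemLp Ψ 2 P → Tendsto (fun n => ∫ ω, Complex.exp ((√(X.A ω) *
      X.wiener (u (ns n)) ω : ℝ) * Complex.I) ∂(densityMeasure P Ψ)) atTop
      (𝓝 (∫ ω, Complex.exp ((√(X.A ω) * X.wiener f ω : ℝ) * Complex.I) ∂(densityMeasure P Ψ))) := by
    intro Ψ hΨ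
    have := isFiniteMeasure_densityMeasure hΨ
    have hac : densityMeasure P Ψ ≪ P := withDensity_absolutelyContinuous _ _
    refine tendsto_integral_of_dominated_convergence (fun _ => 1) (fun n => ?_)
      (integrable_const _) (fun n => ae_of_all _ fun ω => ?_) ?_
    · have hm := (X.aemeasurable_wiener (u (ns n))).mono_ac hac
      exact AEMeasurable.aestronglyMeasurable (by fun_prop)
    · rw [Complex.norm_exp_ofReal_mul_I]
    · filter_upwards [hac.ae_le hns] with ω hω
      have h2 : Continuous fun x : ℝ => Complex.exp ((√(X.A ω) * x : ℝ) * Complex.I) := by fun_prop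
      exact (h2.tendsto _).comp hω
  have hk2 := key (fun ω => -Θ ω) hΘ.neg
  refine tendsto_nhds_unique (key Θ hΘ) (hk2.congr fun n => ?_)
  rw [← hη (ns n)]
  exact (X.integral_cexp_schwartz_eq hR hΘ h _).symm

theorem map_scaled_eq (hR : 0 < X.radius) (hΘ : MemLp Θ 2 P)
    (h : ∀ η ∈ X.testFunctions, X.sTransform Θ η = 0) :
    (densityMeasure P Θ).map (fun ω t => √(X.A ω) * X.B t ω) =
      (densityMeasure P fun ω => -Θ ω).map (fun ω t => √(X.A ω) * X.B t ω) := by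
  have := isFiniteMeasure_densityMeasure hΘ
  have := isFiniteMeasure_densityMeasure hΘ.neg
  have : IsFiniteMeasure (densityMeasure P fun ω => -Θ ω) := isFiniteMeasure_densityMeasure hΘ.neg
  have hA := X.measurable_A
  have hB := X.isBrownian.measurable
  refine map_eq_of_integral_cexp_eq (measurable_pi_lambda _ fun t => by fun_prop) fun I c => ?_
  -- The Wiener integral of the step function with coefficients `c` is the prescribed combination of
  -- Brownian values, so the previous lemma gives the finite-dimensional laws of √A B.
  set d : ℝ →₀ ℝ := Finsupp.onFinset I (fun t => if t ∈ I then c t else 0)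
    (fun a ha => by by_contra h0; simp [h0] at ha)
  have h1 : X.wiener (d.sum fun t a => a • (memLp_ind 0 t 2).toLp (ind 0 t)) =ᵐ[P]
      fun ω => ∑ t ∈ I, c t * X.B t ω := by
    refine (X.isBrownian.isometry_sum_ae_eq d).trans (ae_of_all _ fun ω => ?_)
    have : ∑ t ∈ d.support, d t • X.B t ω = d.sum fun t a => a • X.B t ω := rfl
    simp only [this]
    rw [Finsupp.onFinset_sum _ (by simp)]
    refine Finset.sum_congr rfl fun t ht => ?_
    simp [ht]
  have h2 := X.integral_cexp_wiener_eq hR hΘ h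
    (d.sum fun t a => a • (memLp_ind 0 t 2).toLp (ind 0 t))
  have h3 : ∀ Ψ : Ω → ℝ, ∫ ω, Complex.exp ((√(X.A ω) * X.wiener
      (d.sum fun t a => a • (memLp_ind 0 t 2).toLp (ind 0 t)) ω : ℝ) * Complex.I)
      ∂(densityMeasure P Ψ) = ∫ ω, Complex.exp ((∑ t ∈ I, c t * (√(X.A ω) * X.B t ω) : ℝ) *
        Complex.I) ∂(densityMeasure P Ψ) := by
    intro Ψ
    have hac : densityMeasure P Ψ ≪ P := withDensity_absolutelyContinuous _ _
    refine integral_congr_ae ?_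
    filter_upwards [hac.ae_le h1] with ω hω
    rw [hω, Finset.mul_sum]
    refine congrArg (fun x : ℝ => Complex.exp (x * Complex.I)) ?_
    exact Finset.sum_congr rfl fun t _ => by ring
  rw [h3, h3] at h2
  exact h2

end Totality

end RandomlyScaledFBM


/-! ### Recovering `A` from the path of √A B, and totality. -/

namespace RandomlyScaledFBM

variable {P : Measure Ω} [IsProbabilityMeasure P] (X : RandomlyScaledFBM P)

theorem inner_indLp (a b c d : ℝ) : ⟪(memLp_ind a b 2).toLp (ind a b),
    (memLp_ind c d 2).toLp (ind c d)⟫ = ∫ x, ind a b x * ind c d x := by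
  rw [L2.inner_def]
  refine integral_congr_ae ?_
  filter_upwards [(memLp_ind a b 2).coeFn_toLp, (memLp_ind c d 2).coeFn_toLp] with x h1 h2
  rw [h1, h2]; simp [mul_comm]

theorem wiener_indLp (s t : ℝ) : X.wiener ((memLp_ind s t 2).toLp (ind s t)) =ᵐ[P]
    fun ω => X.B t ω - X.B s ω := by
  have h1 : (memLp_ind s t 2).toLp (ind s t) = (memLp_ind 0 t 2).toLp (ind 0 t) -
      (memLp_ind 0 s 2).toLp (ind 0 s) := by
    rw [← MemLp.toLp_sub]
    exact MemLp.toLp_congr _ _ (ae_of_all _ fun x => ind_eq_sub s t x)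
  rw [h1, wiener, map_sub, X.isBrownian.isometry_ind, X.isBrownian.isometry_ind, ← MemLp.toLp_sub]
  exact MemLp.coeFn_toLp _

/-- Unit increments come from orthogonal indicators, hence are pairwise independent and standard
Gaussian, which suffices for the strong law. For √A B the same averages tend to `A`. -/
theorem tendsto_average_sq_increments : ∀ᵐ ω ∂P, Tendsto (fun n : ℕ =>
    (∑ i ∈ Finset.range n, (X.B (i + 1) ω - X.B i ω) ^ 2) / n) atTop (𝓝 1) := by
  set ξ : ℕ → Ω → ℝ := fun i ω => X.B (i + 1) ω - X.B i ω with hξ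
  have hξm : ∀ i, Measurable (ξ i) := fun i =>
    (X.isBrownian.measurable _).sub (X.isBrownian.measurable _)
  set e : ℕ → Lp ℝ 2 (volume : Measure ℝ) := fun i => (memLp_ind i (i + 1) 2).toLp (ind i (i + 1))
  have he : ∀ i, X.wiener (e i) =ᵐ[P] ξ i := fun i => X.wiener_indLp i (i + 1)
  have hn : ∀ i, ‖e i‖ ^ 2 = 1 := by
    intro i
    rw [← real_inner_self_eq_norm_sq, inner_indLp, ind_eq_indicator (by linarith)]
    have : (fun x => (Ico (i : ℝ) (i + 1)).indicator (1 : ℝ → ℝ) x *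
        (Ico (i : ℝ) (i + 1)).indicator 1 x) = (Ico (i : ℝ) (i + 1)).indicator 1 := by
      ext x; simp [indicator]
    rw [this, integral_indicator_one measurableSet_Ico]
    simp
  have hlaw : ∀ i, P.map (ξ i) = gaussianReal 0 1 := by
    intro i
    rw [← Measure.map_congr (he i), X.isBrownian.map_isometry, hn]; simp
  have hortho : ∀ i j, i ≠ j → ⟪e i, e j⟫ = 0 := by
    intro i j hij
    rw [inner_indLp, ind_eq_indicator (by linarith), ind_eq_indicator (by linarith)]
    have : (fun x => (Ico (i : ℝ) (i + 1)).indicator (1 : ℝ → ℝ) x *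
        (Ico (j : ℝ) (j + 1)).indicator 1 x) = 0 := by
      ext x
      rw [← Set.inter_indicator_mul]
      have : Ico (i : ℝ) (i + 1) ∩ Ico (j : ℝ) (j + 1) = ∅ := by
        refine Set.eq_empty_of_forall_notMem fun y hy => hij ?_
        obtain ⟨⟨h1, h2⟩, h3, h4⟩ := hy
        have h5 : (i : ℝ) < j + 1 := by linarith
        have h6 : (j : ℝ) < i + 1 := by linarith
        norm_cast at h5 h6
        omega
      rw [this]; simp
    rw [this]; simp
  have hsq : ∫ ω, ξ 0 ω ^ 2 ∂P = 1 := by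
    have h1 : ∫ x, x ^ 2 ∂(P.map (ξ 0)) = 1 := by
      rw [hlaw 0]
      have := variance_fun_id_gaussianReal (μ := 0) (v := 1)
      rw [variance_eq_integral measurable_id'.aemeasurable] at this
      simpa using this
    rwa [integral_map (hξm 0).aemeasurable (by fun_prop)] at h1
  have hL2 : MemLp (ξ 0) 2 P := (Lp.memLp (X.wiener (e 0))).ae_eq (he 0)
  have := strong_law_ae_real (μ := P) (fun i ω => ξ i ω ^ 2) hL2.integrable_sq ?_ ?_
  · simp only [hsq] at this
    exact this
  · intro i j hij
    have h1 := (X.isBrownian.indepFun_isometry (hortho i j hij)).congr (he i) (he j)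
    exact h1.comp (measurable_id.pow_const 2) (measurable_id.pow_const 2)
  · intro i
    have h1 : IdentDistrib (ξ i) (ξ 0) P P :=
      ⟨(hξm i).aemeasurable, (hξm 0).aemeasurable, by rw [hlaw, hlaw]⟩
    exact h1.comp (measurable_id.pow_const 2)

/-- The `σ`-algebra generated by the scaled Brownian motion `√A B`. -/
abbrev scaledSigma : MeasurableSpace Ω :=
  MeasurableSpace.comap (fun ω (t : ℝ) => √(X.A ω) * X.B t ω) inferInstance

/-- Almost surely `A` is the limit of the averaged squared increments of √A B, and division by √A
then recovers `B`. So √A B carries all the information of (B, A) up to null sets. -/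
theorem sigmaBA_le_eventuallyMeasurable :
    X.sigmaBA ≤ eventuallyMeasurableSpace X.scaledSigma (ae P) := by
  have hΦ : ∀ t : ℝ, Measurable[X.scaledSigma] fun ω => √(X.A ω) * X.B t ω := by
    intro t
    have ht : Measurable fun w : ℝ → ℝ => w t := measurable_pi_apply t
    exact ht.comp (comap_measurable _)
  set A' : Ω → ℝ := fun ω => limsup (fun n : ℕ => (∑ i ∈ Finset.range n,
    (√(X.A ω) * X.B (i + 1) ω - √(X.A ω) * X.B i ω) ^ 2) / n) atTop
  have hA' : Measurable[X.scaledSigma] A' := by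
    refine Measurable.limsup fun n => ?_
    exact (Finset.measurable_fun_sum _ fun i _ => ((hΦ _).sub (hΦ _)).pow_const 2).div_const _
  have hAA' : X.A =ᵐ[P] A' := by
    filter_upwards [X.tendsto_average_sq_increments] with ω hω
    have h1 := hω.const_mul (X.A ω)
    rw [mul_one] at h1
    refine (Tendsto.limsup_eq (h1.congr fun n => ?_)).symm
    rw [← mul_div_assoc, Finset.mul_sum]
    congr 1
    refine Finset.sum_congr rfl fun i _ => ?_
    rw [← mul_sub, mul_pow, Real.sq_sqrt (X.A_pos ω).le]
  refine sup_le (iSup_le fun t => ?_) ?_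
  · refine Measurable.comap_le ?_
    have h1 : Measurable[X.scaledSigma] fun ω => (√(X.A ω) * X.B t ω) / √(A' ω) :=
      (hΦ t).div (Real.continuous_sqrt.measurable.comp hA')
    refine h1.eventuallyMeasurable_of_eventuallyEq ?_
    filter_upwards [hAA'] with ω hω
    rw [← hω, mul_div_cancel_left₀]
    exact (Real.sqrt_pos.mpr (X.A_pos ω)).ne'
  · exact (hA'.eventuallyMeasurable_of_eventuallyEq hAA').comap_le

/-- The Wick exponentials are total: an element of `L²_A` is determined by its `S_A`-transform. -/
theorem ae_eq_zero_of_sTransform_eq_zero (hR : 0 < X.radius) {Θ : Ω → ℝ} (hΘ : X.MemL2A Θ)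
    (h : ∀ η ∈ X.testFunctions, X.sTransform Θ η = 0) : Θ =ᵐ[P] 0 := by
  have hint : Integrable Θ P := hΘ.2.integrable (by norm_num)
  have hΘm := hΘ.2.aestronglyMeasurable.aemeasurable
  have hA := X.measurable_A
  have hB := X.isBrownian.measurable
  have hΦ : Measurable fun ω (t : ℝ) => √(X.A ω) * X.B t ω :=
    measurable_pi_lambda _ fun t => by fun_prop
  refine ae_eq_of_forall_setIntegral_eq_of_sigmaFinite' X.sigmaBA_le
    (fun s _ _ => hint.integrableOn) (fun s _ _ => integrableOn_zero) (fun s hs _ => ?_)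
    hΘ.1 stronglyMeasurable_zero.aestronglyMeasurable
  -- Up to a null set, an event of σ(B, A) is an event about the path of √A B.
  obtain ⟨s', hs', hss'⟩ := X.sigmaBA_le_eventuallyMeasurable s hs
  obtain ⟨S, hS, rfl⟩ := hs'
  have hS' : MeasurableSet ((fun ω (t : ℝ) => √(X.A ω) * X.B t ω) ⁻¹' S) := hΦ hS
  rw [setIntegral_congr_set hss', ← integral_indicator hS']
  have h1 := integral_withDensity_sub (P := P) (φ := ((fun ω (t : ℝ) => √(X.A ω) * X.B t ω) ⁻¹' S).indicator 1)
    hΘm (aestronglyMeasurable_const.indicator hS') ?_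
  -- Such an event has equal mass under Θ⁺ dP and Θ⁻ dP, so the integral of Θ over it vanishes.
  · have h2 := X.map_scaled_eq hR hΘ.2 h
    rw [integral_indicator_one hS', integral_indicator_one hS', Measure.real, Measure.real,
      ← Measure.map_apply hΦ hS, ← Measure.map_apply hΦ hS, h2, sub_self] at h1
    simp only [Pi.zero_apply, integral_zero]
    rw [h1]
    refine integral_congr_ae (ae_of_all _ fun ω => ?_)
    simp [indicator]
  · refine (hint.indicator hS').congr (ae_of_all _ fun ω => ?_)
    simp [indicator]

end RandomlyScaledFBM


/-! ### The kernel of fractional Brownian motion -/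

/-- The truncated power `y_+^a`. -/
def posPow (a y : ℝ) : ℝ := if 0 < y then y ^ a else 0

theorem posPow_of_pos {a y : ℝ} (h : 0 < y) : posPow a y = y ^ a := if_pos h

theorem posPow_of_nonpos {a y : ℝ} (h : y ≤ 0) : posPow a y = 0 := if_neg h.not_gt

theorem posPow_nonneg (a y : ℝ) : 0 ≤ posPow a y := by
  unfold posPow; split_ifs with h
  · positivity
  · rfl

theorem posPow_eq_indicator (a : ℝ) : posPow a = (Ioi 0).indicator fun y => y ^ a := by
  ext y; simp [posPow, indicator]

@[fun_prop]
theorem measurable_posPow (a : ℝ) : Measurable (posPow a) := by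
  rw [posPow_eq_indicator]
  exact (measurable_id.pow_const a).indicator measurableSet_Ioi

theorem intervalIntegrable_posPow {a : ℝ} (ha : -1 < a) (u v : ℝ) :
    IntervalIntegrable (posPow a) volume u v := by
  have h := intervalIntegral.intervalIntegrable_rpow' (a := u) (b := v) ha
  rw [intervalIntegrable_iff] at h ⊢
  rw [posPow_eq_indicator]
  exact h.indicator measurableSet_Ioi

theorem continuous_posPow {a : ℝ} (ha : 0 < a) : Continuous (posPow a) := by
  have : posPow a = fun y => (max y 0) ^ a := by
    ext y
    rcases lt_or_ge 0 y with h | h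
    · rw [posPow_of_pos h, max_eq_left h.le]
    · rw [posPow_of_nonpos h, max_eq_right h, Real.zero_rpow ha.ne']
  rw [this]
  exact (continuous_id.max continuous_const).rpow_const fun _ => Or.inr ha.le

theorem hasDerivAt_posPow {a y : ℝ} (hy : y ≠ 0) :
    HasDerivAt (posPow a) (a * posPow (a - 1) y) y := by
  rcases lt_or_gt_of_ne hy with h | h
  · rw [posPow_of_nonpos h.le, mul_zero]
    refine (hasDerivAt_const y (0 : ℝ)).congr_of_eventuallyEq ?_
    filter_upwards [Iio_mem_nhds h] with z hz
    exact posPow_of_nonpos (le_of_lt hz)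
  · rw [posPow_of_pos h]
    refine (Real.hasDerivAt_rpow_const (Or.inl hy)).congr_of_eventuallyEq ?_
    filter_upwards [Ioi_mem_nhds h] with z hz
    exact posPow_of_pos hz

theorem integral_posPow_sub {a : ℝ} (ha : 0 < a) (x u v : ℝ) (huv : u ≤ v) :
    ∫ s in u..v, posPow (a - 1) (s - x) = (posPow a (v - x) - posPow a (u - x)) / a := by
  have hi : IntervalIntegrable (fun s => posPow (a - 1) (s - x)) volume u v := by
    have := (intervalIntegrable_posPow (a := a - 1) (by linarith) (u - x) (v - x)).comp_sub_right x
    simpa using this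
  -- The primitive is continuous, and differentiability fails at most at the single point s = x,
  -- where the integrand may be singular.
  have h := integral_eq_of_hasDerivAt_off_countable_of_le (fun s => posPow a (s - x) / a)
    (fun s => posPow (a - 1) (s - x)) huv (countable_singleton x)
    (((continuous_posPow ha).comp (continuous_sub_right x)).div_const a).continuousOn
    (fun s hs => ?_) hi
  · rw [h]; ring
  · have hs' : s - x ≠ 0 := sub_ne_zero.mpr fun h => hs.2 h
    have := ((hasDerivAt_posPow (a := a) hs').comp s ((hasDerivAt_id s).sub_const x)).div_const a
    rw [mul_one, mul_div_cancel_left₀ _ ha.ne'] at this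
    exact this

/-- The kernel `(t-x)_+^b - (-x)_+^b`. -/
def mvnKernel (b t x : ℝ) : ℝ := posPow b (t - x) - posPow b (-x)

theorem abs_one_add_rpow_sub_le {b s : ℝ} (hb : b ≤ 1) (hs : 0 < s) :
    |(1 + s) ^ b - s ^ b| ≤ |b| * s ^ (b - 1) := by
  have h := Convex.norm_image_sub_le_of_norm_hasDerivWithin_le (f := fun u : ℝ => u ^ b)
    (f' := fun u => b * u ^ (b - 1)) (s := Ici s) (x := s) (y := 1 + s) (C := |b| * s ^ (b - 1))
    (fun u hu => (Real.hasDerivAt_rpow_const (Or.inl (hs.trans_le hu).ne')).hasDerivWithinAt)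
    (fun u hu => ?_) (convex_Ici s) self_mem_Ici (by simp)
  · simpa using h
  · have hu' : 0 < u := hs.trans_le hu
    rw [norm_mul, Real.norm_eq_abs, Real.norm_eq_abs, abs_of_pos (Real.rpow_pos_of_pos hu' _)]
    exact mul_le_mul_of_nonneg_left (Real.rpow_le_rpow_of_nonpos hs hu (by linarith)) (abs_nonneg b)

/-- Near 0 the square is of order s^(2b) at worst, integrable as b > -1/2. At infinity the
difference is of order s^(b-1), square integrable as b < 1/2. -/
theorem integrableOn_sq_rpow_sub {b : ℝ} (hb0 : -(1 / 2) < b) (hb1 : b < 1 / 2) :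
    IntegrableOn (fun s : ℝ => ((1 + s) ^ b - s ^ b) ^ 2) (Ioi 0) := by
  have hm : Measurable (fun s : ℝ => ((1 + s) ^ b - s ^ b) ^ 2) := by fun_prop
  rw [← Ioc_union_Ioi_eq_Ioi (zero_le_one' ℝ)]
  refine IntegrableOn.union ?_ ?_
  · have h1 : IntervalIntegrable (fun s : ℝ => s ^ (2 * b)) volume 0 1 :=
      intervalIntegral.intervalIntegrable_rpow' (by linarith)
    have h2 : IntervalIntegrable (fun s : ℝ => (s + 1) ^ (2 * b)) volume 0 1 := by
      have := (intervalIntegral.intervalIntegrable_rpow' (r := 2 * b) (by linarith)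
        (a := 1) (b := 2)).comp_add_right 1
      norm_num at this
      exact this
    rw [intervalIntegrable_iff_integrableOn_Ioc_of_le zero_le_one] at h1 h2
    refine ((h1.add h2).const_mul 2).mono' hm.aestronglyMeasurable ?_
    refine (ae_restrict_iff' measurableSet_Ioc).mpr (ae_of_all _ fun s hs => ?_)
    have e1 : s ^ (2 * b) = (s ^ b) ^ 2 := by
      rw [mul_comm, Real.rpow_mul hs.1.le]; norm_cast
    have e2 : (s + 1) ^ (2 * b) = ((1 + s) ^ b) ^ 2 := by
      rw [mul_comm, Real.rpow_mul (by linarith [hs.1]), add_comm]; norm_cast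
    rw [Real.norm_eq_abs, abs_of_nonneg (sq_nonneg _)]
    simp only [Pi.add_apply]
    rw [e1, e2]
    nlinarith [sq_nonneg ((1 + s) ^ b + s ^ b)]
  · have h1 : IntegrableOn (fun s : ℝ => s ^ (2 * b - 2)) (Ioi 1) :=
      integrableOn_Ioi_rpow_of_lt (by linarith) one_pos
    refine h1.mono' hm.aestronglyMeasurable ?_
    refine (ae_restrict_iff' measurableSet_Ioi).mpr (ae_of_all _ fun s hs => ?_)
    have hs0 : 0 < s := one_pos.trans hs
    have e1 : s ^ (2 * b - 2) = (s ^ (b - 1)) ^ 2 := by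
      rw [show 2 * b - 2 = (b - 1) * 2 by ring, Real.rpow_mul hs0.le]; norm_cast
    rw [Real.norm_eq_abs, abs_of_nonneg (sq_nonneg _), e1, ← sq_abs]
    refine pow_le_pow_left₀ (abs_nonneg _) ((abs_one_add_rpow_sub_le (by linarith) hs0).trans ?_) 2
    have : |b| ≤ 1 := abs_le.mpr ⟨by linarith, by linarith⟩
    exact mul_le_of_le_one_left (Real.rpow_nonneg hs0.le _) this

/-- On the positive half-line only (t - x)_+^b survives; for b = H - 1/2 this is the source of
1/(2H) in `constK`. -/
theorem integrableOn_sq_mvnKernel_Ioi {b t : ℝ} (hb0 : -(1 / 2) < b) (ht : 0 < t) :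
    IntegrableOn (fun x => mvnKernel b t x ^ 2) (Ioi 0) ∧
      ∫ x in Ioi 0, mvnKernel b t x ^ 2 = t ^ (2 * b + 1) / (2 * b + 1) := by
  have h0 : ∀ x ∈ Ioi (0 : ℝ), mvnKernel b t x ^ 2 = (Iio t).indicator (fun x => (t - x) ^ (2 * b)) x := by
    intro x hx
    rw [mvnKernel, posPow_of_nonpos (a := b) (y := -x) (by simpa using le_of_lt hx), sub_zero]
    by_cases h : x < t
    · rw [indicator_of_mem (by exact h), posPow_of_pos (sub_pos.mpr h), mul_comm,
        Real.rpow_mul (sub_pos.mpr h).le]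
      norm_cast
    · rw [indicator_of_notMem (by exact h), posPow_of_nonpos (by linarith)]; norm_num
  have hset : Ioi (0 : ℝ) ∩ Iio t = Ioo 0 t := rfl
  have h1 : IntervalIntegrable (fun x => (t - x) ^ (2 * b)) volume 0 t := by
    have := (intervalIntegral.intervalIntegrable_rpow' (r := 2 * b) (by linarith)
        (a := t) (b := 0)).comp_sub_left t
    simpa using this
  constructor
  · refine IntegrableOn.congr_fun ?_ (fun x hx => (h0 x hx).symm) measurableSet_Ioi
    rw [IntegrableOn, integrable_indicator_iff measurableSet_Iio, IntegrableOn,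
      Measure.restrict_restrict measurableSet_Iio, inter_comm, hset, ← IntegrableOn,
      ← integrableOn_Ioc_iff_integrableOn_Ioo, ← intervalIntegrable_iff_integrableOn_Ioc_of_le ht.le]
    exact h1
  · rw [setIntegral_congr_fun measurableSet_Ioi h0, setIntegral_indicator measurableSet_Iio, hset,
      ← integral_Ioc_eq_integral_Ioo, ← intervalIntegral.integral_of_le ht.le,
      intervalIntegral.integral_comp_sub_left (fun x => x ^ (2 * b)), sub_self, sub_zero,
      integral_rpow (Or.inl (by linarith)), Real.zero_rpow (by linarith), sub_zero]

/-- The substitution x = -ts brings out the power of t and leaves the integral that appears in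
`constK`. -/
theorem integrableOn_sq_mvnKernel_Iic {b t : ℝ} (hb0 : -(1 / 2) < b) (hb1 : b < 1 / 2)
    (ht : 0 < t) :
    IntegrableOn (fun x => mvnKernel b t x ^ 2) (Iic 0) ∧
      ∫ x in Iic 0, mvnKernel b t x ^ 2 =
        t ^ (2 * b + 1) * ∫ s in Ioi (0 : ℝ), ((1 + s) ^ b - s ^ b) ^ 2 := by
  have h0 : ∀ s ∈ Ioi (0 : ℝ), mvnKernel b t (-(t * s)) ^ 2 =
      t ^ (2 * b) * ((1 + s) ^ b - s ^ b) ^ 2 := by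
    intro s hs
    have hs' : (0 : ℝ) < s := hs
    rw [mvnKernel, neg_neg, sub_neg_eq_add, posPow_of_pos (by positivity),
      posPow_of_pos (by positivity), show t + t * s = t * (1 + s) by ring,
      Real.mul_rpow ht.le (by positivity), Real.mul_rpow ht.le hs'.le, ← mul_sub, mul_pow,
      mul_comm 2 b, Real.rpow_mul ht.le]
    norm_cast
  have h1 : IntegrableOn (fun s => mvnKernel b t (-(t * s)) ^ 2) (Ioi 0) :=
    IntegrableOn.congr_fun ((integrableOn_sq_rpow_sub hb0 hb1).const_mul _)
      (fun s hs => (h0 s hs).symm) measurableSet_Ioi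
  have h2 : IntegrableOn (fun y => mvnKernel b t (-y) ^ 2) (Ioi 0) := by
    have := integrableOn_Ioi_comp_mul_left_iff (fun y => mvnKernel b t (-y) ^ 2) 0 ht
    rw [mul_zero] at this
    exact this.mp h1
  constructor
  · have := integrableOn_Iic_iff_integrableOn_Iio (μ := volume) (f := fun x => mvnKernel b t x ^ 2)
      (b := 0)
    rw [this]
    have h3 := (Measure.measurePreserving_neg (volume : Measure ℝ)).integrableOn_comp_preimage
      (MeasurableEquiv.neg ℝ).measurableEmbedding (f := fun x => mvnKernel b t x ^ 2) (s := Iio 0)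
    rw [← h3]
    simpa [Function.comp_def] using h2
  · rw [← neg_zero, ← integral_comp_neg_Ioi 0 (fun x => mvnKernel b t x ^ 2)]
    have h4 := integral_comp_mul_left_Ioi (fun y => mvnKernel b t (-y) ^ 2) 0 ht
    rw [mul_zero, setIntegral_congr_fun measurableSet_Ioi h0, integral_const_mul, smul_eq_mul] at h4
    rw [Real.rpow_add ht, Real.rpow_one]
    field_simp at h4
    simp only [neg_zero]
    linear_combination -h4

theorem integral_sq_mvnKernel {b t : ℝ} (hb0 : -(1 / 2) < b) (hb1 : b < 1 / 2) (ht : 0 < t) :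
    Integrable (fun x => mvnKernel b t x ^ 2) ∧ ∫ x, mvnKernel b t x ^ 2 = t ^ (2 * b + 1) *
      ((∫ s in Ioi (0 : ℝ), ((1 + s) ^ b - s ^ b) ^ 2) + 1 / (2 * b + 1)) := by
  obtain ⟨h1, h2⟩ := integrableOn_sq_mvnKernel_Ioi hb0 ht
  obtain ⟨h3, h4⟩ := integrableOn_sq_mvnKernel_Iic hb0 hb1 ht
  constructor
  · rw [← integrableOn_univ, ← Iic_union_Ioi (a := (0 : ℝ))]
    exact h3.union h1
  · rw [← setIntegral_univ, ← Iic_union_Ioi (a := (0 : ℝ)),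
      setIntegral_union (Iic_disjoint_Ioi le_rfl) measurableSet_Ioi h3 h1, h2, h4]
    ring

theorem measurable_mvnKernel (b t : ℝ) : Measurable (mvnKernel b t) := by
  unfold mvnKernel; fun_prop

theorem memLp_mvnKernel {b t : ℝ} (hb0 : -(1 / 2) < b) (hb1 : b < 1 / 2) (ht : 0 ≤ t) :
    MemLp (mvnKernel b t) 2 volume := by
  rcases ht.eq_or_lt with rfl | ht
  · have : mvnKernel b 0 = fun _ => 0 := by ext x; simp [mvnKernel]
    rw [this]; exact MemLp.zero'
  · exact (memLp_two_iff_integrable_sq (measurable_mvnKernel b t).aestronglyMeasurable).mpr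
      (integral_sq_mvnKernel hb0 hb1 ht).1

/-- The normalisation of `constK` makes the kernel have squared norm `t ^ (2 * H)`. -/
theorem integral_sq_const_mul_mvnKernel {H t : ℝ} (h0 : 0 < H) (h1 : H < 1) (ht : 0 ≤ t) :
    ∫ x, (constK H / Real.Gamma (H + 1 / 2) * mvnKernel (H - 1 / 2) t x) ^ 2 = t ^ (2 * H) := by
  rcases ht.eq_or_lt with rfl | ht
  · have : ∀ x, mvnKernel (H - 1 / 2) 0 x = 0 := by intro x; simp [mvnKernel]
    simp_rw [this]
    simp [Real.zero_rpow (show 2 * H ≠ 0 by positivity)]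
  simp_rw [mul_pow]
  rw [integral_const_mul, (integral_sq_mvnKernel (by linarith) (by linarith) ht).2,
    show 2 * (H - 1 / 2) + 1 = 2 * H by ring, constK]
  have hG : Real.Gamma (H + 1 / 2) ≠ 0 := (Real.Gamma_pos_of_pos (by linarith)).ne'
  rw [mul_div_cancel_left₀ _ hG]
  set S := (∫ s in Ioi (0 : ℝ), ((1 + s) ^ (H - 1 / 2) - s ^ (H - 1 / 2)) ^ 2) + 1 / (2 * H)
  have hS : 0 < S := add_pos_of_nonneg_of_pos (integral_nonneg fun s => sq_nonneg _) (by positivity)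
  have : (S ^ (-(1 / 2) : ℝ)) ^ 2 = S⁻¹ := by
    rw [← Real.rpow_natCast, ← Real.rpow_mul hS.le]; norm_num [Real.rpow_neg_one]
  rw [this]; field_simp


/-! ### Convolution with a truncated power -/

/-- The convolution of `f` with the truncated power `y_+^a`. -/
def posConv (a : ℝ) (f : ℝ → ℝ) (s : ℝ) : ℝ := ∫ y, posPow a y * f (s - y)

/-- A truncated power is the sum of an integrable function and a bounded continuous one. -/
theorem exists_posPow_eq_add {a : ℝ} (ha : -1 < a) (ha0 : a < 0) :
    ∃ p q : ℝ → ℝ, Integrable p ∧ Continuous q ∧ (∀ y, |q y| ≤ 1) ∧ ∀ y, posPow a y = p y + q y := by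
  -- The function `q` equals y^a beyond 1 and the harmless y^(a+1) on (0,1], so the difference is
  -- supported in (0,1].
  set q : ℝ → ℝ := fun y => posPow (a + 1) y / max y 1 with hq
  have hpos : ∀ y : ℝ, 0 < max y 1 := fun y => lt_max_of_lt_right one_pos
  have hqc : Continuous q := by
    refine (continuous_posPow (by linarith)).div (continuous_id.max continuous_const) fun y => ?_
    exact (hpos y).ne'
  refine ⟨fun y => posPow a y - q y, q, ?_, hqc, fun y => ?_, fun y => by ring⟩
  · have hz : ∀ y, y ∉ Ioc (0 : ℝ) 1 → posPow a y - q y = 0 := by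
      intro y hy
      rcases le_or_gt y 0 with h | h
      · simp [hq, posPow_of_nonpos h]
      · have h1 : 1 < y := by
          by_contra h2; exact hy ⟨h, not_lt.mp h2⟩
        simp only [hq]
        rw [posPow_of_pos h, posPow_of_pos h, max_eq_left h1.le, Real.rpow_add_one h.ne']
        field_simp; ring
    rw [← integrableOn_iff_integrable_of_support_subset (s := Ioc 0 1)]
    · refine Integrable.sub ?_ ?_
      · exact (intervalIntegrable_iff_integrableOn_Ioc_of_le zero_le_one).mp
          (intervalIntegrable_posPow ha 0 1)
      · exact (hqc.integrableOn_Icc (a := 0) (b := 1)).mono_set Ioc_subset_Icc_self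
    · intro y hy
      by_contra h
      exact hy (hz y h)
  · simp only [hq]
    rw [abs_div, abs_of_pos (hpos y), abs_of_nonneg (posPow_nonneg _ _), div_le_one (hpos y)]
    rcases le_or_gt y 0 with h | h
    · rw [posPow_of_nonpos h]; exact (hpos y).le
    · rw [posPow_of_pos h]
      rcases le_or_gt y 1 with h1 | h1
      · exact (Real.rpow_le_one h.le h1 (by linarith)).trans (le_max_right _ _)
      · refine le_trans ?_ (le_max_left _ _)
        calc y ^ (a + 1) ≤ y ^ (1 : ℝ) := Real.rpow_le_rpow_of_exponent_le h1.le (by linarith)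
          _ = y := Real.rpow_one y

section posConv

variable {a : ℝ} (ha : -1 < a) (ha0 : a < 0) {f : ℝ → ℝ} (hf : Continuous f) (hfi : Integrable f)
  {C : ℝ} (hC : ∀ x, |f x| ≤ C)

include ha ha0 hf hfi hC

/-- The integrable part of the power is paired with the bounded `f`, the bounded part with the
integrable `f`. Continuity of the convolution follows from the same splitting. -/
theorem integrable_posPow_mul (s : ℝ) : Integrable fun y => posPow a y * f (s - y) := by
  obtain ⟨p, q, hp, hq, hq1, h⟩ := exists_posPow_eq_add ha ha0
  simp_rw [h, add_mul]
  have hfs : Continuous fun y => f (s - y) := hf.comp (continuous_const.sub continuous_id)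
  refine Integrable.add ?_ ?_
  · exact hp.mul_bdd (c := C) hfs.aestronglyMeasurable (ae_of_all _ fun y => hC _)
  · exact (hfi.comp_sub_left s).bdd_mul (c := 1) hq.aestronglyMeasurable (ae_of_all _ hq1)

theorem continuous_posConv : Continuous (posConv a f) := by
  obtain ⟨p, q, hp, hq, hq1, h⟩ := exists_posPow_eq_add ha ha0
  have hfs : ∀ s, Continuous fun y => f (s - y) := fun s =>
    hf.comp (continuous_const.sub continuous_id)
  have h1 : posConv a f = fun s => (∫ y, p y * f (s - y)) + ∫ y, q (s - y) * f y := by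
    ext s
    have e : ∫ y, q (s - y) * f y = ∫ y, q y * f (s - y) := by
      rw [← integral_sub_left_eq_self (fun y => q y * f (s - y)) volume s]
      simp
    rw [e, ← integral_add]
    · unfold posConv; simp_rw [h, add_mul]
    · exact hp.mul_bdd (c := C) (hfs s).aestronglyMeasurable (ae_of_all _ fun y => hC _)
    · exact (hfi.comp_sub_left s).bdd_mul (c := 1) hq.aestronglyMeasurable (ae_of_all _ hq1)
  rw [h1]
  refine Continuous.add ?_ ?_
  · refine continuous_of_dominated (bound := fun y => |p y| * C) (fun s => ?_) (fun s => ?_)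
      (hp.abs.mul_const C) (ae_of_all _ fun y => by fun_prop)
    · exact hp.1.mul (hfs s).aestronglyMeasurable
    · refine ae_of_all _ fun y => ?_
      rw [norm_mul]
      exact mul_le_mul_of_nonneg_left (hC _) (abs_nonneg _)
  · refine continuous_of_dominated (bound := fun y => |f y|) (fun s => ?_) (fun s => ?_)
      hfi.abs (ae_of_all _ fun y => by fun_prop)
    · exact Continuous.aestronglyMeasurable (by fun_prop)
    · refine ae_of_all _ fun y => ?_
      rw [norm_mul]
      exact mul_le_of_le_one_left (abs_nonneg _) (hq1 _)

end posConv

/-- Differentiation commutes with the convolution with a truncated power. -/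
theorem integral_posConv_deriv {a : ℝ} (ha : -1 < a) (ha0 : a < 0) {f f' : ℝ → ℝ} {C C' : ℝ}
    (hf : ∀ x, HasDerivAt f (f' x) x) (hf' : Continuous f') (hfi : Integrable f)
    (hfi' : Integrable f') (hC : ∀ x, |f x| ≤ C) (hC' : ∀ x, |f' x| ≤ C') {t : ℝ} (ht : 0 ≤ t) :
    ∫ s in (0 : ℝ)..t, posConv a f' s = posConv a f t - posConv a f 0 := by
  have hfc : Continuous f := continuous_iff_continuousAt.mpr fun x => (hf x).continuousAt
  have hint : Integrable (fun p : ℝ × ℝ => posPow a p.2 * f' (p.1 - p.2))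
      ((volume.restrict (Ioc 0 t)).prod volume) := by
    have hm : Measurable (fun p : ℝ × ℝ => posPow a p.2 * f' (p.1 - p.2)) :=
      ((measurable_posPow a).comp measurable_snd).mul
        (hf'.measurable.comp (measurable_fst.sub measurable_snd))
    rw [integrable_prod_iff hm.aestronglyMeasurable]
    refine ⟨ae_of_all _ fun s => integrable_posPow_mul ha ha0 hf' hfi' hC' s, ?_⟩
    have hc := continuous_posConv ha ha0 hf'.abs hfi'.abs (C := C') (fun x => by simpa using hC' x)
    refine (hc.integrableOn_Icc.mono_set Ioc_subset_Icc_self).congr (ae_of_all _ fun s => ?_)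
    simp only [posConv, norm_mul, Real.norm_eq_abs, abs_of_nonneg (posPow_nonneg _ _)]
  rw [intervalIntegral.integral_of_le ht]
  unfold posConv
  -- After Fubini the inner integral over s is f(t - y) - f(-y).
  rw [integral_integral_swap hint, ← integral_sub (integrable_posPow_mul ha ha0 hfc hfi hC t)
    (integrable_posPow_mul ha ha0 hfc hfi hC 0)]
  refine integral_congr_ae (ae_of_all _ fun y => ?_)
  simp only
  rw [integral_const_mul, ← mul_sub, ← intervalIntegral.integral_of_le ht,
    intervalIntegral.integral_comp_sub_right (fun s => f' s) y,
    intervalIntegral.integral_eq_sub_of_hasDerivAt (fun x _ => hf x)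
      (hf'.intervalIntegrable _ _)]

theorem exists_bound_schwartz (η : 𝓢(ℝ, ℝ)) : ∃ C, ∀ x, |η x| ≤ C :=
  ⟨_, fun x => by simpa using η.norm_le_seminorm ℝ x⟩

theorem schwartz_hasDerivAt (η : 𝓢(ℝ, ℝ)) (x : ℝ) :
    HasDerivAt η (SchwartzMap.derivCLM ℝ ℝ η x) x := by
  rw [SchwartzMap.derivCLM_apply]
  exact η.differentiableAt.hasDerivAt

/-! ### The operators on Schwartz functions -/

theorem opPlus_of_half_lt {H : ℝ} (h : 1 / 2 < H) (f : ℝ → ℝ) (x : ℝ) :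
    opPlus H f x = constK H / Real.Gamma (H - 1 / 2) * posConv (H - 3 / 2) f x := by
  rw [opPlus, if_pos h, posConv, ← integral_sub_left_eq_self _ volume x,
    ← integral_indicator measurableSet_Iio]
  congr 2
  ext y
  simp only [sub_sub_cancel]
  by_cases hy : y < x
  · rw [indicator_of_mem (by exact hy), posPow_of_pos (sub_pos.mpr hy), mul_comm]
  · rw [indicator_of_notMem (by exact hy), posPow_of_nonpos (by linarith), zero_mul]

/-- Integration by parts on (ε,∞) turns the truncated Marchaud derivative into a fractional integral
of η'. The boundary term (η(x) - η(x-ε)) ε^(-d) is of order ε^(1-d) and vanishes in the limit. -/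
theorem opPlus_of_lt_half {H : ℝ} (h0 : 0 < H) (h : H < 1 / 2) (η : 𝓢(ℝ, ℝ)) (x : ℝ) :
    opPlus H η x = constK H / Real.Gamma (H + 1 / 2) *
      posConv (H - 1 / 2) (SchwartzMap.derivCLM ℝ ℝ η) x := by
  set d := 1 / 2 - H with hd
  have hd0 : 0 < d := by linarith
  have hd1 : d < 1 / 2 := by linarith
  set η' := SchwartzMap.derivCLM ℝ ℝ η
  obtain ⟨C, hC⟩ := exists_bound_schwartz η
  obtain ⟨C', hC'⟩ := exists_bound_schwartz η'
  have hI : Integrable fun y => posPow (H - 1 / 2) y * η' (x - y) :=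
    integrable_posPow_mul (by linarith) (by linarith) η'.continuous η'.integrable hC' x
  have hder : ∀ y, HasDerivAt (fun y => η x - η (x - y)) (η' (x - y)) y := by
    intro y
    have := ((schwartz_hasDerivAt η (x - y)).comp y ((hasDerivAt_id y).const_sub x)).const_sub (η x)
    refine this.congr_deriv ?_
    ring
  have key : ∀ ε : ℝ, 0 < ε → ∫ y in Ioi ε, (η x - η (x - y)) / y ^ (3 / 2 - H) =
      (1 / d) * ((η x - η (x - ε)) * ε ^ (-d) +
        ∫ y in Ioi ε, posPow (H - 1 / 2) y * η' (x - y)) := by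
    intro ε hε
    have hw : ∀ y ∈ Ioi ε, HasDerivAt (fun y : ℝ => -(1 / d) * y ^ (-d)) (y ^ (-(3 / 2 - H))) y := by
      intro y hy
      have hy0 : 0 < y := hε.trans hy
      have := (Real.hasDerivAt_rpow_const (x := y) (p := -d) (Or.inl hy0.ne')).const_mul (-(1 / d))
      rw [show -d - 1 = -(3 / 2 - H) by rw [hd]; ring] at this
      refine this.congr_deriv ?_
      field_simp
    have hce : Tendsto (fun y : ℝ => (η x - η (x - y)) * (-(1 / d) * y ^ (-d))) (𝓝[>] ε)
        (𝓝 ((η x - η (x - ε)) * (-(1 / d) * ε ^ (-d)))) := by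
      refine tendsto_nhdsWithin_of_tendsto_nhds (ContinuousAt.tendsto ?_)
      refine ((hder ε).continuousAt).mul (continuousAt_const.mul ?_)
      exact Real.continuousAt_rpow_const _ _ (Or.inl hε.ne')
    have hinf : Tendsto (fun y : ℝ => (η x - η (x - y)) * (-(1 / d) * y ^ (-d))) atTop (𝓝 0) := by
      refine bdd_le_mul_tendsto_zero' (2 * C) (Eventually.of_forall fun y => ?_) ?_
      · calc |η x - η (x - y)| ≤ |η x| + |η (x - y)| := abs_sub _ _
          _ ≤ 2 * C := by linarith [hC x, hC (x - y)]
      · simpa using (tendsto_rpow_neg_atTop hd0).const_mul (-(1 / d))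
    have hi1 : IntegrableOn (fun y : ℝ => (η x - η (x - y)) * y ^ (-(3 / 2 - H))) (Ioi ε) := by
      refine (integrableOn_Ioi_rpow_of_lt (by linarith) hε).bdd_mul (c := 2 * C)
        (Continuous.aestronglyMeasurable ?_) (ae_of_all _ fun y => ?_)
      · exact continuous_const.sub (η.continuous.comp (continuous_const.sub continuous_id))
      · calc |η x - η (x - y)| ≤ |η x| + |η (x - y)| := abs_sub _ _
          _ ≤ 2 * C := by linarith [hC x, hC (x - y)]
    have heq : ∀ y ∈ Ioi ε, -(1 / d) * (posPow (H - 1 / 2) y * η' (x - y)) =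
        η' (x - y) * (-(1 / d) * y ^ (-d)) := by
      intro y hy
      rw [posPow_of_pos (hε.trans hy), show H - 1 / 2 = -d by rw [hd]; ring]; ring
    have hi2 : IntegrableOn (fun y : ℝ => η' (x - y) * (-(1 / d) * y ^ (-d))) (Ioi ε) :=
      IntegrableOn.congr_fun (hI.integrableOn.const_mul (-(1 / d))) heq measurableSet_Ioi
    have := integral_Ioi_mul_deriv_eq_deriv_mul (fun y _ => hder y) hw hi1 hi2 hce hinf
    rw [← setIntegral_congr_fun measurableSet_Ioi heq, integral_const_mul] at this
    rw [setIntegral_congr_fun (g := fun y : ℝ => (η x - η (x - y)) * y ^ (-(3 / 2 - H)))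
      measurableSet_Ioi (fun y hy => ?_), this]
    · ring
    · simp only
      rw [Real.rpow_neg (hε.trans hy).le]; rfl
  have hlim0 : Tendsto (fun ε : ℝ => (η x - η (x - ε)) * ε ^ (-d)) (𝓝[>] 0) (𝓝 0) := by
    have hL : ∀ ε : ℝ, 0 < ε → |η x - η (x - ε)| ≤ C' * ε := by
      intro ε hε
      have := Convex.norm_image_sub_le_of_norm_hasDerivWithin_le (f := η) (f' := η') (s := univ)
        (x := x - ε) (y := x) (C := C') (fun u _ => (schwartz_hasDerivAt η u).hasDerivWithinAt)
        (fun u _ => hC' u) convex_univ trivial trivial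
      simpa [abs_of_pos hε] using this
    refine squeeze_zero_norm' (a := fun ε : ℝ => C' * ε ^ (1 - d)) ?_ ?_
    · filter_upwards [self_mem_nhdsWithin] with ε hε
      have hε' : (0 : ℝ) < ε := hε
      rw [norm_mul, Real.norm_eq_abs, Real.norm_eq_abs, abs_of_pos (Real.rpow_pos_of_pos hε' _),
        show 1 - d = 1 + -d by ring, Real.rpow_add hε', Real.rpow_one, ← mul_assoc]
      exact mul_le_mul_of_nonneg_right (hL ε hε') (Real.rpow_nonneg hε'.le _)
    · have : Tendsto (fun ε : ℝ => C' * ε ^ (1 - d)) (𝓝 0) (𝓝 (C' * 0 ^ (1 - d))) :=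
        ((Real.continuousAt_rpow_const 0 (1 - d) (Or.inr (by linarith))).tendsto).const_mul C'
      rw [Real.zero_rpow (by linarith), mul_zero] at this
      exact tendsto_nhdsWithin_of_tendsto_nhds this
  have hlim1 : Tendsto (fun ε : ℝ => ∫ y in Ioi ε, posPow (H - 1 / 2) y * η' (x - y)) (𝓝[>] 0)
      (𝓝 (posConv (H - 1 / 2) η' x)) := by
    have e0 : posConv (H - 1 / 2) η' x = ∫ y in Ioi (0 : ℝ), posPow (H - 1 / 2) y * η' (x - y) := by
      rw [posConv, setIntegral_eq_integral_of_forall_compl_eq_zero]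
      intro y hy
      rw [posPow_of_nonpos (not_lt.mp hy), zero_mul]
    have hc : Tendsto (fun ε : ℝ => ∫ y in (0 : ℝ)..ε, posPow (H - 1 / 2) y * η' (x - y)) (𝓝[>] 0)
        (𝓝 0) := by
      have := (intervalIntegral.continuous_primitive (fun a b => hI.intervalIntegrable) 0).tendsto 0
      rw [intervalIntegral.integral_same] at this
      exact tendsto_nhdsWithin_of_tendsto_nhds this
    have := (tendsto_const_nhds (x := posConv (H - 1 / 2) η' x)).sub hc
    rw [sub_zero] at this
    refine this.congr' ?_
    filter_upwards [self_mem_nhdsWithin] with ε hε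
    rw [e0, ← intervalIntegral.integral_Ioi_sub_Ioi hI.integrableOn (le_of_lt hε)]
    ring
  rw [opPlus, if_neg (by linarith), if_pos h]
  refine Tendsto.limUnder_eq ?_
  have := ((hlim0.add hlim1).const_mul (1 / d)).const_mul
    (constK H * d / Real.Gamma (1 / 2 + H))
  refine (this.congr' ?_).trans (le_of_eq ?_)
  · filter_upwards [self_mem_nhdsWithin] with ε hε
    rw [key ε hε]
  · congr 1
    rw [zero_add, add_comm H]; field_simp

theorem continuous_opPlus {H : ℝ} (h0 : 0 < H) (h1 : H < 1) (η : 𝓢(ℝ, ℝ)) :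
    Continuous (opPlus H η) := by
  obtain ⟨C, hC⟩ := exists_bound_schwartz η
  obtain ⟨C', hC'⟩ := exists_bound_schwartz (SchwartzMap.derivCLM ℝ ℝ η)
  rcases lt_trichotomy H (1 / 2) with h | h | h
  · rw [funext fun x => opPlus_of_lt_half h0 h η x]
    exact continuous_const.mul (continuous_posConv (by linarith) (by linarith)
      (SchwartzMap.continuous _) (SchwartzMap.integrable _) hC')
  · have : opPlus H η = η := by ext x; simp [opPlus, h]
    rw [this]; exact η.continuous
  · rw [funext fun x => opPlus_of_half_lt h η x]
    exact continuous_const.mul (continuous_posConv (by linarith) (by linarith)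
      η.continuous η.integrable hC)


/-! ### The operators on functions supported in an interval -/

theorem constK_pos {H : ℝ} (h0 : 0 < H) : 0 < constK H := by
  unfold constK
  refine mul_pos (Real.Gamma_pos_of_pos (by linarith)) (Real.rpow_pos_of_pos ?_ _)
  exact add_pos_of_nonneg_of_pos (integral_nonneg fun s => sq_nonneg _) (by positivity)

theorem opMinus_of_half_lt {H : ℝ} (h : 1 / 2 < H) (f : ℝ → ℝ) (x : ℝ) :
    opMinus H f x =
      constK H / Real.Gamma (H - 1 / 2) * ∫ s, f s * posPow (H - 3 / 2) (s - x) := by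
  rw [opMinus, if_pos h, ← integral_indicator measurableSet_Ioi]
  congr 2
  ext s
  by_cases hs : x < s
  · rw [indicator_of_mem (by exact hs), posPow_of_pos (sub_pos.mpr hs)]
  · rw [indicator_of_notMem (by exact hs), posPow_of_nonpos (by linarith), mul_zero]

theorem integrableOn_posPow_sub {a : ℝ} (ha : -1 < a) (x : ℝ) {t : ℝ} (ht : 0 ≤ t) :
    IntegrableOn (fun s => posPow a (s - x)) (Ico 0 t) := by
  have := (intervalIntegrable_posPow ha (0 - x) (t - x)).comp_sub_right x
  simp only [sub_add_cancel] at this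
  exact (intervalIntegrable_iff_integrableOn_Ico_of_le ht).mp this

theorem integral_ind_mul_posPow {a : ℝ} (ha : 0 < a) (x : ℝ) {t : ℝ} (ht : 0 ≤ t) :
    ∫ s, ind 0 t s * posPow (a - 1) (s - x) = mvnKernel a t x / a := by
  rw [ind_eq_indicator ht, mvnKernel]
  have : ∀ s, (Ico 0 t).indicator 1 s * posPow (a - 1) (s - x) =
      (Ico 0 t).indicator (fun s => posPow (a - 1) (s - x)) s := by
    intro s; by_cases h : s ∈ Ico 0 t <;> simp [h]
  simp_rw [this]
  rw [integral_indicator measurableSet_Ico, integral_Ico_eq_integral_Ioo,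
    ← integral_Ioc_eq_integral_Ioo, ← intervalIntegral.integral_of_le ht,
    integral_posPow_sub ha x 0 t ht, zero_sub]

theorem opMinus_ind_of_half_lt {H : ℝ} (h : 1 / 2 < H) {t : ℝ} (ht : 0 ≤ t) (x : ℝ) :
    opMinus H (ind 0 t) x =
      constK H / Real.Gamma (H + 1 / 2) * mvnKernel (H - 1 / 2) t x := by
  have hb : 0 < H - 1 / 2 := by linarith
  rw [opMinus_of_half_lt h, show H - 3 / 2 = H - 1 / 2 - 1 by ring, integral_ind_mul_posPow hb x ht,
    show H + 1 / 2 = H - 1 / 2 + 1 by ring, Real.Gamma_add_one hb.ne']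
  have := (Real.Gamma_pos_of_pos hb).ne'
  field_simp

/-- The indicator is a difference of two shifted Heaviside functions θ. For w > 0 and ε < w, the
truncated integral for θ at w is the integral of y^(H-3/2) over (w,∞), and for w ≤ 0 it is 0. It no
longer depends on ε, so the limit is trivial. -/
theorem opMinus_const_mul_ind_of_lt_half {H : ℝ} (h0 : 0 < H) (h : H < 1 / 2) {t : ℝ} (ht : 0 ≤ t)
    (k x : ℝ) :
    opMinus H (fun s => k * ind 0 t s) x =
      k * (constK H / Real.Gamma (H + 1 / 2) * mvnKernel (H - 1 / 2) t x) := by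
  have hd0 : 0 < 1 / 2 - H := by linarith
  let θ : ℝ → ℝ := fun y => if 0 < y then 1 else 0
  have hind : ∀ x, ind 0 t x = θ (t - x) - θ (-x) := by
    intro x
    simp only [ind, θ]
    split_ifs <;> first | (norm_num; done) | (exfalso; grind)
  have key : ∀ w : ℝ, ∀ᶠ ε in 𝓝[>] (0 : ℝ),
      IntegrableOn (fun y => (θ w - θ (w - y)) / y ^ (3 / 2 - H)) (Ioi ε) ∧
      ∫ y in Ioi ε, (θ w - θ (w - y)) / y ^ (3 / 2 - H) = posPow (H - 1 / 2) w / (1 / 2 - H) := by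
    intro w
    rcases le_or_gt w 0 with hw | hw
    · filter_upwards [self_mem_nhdsWithin] with ε hε
      have : ∀ y ∈ Ioi ε, (0 : ℝ) = (θ w - θ (w - y)) / y ^ (3 / 2 - H) := by
        intro y hy
        have hy0 : (0 : ℝ) < y := lt_trans hε hy
        simp only [θ]
        rw [if_neg (by linarith), if_neg (by linarith)]; simp
      refine ⟨IntegrableOn.congr_fun integrableOn_zero this measurableSet_Ioi, ?_⟩
      rw [← setIntegral_congr_fun measurableSet_Ioi this, posPow_of_nonpos hw]
      simp
    · filter_upwards [Ioo_mem_nhdsGT hw] with ε hε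
      have : ∀ y ∈ Ioi ε, (Ici w).indicator (fun y => y ^ (-(3 / 2 - H))) y =
          (θ w - θ (w - y)) / y ^ (3 / 2 - H) := by
        intro y hy
        have hy0 : (0 : ℝ) < y := lt_trans hε.1 hy
        simp only [θ]
        rw [if_pos hw]
        by_cases h1 : w ≤ y
        · rw [indicator_of_mem (by exact h1), if_neg (by linarith), Real.rpow_neg hy0.le]; simp
        · rw [indicator_of_notMem (by exact h1), if_pos (by linarith)]; simp
      have hset : Ioi ε ∩ Ici w = Ici w := by
        ext y; simp only [mem_inter_iff, mem_Ioi, mem_Ici]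
        exact ⟨fun h => h.2, fun h => ⟨hε.2.trans_le h, h⟩⟩
      have hi := integrableOn_Ioi_rpow_of_lt (a := -(3 / 2 - H)) (by linarith) hw
      constructor
      · refine IntegrableOn.congr_fun ?_ this measurableSet_Ioi
        refine Integrable.integrableOn ?_
        rw [integrable_indicator_iff measurableSet_Ici]
        exact (integrableOn_Ici_iff_integrableOn_Ioi).mpr hi
      · rw [← setIntegral_congr_fun measurableSet_Ioi this, setIntegral_indicator measurableSet_Ici,
          hset, integral_Ici_eq_integral_Ioi, integral_Ioi_rpow_of_lt (by linarith) hw,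
          posPow_of_pos hw, show -(3 / 2 - H) + 1 = H - 1 / 2 by ring,
          show (1 / 2 - H) = -(H - 1 / 2) by ring, div_neg, neg_div]
  rw [opMinus, if_neg (by linarith), if_pos h]
  refine Tendsto.limUnder_eq (tendsto_const_nhds.congr' ?_)
  filter_upwards [key (t - x), key (-x)] with ε h1 h2
  have e : ∀ y, (k * ind 0 t x - k * ind 0 t (x + y)) / y ^ (3 / 2 - H) =
      k * ((θ (t - x) - θ (t - x - y)) / y ^ (3 / 2 - H) -
        (θ (-x) - θ (-x - y)) / y ^ (3 / 2 - H)) := by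
    intro y
    rw [hind, hind, show t - (x + y) = t - x - y by ring, show -(x + y) = -x - y by ring]; ring
  simp_rw [e]
  rw [integral_const_mul, integral_sub h1.1 h2.1, h1.2, h2.2, mvnKernel, add_comm (1 / 2) H]
  have h3 : 1 - H * 2 ≠ 0 := by linarith
  field_simp

/-! ### Regularity `H > 1/2` -/

section halfLt

variable {H N t : ℝ} {f : ℝ → ℝ} (h : 1 / 2 < H) (h1 : H < 1) (ht : 0 ≤ t) (hf : Measurable f)
  (hN : ∀ s, |f s| ≤ N * ind 0 t s)

include hN ht hf in
theorem integrable_mul_posPow_sub {a : ℝ} (ha : -1 < a) (x : ℝ) :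
    Integrable fun s => f s * posPow a (s - x) := by
  have hi : Integrable fun s => N * (ind 0 t s * posPow a (s - x)) := by
    refine Integrable.const_mul ?_ N
    have : (fun s => ind 0 t s * posPow a (s - x)) =
        (Ico 0 t).indicator (fun s => posPow a (s - x)) := by
      ext s
      rw [ind_eq_indicator ht]; by_cases h : s ∈ Ico 0 t <;> simp [h]
    rw [this, integrable_indicator_iff measurableSet_Ico]
    exact integrableOn_posPow_sub ha x ht
  refine hi.mono' (hf.mul ((measurable_posPow a).comp (measurable_sub_const x))).aestronglyMeasurable
    (ae_of_all _ fun s => ?_)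
  rw [norm_mul, Real.norm_eq_abs, Real.norm_eq_abs, abs_of_nonneg (posPow_nonneg _ _), ← mul_assoc]
  exact mul_le_mul_of_nonneg_right (hN s) (posPow_nonneg _ _)

include hf in
theorem measurable_integral_mul_posPow (a : ℝ) :
    Measurable fun x => ∫ s, f s * posPow a (s - x) := by
  have : Measurable fun p : ℝ × ℝ => f p.2 * posPow a (p.2 - p.1) :=
    (hf.comp measurable_snd).mul ((measurable_posPow a).comp (measurable_snd.sub measurable_fst))
  exact (this.stronglyMeasurable.integral_prod_right (ν := volume)).measurable

include h hN ht hf in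
-- The kernel is positive, so the operator is monotone and compares `f` with an indicator.
theorem abs_opMinus_le (x : ℝ) : |opMinus H f x| ≤ N * opMinus H (ind 0 t) x := by
  have hc : 0 ≤ constK H / Real.Gamma (H - 1 / 2) :=
    div_nonneg (constK_pos (by linarith)).le (Real.Gamma_pos_of_pos (by linarith)).le
  have hi : Integrable fun s => ind 0 t s * posPow (H - 3 / 2) (s - x) :=
    integrable_mul_posPow_sub (N := 1) ht (measurable_ind 0 t) (fun s => by
      rw [ind_eq_indicator ht]; by_cases h : s ∈ Ico 0 t <;> simp [h]) (by linarith) x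
  rw [opMinus_of_half_lt h, opMinus_of_half_lt h, abs_mul, abs_of_nonneg hc, mul_left_comm]
  refine mul_le_mul_of_nonneg_left ?_ hc
  rw [← integral_const_mul]
  refine (abs_integral_le_integral_abs).trans (integral_mono_of_nonneg (ae_of_all _ fun s => abs_nonneg _)
    (hi.const_mul N) (ae_of_all _ fun s => ?_))
  simp only
  rw [abs_mul, abs_of_nonneg (posPow_nonneg _ _), ← mul_assoc]
  exact mul_le_mul_of_nonneg_right (hN s) (posPow_nonneg _ _)

include h h1 hN ht hf in
theorem memLp_opMinus_of_half_lt : MemLp (opMinus H f) 2 volume := by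
  have h2 : MemLp (fun x => N * opMinus H (ind 0 t) x) 2 volume := by
    refine MemLp.const_mul ?_ N
    rw [funext fun x => opMinus_ind_of_half_lt h ht x]
    exact (memLp_mvnKernel (by linarith) (by linarith) ht).const_mul _
  refine h2.mono' ?_ (ae_of_all _ (abs_opMinus_le h ht hf hN))
  rw [funext fun x => opMinus_of_half_lt h f x]
  exact ((measurable_integral_mul_posPow hf _).const_mul _).aestronglyMeasurable

include h h1 hN ht hf in
-- Fubini's theorem; absolute integrability holds because the operator applied to |f| and the
-- function η both lie in L².
theorem integral_opMinus_mul_of_half_lt (η : 𝓢(ℝ, ℝ)) :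
    ∫ x, opMinus H f x * η x = ∫ s, f s * opPlus H η s := by
  have habs : ∀ s, |(|f s|)| ≤ N * ind 0 t s := by simpa using hN
  have hc : constK H / Real.Gamma (H - 1 / 2) ≠ 0 :=
    (div_pos (constK_pos (by linarith)) (Real.Gamma_pos_of_pos (by linarith))).ne'
  have hm : MemLp (fun x => ∫ s, |f s| * posPow (H - 3 / 2) (s - x)) 2 volume := by
    have := (memLp_opMinus_of_half_lt h h1 ht hf.abs habs).const_mul
      (constK H / Real.Gamma (H - 1 / 2))⁻¹
    refine this.ae_eq (ae_of_all _ fun x => ?_)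
    simp only [opMinus_of_half_lt h]
    rw [inv_mul_cancel_left₀ hc]
  have hint : Integrable (fun p : ℝ × ℝ => f p.2 * posPow (H - 3 / 2) (p.2 - p.1) * η p.1)
      (volume.prod volume) := by
    have hmeas : Measurable (fun p : ℝ × ℝ => f p.2 * posPow (H - 3 / 2) (p.2 - p.1) * η p.1) :=
      ((hf.comp measurable_snd).mul
        ((measurable_posPow _).comp (measurable_snd.sub measurable_fst))).mul
        (η.continuous.measurable.comp measurable_fst)
    rw [integrable_prod_iff hmeas.aestronglyMeasurable]
    refine ⟨ae_of_all _ fun x =>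
      (integrable_mul_posPow_sub (a := H - 3 / 2) ht hf hN (by linarith) x).mul_const (η x), ?_⟩
    refine (hm.integrable_mul ((η.memLp 2 volume).norm)).congr (ae_of_all _ fun x => ?_)
    simp only [norm_mul, Pi.mul_apply, Real.norm_eq_abs, abs_of_nonneg (posPow_nonneg _ _)]
    rw [integral_mul_const]
  simp_rw [opMinus_of_half_lt h, opPlus_of_half_lt h, mul_assoc, mul_left_comm _ (constK H / _)]
  rw [integral_const_mul, integral_const_mul]
  congr 1
  simp_rw [← integral_mul_const]
  rw [integral_integral_swap hint]
  refine integral_congr_ae (ae_of_all _ fun s => ?_)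
  simp only [posConv]
  rw [← integral_sub_left_eq_self (fun y => posPow (H - 3 / 2) y * η (s - y)) volume s,
    ← integral_const_mul]
  refine integral_congr_ae (ae_of_all _ fun x => ?_)
  simp only [sub_sub_cancel]; ring

end halfLt


/-! ### The variance function for `H > 1/2` -/

theorem posPow_mul {a l : ℝ} (hl : 0 < l) (y : ℝ) : posPow a (l * y) = l ^ a * posPow a y := by
  rcases le_or_gt y 0 with h | h
  · rw [posPow_of_nonpos h, posPow_of_nonpos (mul_nonpos_of_nonneg_of_nonpos hl.le h), mul_zero]
  · rw [posPow_of_pos h, posPow_of_pos (mul_pos hl h), Real.mul_rpow hl.le h.le]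

/-- The scaling relation for the overlap of two truncated powers. -/
theorem integral_posPow_mul_posPow (a : ℝ) {u s : ℝ} (h : u < s) :
    ∫ x, posPow a (u - x) * posPow a (s - x) =
      (∫ z, posPow a z * posPow a (1 + z)) * posPow (2 * a + 1) (s - u) := by
  have hl : 0 < s - u := sub_pos.mpr h
  rw [← integral_sub_left_eq_self _ volume u]
  have e : ∀ z, posPow a ((s - u) * z) * posPow a (s - u + (s - u) * z) =
      (s - u) ^ (2 * a) * (posPow a z * posPow a (1 + z)) := by
    intro z
    rw [show s - u + (s - u) * z = (s - u) * (1 + z) by ring, posPow_mul hl, posPow_mul hl,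
      two_mul, Real.rpow_add hl]
    ring
  -- The exponent 2a + 1 is made of 2a from homogeneity and 1 from the Jacobian.
  have h2 := Measure.integral_comp_mul_left
    (fun y => posPow a y * posPow a (s - u + y)) (s - u)
  simp_rw [e] at h2
  rw [integral_const_mul, abs_of_pos (inv_pos.mpr hl), smul_eq_mul] at h2
  have h3 : ∀ y, posPow a (u - (u - y)) * posPow a (s - (u - y)) =
      posPow a y * posPow a (s - u + y) := by
    intro y; congr 2 <;> ring
  simp_rw [h3]
  rw [posPow_of_pos hl, Real.rpow_add_one hl.ne']
  field_simp at h2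
  linear_combination -h2

theorem integral_posPow_mul_posPow_of_ne (a : ℝ) {u s : ℝ} (h : u ≠ s) :
    ∫ x, posPow a (u - x) * posPow a (s - x) = (∫ z, posPow a z * posPow a (1 + z)) *
      (posPow (2 * a + 1) (u - s) + posPow (2 * a + 1) (s - u)) := by
  rcases lt_or_gt_of_ne h with h | h
  · rw [integral_posPow_mul_posPow a h, posPow_of_nonpos (y := u - s) (by linarith), zero_add]
  · simp_rw [mul_comm (posPow a (u - _))]
    rw [integral_posPow_mul_posPow a h, posPow_of_nonpos (y := s - u) (by linarith), add_zero]

section halfLt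

variable {H N t : ℝ} {f : ℝ → ℝ} (h : 1 / 2 < H) (h1 : H < 1) (ht : 0 ≤ t) (hf : Measurable f)
  (hN : ∀ s, |f s| ≤ N * ind 0 t s)

include hN ht hf in
-- For u in [0,t) the inner integral is bounded by N times the integral of the power over (0,t],
-- uniformly in u.
theorem integrable_mul_mul_posPow {a : ℝ} (ha : -1 < a) :
    Integrable (fun p : ℝ × ℝ => f p.1 * (f p.2 * posPow a (p.2 - p.1))) (volume.prod volume) := by
  have hm : Measurable (fun p : ℝ × ℝ => f p.1 * (f p.2 * posPow a (p.2 - p.1))) :=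
    (hf.comp measurable_fst).mul ((hf.comp measurable_snd).mul
      ((measurable_posPow _).comp (measurable_snd.sub measurable_fst)))
  have hind : Integrable (ind 0 t) := (memLp_one_iff_integrable).mp (memLp_ind 0 t 1)
  have hN0 : ∀ s, 0 ≤ N * ind 0 t s := fun s => (abs_nonneg _).trans (hN s)
  rw [integrable_prod_iff hm.aestronglyMeasurable]
  refine ⟨ae_of_all _ fun u => (integrable_mul_posPow_sub ht hf hN ha u).const_mul (f u), ?_⟩
  simp_rw [norm_mul, Real.norm_eq_abs, abs_of_nonneg (posPow_nonneg _ _)]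
  simp_rw [integral_const_mul]
  refine (hind.const_mul (N * (N * ∫ s in Ioc 0 t, posPow a s))).mono'
    ((hf.abs.mul (measurable_integral_mul_posPow hf.abs a)).aestronglyMeasurable)
    (ae_of_all _ fun u => ?_)
  by_cases hu : u ∈ Ico 0 t
  · have e1 : ind 0 t u = 1 := by rw [ind_eq_indicator ht]; simp [hu]
    have hfu := hN u
    rw [e1, mul_one] at hfu
    have hN' : 0 ≤ N := (abs_nonneg _).trans hfu
    have hI0 : 0 ≤ ∫ s, |f s| * posPow a (s - u) :=
      integral_nonneg fun s => mul_nonneg (abs_nonneg _) (posPow_nonneg _ _)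
    have hint : IntegrableOn (posPow a) (Ioc 0 t) :=
      (intervalIntegrable_iff_integrableOn_Ioc_of_le ht).mp (intervalIntegrable_posPow ha 0 t)
    have hI : ∫ s, |f s| * posPow a (s - u) ≤ N * ∫ s in Ioc 0 t, posPow a s := by
      rw [← integral_const_mul, ← integral_add_right_eq_self _ u, ← integral_indicator measurableSet_Ioc]
      refine integral_mono_of_nonneg (ae_of_all _ fun s => mul_nonneg (abs_nonneg _) (posPow_nonneg _ _))
        ((integrable_indicator_iff measurableSet_Ioc).mpr (hint.const_mul N)) (ae_of_all _ fun s => ?_)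
      simp only [add_sub_cancel_right]
      by_cases hs : s ∈ Ioc 0 t
      · rw [indicator_of_mem hs]
        refine mul_le_mul_of_nonneg_right ((hN _).trans ?_) (posPow_nonneg _ _)
        rw [ind_eq_indicator ht]
        exact mul_le_of_le_one_right hN' (indicator_le_self' (fun _ _ => zero_le_one) _)
      · rw [indicator_of_notMem hs]
        rcases le_or_gt s 0 with h0 | h0
        · rw [posPow_of_nonpos h0, mul_zero]
        · have hst : t < s := by by_contra hh; exact hs ⟨h0, not_lt.mp hh⟩
          have := hN (s + u)
          rw [ind_eq_indicator ht, indicator_of_notMem (by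
            simp only [mem_Ico, not_and, not_lt]; intro _; linarith [hu.1]), mul_zero] at this
          rw [le_antisymm this (abs_nonneg _), zero_mul]
    rw [e1, mul_one, Real.norm_eq_abs, abs_mul, abs_abs, abs_of_nonneg hI0]
    exact mul_le_mul hfu hI hI0 hN'
  · have := hN u
    have e1 : ind 0 t u = 0 := by rw [ind_eq_indicator ht]; simp [hu]
    rw [e1, mul_zero] at this
    rw [e1, le_antisymm this (abs_nonneg _)]; simp

include h h1 hN ht hf in
-- The square is written as a double integral in (u, s) and x is integrated first. The overlap of
-- two truncated powers is a multiple of |s - u|^(2H-2). By symmetry the halves s < u and u < s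
-- contribute equally, which gives the factor 2 and a one-sided convolution.
theorem integral_sq_opMinus_of_half_lt :
    ∫ x, opMinus H f x ^ 2 = (constK H / Real.Gamma (H - 1 / 2)) ^ 2 *
      ((∫ z, posPow (H - 3 / 2) z * posPow (H - 3 / 2) (1 + z)) *
        (2 * ∫ u, f u * posConv (2 * H - 2) f u)) := by
  set a := H - 3 / 2 with ha
  set D := ∫ z, posPow a z * posPow a (1 + z) with hD
  have ha1 : -1 < a := by linarith
  have hb1 : -1 < 2 * H - 2 := by linarith
  have habs : ∀ s, |(|f s|)| ≤ N * ind 0 t s := by simpa using hN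
  have hc : constK H / Real.Gamma (H - 1 / 2) ≠ 0 :=
    (div_pos (constK_pos (by linarith)) (Real.Gamma_pos_of_pos (by linarith))).ne'
  simp_rw [opMinus_of_half_lt h, mul_pow, ← ha]
  rw [integral_const_mul]
  congr 1
  let J : ℝ → ℝ × ℝ → ℝ := fun x p => (f p.1 * posPow a (p.1 - x)) * (f p.2 * posPow a (p.2 - x))
  have hsq : ∀ x, (∫ s, f s * posPow a (s - x)) ^ 2 = ∫ p, J x p ∂(volume.prod volume) := by
    intro x
    rw [sq, ← integral_prod_mul]
  have hint : Integrable (Function.uncurry J) (volume.prod (volume.prod volume)) := by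
    have hm : Measurable (Function.uncurry J) := by
      have m1 : Measurable fun q : ℝ × ℝ × ℝ => q.2.1 - q.1 := by fun_prop
      have m2 : Measurable fun q : ℝ × ℝ × ℝ => q.2.2 - q.1 := by fun_prop
      exact ((hf.comp (measurable_fst.comp measurable_snd)).mul
        ((measurable_posPow a).comp m1)).mul
        ((hf.comp (measurable_snd.comp measurable_snd)).mul ((measurable_posPow a).comp m2))
    rw [integrable_prod_iff hm.aestronglyMeasurable]
    constructor
    · refine ae_of_all _ fun x => ?_
      exact (integrable_mul_posPow_sub ht hf hN ha1 x).mul_prod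
        (integrable_mul_posPow_sub ht hf hN ha1 x)
    · have hm2 := (memLp_opMinus_of_half_lt h h1 ht hf.abs habs).const_mul
        (constK H / Real.Gamma (H - 1 / 2))⁻¹
      refine hm2.integrable_sq.congr (ae_of_all _ fun x => ?_)
      simp only [opMinus_of_half_lt h, Function.uncurry, J]
      rw [inv_mul_cancel_left₀ hc, sq, ← integral_prod_mul]
      refine integral_congr_ae (ae_of_all _ fun p => ?_)
      simp only [norm_mul, Real.norm_eq_abs, abs_of_nonneg (posPow_nonneg _ _), ha]
  simp_rw [hsq]
  have e1 : ∫ x, ∫ p, J x p ∂(volume.prod volume) =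
      ∫ p : ℝ × ℝ, f p.1 * f p.2 * ∫ x, posPow a (p.1 - x) * posPow a (p.2 - x) := by
    rw [integral_integral_swap hint]
    refine integral_congr_ae (ae_of_all _ fun p => ?_)
    simp only [J]
    rw [← integral_const_mul]
    refine integral_congr_ae (ae_of_all _ fun x => ?_)
    simp only; ring
  have hK1 := integrable_mul_mul_posPow ht hf hN hb1
  have hK2 : Integrable (fun p : ℝ × ℝ => f p.2 * (f p.1 * posPow (2 * H - 2) (p.1 - p.2)))
      (volume.prod volume) := hK1.swap
  have e2 : ∀ᵐ p : ℝ × ℝ ∂(volume.prod volume),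
      f p.1 * f p.2 * ∫ x, posPow a (p.1 - x) * posPow a (p.2 - x) =
      D * (f p.2 * (f p.1 * posPow (2 * H - 2) (p.1 - p.2)) +
        f p.1 * (f p.2 * posPow (2 * H - 2) (p.2 - p.1))) := by
    -- The overlap formula excludes the diagonal, which is a null set.
    have hne : ∀ᵐ p : ℝ × ℝ ∂(volume.prod volume), p.1 ≠ p.2 := by
      have hms : MeasurableSet {p : ℝ × ℝ | p.1 ≠ p.2} :=
        (measurableSet_eq_fun measurable_fst measurable_snd).compl
      rw [Measure.ae_prod_iff_ae_ae hms]
      refine ae_of_all _ fun u => ?_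
      have : ∀ᵐ s : ℝ, s ≠ u := by simp [ae_iff]
      filter_upwards [this] with s hs using hs.symm
    filter_upwards [hne] with p hp
    rw [integral_posPow_mul_posPow_of_ne a hp, show 2 * a + 1 = 2 * H - 2 by rw [ha]; ring]
    ring
  rw [e1]
  refine (integral_congr_ae e2).trans ?_
  rw [integral_const_mul]
  congr 1
  have hs : ∫ p : ℝ × ℝ, f p.2 * (f p.1 * posPow (2 * H - 2) (p.1 - p.2))
      ∂(volume.prod volume) =
      ∫ p : ℝ × ℝ, f p.1 * (f p.2 * posPow (2 * H - 2) (p.2 - p.1)) ∂(volume.prod volume) := by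
    exact integral_prod_swap (μ := (volume : Measure ℝ)) (ν := (volume : Measure ℝ))
      (fun p : ℝ × ℝ => f p.1 * (f p.2 * posPow (2 * H - 2) (p.2 - p.1)))
  rw [integral_add hK2 hK1, hs, ← two_mul]
  congr 1
  rw [← hs, integral_prod _ hK2]
  refine integral_congr_ae (ae_of_all _ fun u => ?_)
  simp only [posConv]
  rw [← integral_sub_left_eq_self (fun y => posPow (2 * H - 2) y * f (u - y)) volume u,
    ← integral_const_mul]
  refine integral_congr_ae (ae_of_all _ fun s => ?_)
  simp only [sub_sub_cancel]; ring

end halfLt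


/-! ### Integrands of the Gaussian part -/

theorem opMinus_ind {H : ℝ} (h0 : 0 < H) {t : ℝ} (ht : 0 ≤ t) (x : ℝ) :
    opMinus H (ind 0 t) x =
      constK H / Real.Gamma (H + 1 / 2) * mvnKernel (H - 1 / 2) t x := by
  rcases lt_trichotomy H (1 / 2) with h | h | h
  · simpa using opMinus_const_mul_ind_of_lt_half h0 h ht 1 x
  · subst h
    -- For exponent 0 the integral in the constant vanishes and 1/(2H) = 1. The kernel becomes
    -- 1_{x<t} - 1_{x<0}, the indicator of [0,t) with the same half-open convention.
    have hK : constK (1 / 2) = 1 := by simp [constK]; norm_num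
    rw [opMinus, if_neg (lt_irrefl _), if_neg (lt_irrefl _), hK]
    have h1 : Real.Gamma ((1 / 2 : ℝ) + 1 / 2) = 1 := by norm_num
    rw [h1]
    simp only [ind, mvnKernel, posPow, sub_self, Real.rpow_zero]
    split_ifs <;> first | (norm_num; done) | (exfalso; grind)
  · exact opMinus_ind_of_half_lt h ht x

theorem integral_sq_opMinus_ind {H : ℝ} (h0 : 0 < H) (h1 : H < 1) {t : ℝ} (ht : 0 ≤ t) :
    ∫ x, opMinus H (ind 0 t) x ^ 2 = t ^ (2 * H) := by
  simp_rw [opMinus_ind h0 ht]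
  exact integral_sq_const_mul_mvnKernel h0 h1 ht

theorem memLp_opMinus_ind {H : ℝ} (h0 : 0 < H) (h1 : H < 1) {t : ℝ} (ht : 0 ≤ t) :
    MemLp (opMinus H (ind 0 t)) 2 volume := by
  rw [funext (opMinus_ind h0 ht)]
  exact (memLp_mvnKernel (by linarith) (by linarith) ht).const_mul _

theorem abs_le_sSup_image {ν : ℝ → ℝ} (hν : ContinuousOn ν (Ici 0)) {T s : ℝ} (hs : s ∈ Icc 0 T) :
    |ν s| ≤ sSup ((fun s => |ν s|) '' Icc 0 T) :=
  le_csSup ((isCompact_Icc.image_of_continuousOn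
    (hν.mono fun _ h => h.1).abs).bddAbove) (mem_image_of_mem _ hs)

/-- The continuous extension of a function on `[0,T]` that is constant on both sides. -/
def clampExt (T : ℝ) (ν : ℝ → ℝ) (s : ℝ) : ℝ := ν (max 0 (min s T))

theorem clampExt_of_mem {T s : ℝ} (hs : s ∈ Icc 0 T) (ν : ℝ → ℝ) : clampExt T ν s = ν s := by
  rw [clampExt, min_eq_left hs.2, max_eq_right hs.1]

section integrand

variable {H : ℝ} {ν : ℝ → ℝ} (h0 : 0 < H) (h1 : H < 1) (hν : ContinuousOn ν (Ici 0))
  (hk : H < 1 / 2 → ∃ k, ∀ s, 0 ≤ s → ν s = k) {T t : ℝ}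

include hν in
theorem continuous_clampExt : Continuous (clampExt T ν) :=
  hν.comp_continuous (by fun_prop) fun _ => mem_Ici.mpr (le_max_left _ _)

include hν in
theorem abs_clampExt_le (hT : 0 ≤ T) (s : ℝ) :
    |clampExt T ν s| ≤ sSup ((fun s => |ν s|) '' Icc 0 T) :=
  abs_le_sSup_image hν ⟨le_max_left _ _, max_le hT (min_le_right _ _)⟩

theorem ind_of_mem {s : ℝ} (hs : s ∈ Ico 0 t) : ind 0 t s = 1 := by
  rw [ind_eq_indicator (hs.1.trans hs.2.le)]; simp [hs]

theorem ind_of_notMem {s : ℝ} (ht : 0 ≤ t) (hs : s ∉ Ico 0 t) : ind 0 t s = 0 := by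
  rw [ind_eq_indicator ht]; simp [hs]

theorem mul_ind_eq_clampExt (ht : t ∈ Icc 0 T) :
    (fun s => ν s * ind 0 t s) = fun s => clampExt T ν s * ind 0 t s := by
  ext s
  by_cases hs : s ∈ Ico 0 t
  · rw [clampExt_of_mem ⟨hs.1, hs.2.le.trans ht.2⟩]
  · rw [ind_of_notMem ht.1 hs, mul_zero, mul_zero]

include hν in
theorem measurable_mul_ind (ht : 0 ≤ t) : Measurable fun s => ν s * ind 0 t s := by
  rw [mul_ind_eq_clampExt (T := t) ⟨ht, le_rfl⟩]
  exact (continuous_clampExt hν).measurable.mul (measurable_ind 0 t)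

include hν in
theorem abs_mul_ind_le (ht : t ∈ Icc 0 T) (s : ℝ) :
    |ν s * ind 0 t s| ≤ sSup ((fun s => |ν s|) '' Icc 0 T) * ind 0 t s := by
  by_cases hs : s ∈ Ico 0 t
  · rw [ind_of_mem hs, mul_one, mul_one]
    exact abs_le_sSup_image hν ⟨hs.1, hs.2.le.trans ht.2⟩
  · rw [ind_of_notMem ht.1 hs]; simp

/-- If `ν = k` on `[0,∞)` then `ν 1_(0,t) = k 1_(0,t)`. -/
theorem mul_ind_eq_const {k : ℝ} (h : ∀ s, 0 ≤ s → ν s = k) (ht : 0 ≤ t) :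
    (fun s => ν s * ind 0 t s) = fun s => k * ind 0 t s := by
  ext s
  by_cases hs : s ∈ Ico 0 t
  · rw [h s hs.1]
  · rw [ind_of_notMem ht hs, mul_zero, mul_zero]

include h0 hν hk in
-- The kernel of the integral of ν is dominated pointwise by that of fractional Brownian motion: by
-- linearity for constant ν if H < 1/2, trivially if H = 1/2, by positivity if H > 1/2.
theorem abs_opMinus_mul_ind_le (ht : t ∈ Icc 0 T) (x : ℝ) :
    |opMinus H (fun s => ν s * ind 0 t s) x| ≤
      sSup ((fun s => |ν s|) '' Icc 0 T) * |opMinus H (ind 0 t) x| := by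
  have hN0 : 0 ≤ sSup ((fun s => |ν s|) '' Icc 0 T) :=
    (abs_nonneg _).trans (abs_le_sSup_image hν (s := 0) ⟨le_rfl, ht.1.trans ht.2⟩)
  rcases lt_trichotomy H (1 / 2) with h | h | h
  · obtain ⟨k, hk⟩ := hk h
    rw [mul_ind_eq_const hk ht.1, opMinus_const_mul_ind_of_lt_half h0 h ht.1, opMinus_ind h0 ht.1,
      abs_mul]
    refine mul_le_mul_of_nonneg_right ?_ (abs_nonneg _)
    rw [← hk 0 le_rfl]
    exact abs_le_sSup_image hν ⟨le_rfl, ht.1.trans ht.2⟩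
  · subst h
    simp only [opMinus, lt_irrefl, if_false]
    refine (abs_mul_ind_le hν ht x).trans (mul_le_mul_of_nonneg_left (le_abs_self _) hN0)
  · exact (abs_opMinus_le h ht.1 (measurable_mul_ind hν ht.1) (abs_mul_ind_le hν ht) x).trans
      (mul_le_mul_of_nonneg_left (le_abs_self _) hN0)

include h0 h1 hν hk in
theorem memLp_opMinus_mul_ind (ht : 0 ≤ t) :
    MemLp (opMinus H fun s => ν s * ind 0 t s) 2 volume := by
  refine ((memLp_opMinus_ind h0 h1 ht).norm.const_mul
    (sSup ((fun s => |ν s|) '' Icc 0 t))).mono' ?_ (ae_of_all _ fun x => ?_)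
  · rcases lt_trichotomy H (1 / 2) with h | h | h
    · obtain ⟨k, hk⟩ := hk h
      rw [mul_ind_eq_const hk ht, funext fun x => opMinus_const_mul_ind_of_lt_half h0 h ht k x]
      exact (((measurable_mvnKernel _ _).const_mul _).const_mul _).aestronglyMeasurable
    · subst h
      have : (opMinus (1 / 2) fun s => ν s * ind 0 t s) = fun s => ν s * ind 0 t s := by
        ext x; simp [opMinus]
      rw [this]
      exact (measurable_mul_ind hν ht).aestronglyMeasurable
    · exact (memLp_opMinus_of_half_lt h h1 ht (measurable_mul_ind hν ht)
        (abs_mul_ind_le hν ⟨ht, le_rfl⟩)).1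
  · exact abs_opMinus_mul_ind_le h0 hν hk ⟨ht, le_rfl⟩ x

include h0 h1 hν hk in
-- Through this bound the growth condition l (2 T^H max|ν|)² < 1 becomes a bound on 4 l times the
-- variance.
theorem varianceFun_le (ht : t ∈ Icc 0 T) :
    varianceFun H ν t ≤ (T ^ H * sSup ((fun s => |ν s|) '' Icc 0 T)) ^ 2 := by
  set N := sSup ((fun s => |ν s|) '' Icc 0 T)
  have hT : 0 ≤ T := ht.1.trans ht.2
  calc varianceFun H ν t ≤ ∫ x, N ^ 2 * opMinus H (ind 0 t) x ^ 2 := by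
        refine integral_mono_of_nonneg (ae_of_all _ fun x => sq_nonneg _)
          ((memLp_opMinus_ind h0 h1 ht.1).integrable_sq.const_mul _) (ae_of_all _ fun x => ?_)
        have := pow_le_pow_left₀ (abs_nonneg _) (abs_opMinus_mul_ind_le h0 hν hk ht x) 2
        rw [mul_pow, sq_abs, sq_abs] at this
        exact this
    _ = N ^ 2 * t ^ (2 * H) := by rw [integral_const_mul, integral_sq_opMinus_ind h0 h1 ht.1]
    _ ≤ N ^ 2 * T ^ (2 * H) := mul_le_mul_of_nonneg_left
        (Real.rpow_le_rpow ht.1 ht.2 (by linarith)) (sq_nonneg _)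
    _ = (T ^ H * N) ^ 2 := by
        rw [mul_comm 2 H, Real.rpow_mul hT, mul_pow, mul_comm]; norm_cast

include h0 h1 hν hk in
/-- The operators `M_-^H` and `M_+^H` are adjoint to each other. -/
theorem integral_opMinus_mul_schwartz (ht : 0 ≤ t) (η : 𝓢(ℝ, ℝ)) :
    ∫ x, opMinus H (fun s => ν s * ind 0 t s) x * η x =
      ∫ s in (0 : ℝ)..t, ν s * opPlus H η s := by
  have hset : ∀ g : ℝ → ℝ, ∫ s, (ν s * ind 0 t s) * g s = ∫ s in (0 : ℝ)..t, ν s * g s := by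
    intro g
    rw [intervalIntegral.integral_of_le ht, integral_Ioc_eq_integral_Ioo,
      ← integral_Ico_eq_integral_Ioo, ← integral_indicator measurableSet_Ico]
    refine integral_congr_ae (ae_of_all _ fun s => ?_)
    by_cases hs : s ∈ Ico 0 t
    · simp only [ind_of_mem hs, indicator_of_mem hs, mul_one]
    · simp only [ind_of_notMem ht hs, indicator_of_notMem hs, mul_zero, zero_mul]
  rcases lt_trichotomy H (1 / 2) with h | h | h
  · obtain ⟨k, hk⟩ := hk h
    obtain ⟨C, hC⟩ := exists_bound_schwartz η
    obtain ⟨C', hC'⟩ := exists_bound_schwartz (SchwartzMap.derivCLM ℝ ℝ η)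
    have hb1 : -1 < H - 1 / 2 := by linarith
    have hb0 : H - 1 / 2 < 0 := by linarith
    have e : ∀ r, posConv (H - 1 / 2) η r = ∫ x, posPow (H - 1 / 2) (r - x) * η x := by
      intro r
      rw [posConv, ← integral_sub_left_eq_self _ volume r]
      simp
    have hi : ∀ r, Integrable fun x => posPow (H - 1 / 2) (r - x) * η x := by
      intro r
      have := (integrable_posPow_mul hb1 hb0 η.continuous η.integrable hC r).comp_sub_left r
      simpa using this
    rw [mul_ind_eq_const hk ht]
    simp_rw [opMinus_const_mul_ind_of_lt_half h0 h ht, opPlus_of_lt_half h0 h, mvnKernel]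
    have e1 : ∀ x, k * (constK H / Real.Gamma (H + 1 / 2) *
        (posPow (H - 1 / 2) (t - x) - posPow (H - 1 / 2) (-x))) * η x =
        k * (constK H / Real.Gamma (H + 1 / 2)) *
        (posPow (H - 1 / 2) (t - x) * η x - posPow (H - 1 / 2) (0 - x) * η x) := by
      intro x; rw [zero_sub]; ring
    simp_rw [e1]
    -- For H < 1/2 the left side is an increment of the fractional integral of η, and M_+^H η is a
    -- multiple of the derivative of that integral.
    rw [integral_const_mul, integral_sub (hi t) (hi 0), ← e, ← e,
      ← integral_posConv_deriv hb1 hb0 (schwartz_hasDerivAt η) (SchwartzMap.continuous _) η.integrable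
        (SchwartzMap.integrable _) hC hC' ht, ← intervalIntegral.integral_const_mul]
    refine intervalIntegral.integral_congr fun s hs => ?_
    rw [uIcc_of_le ht] at hs
    simp only [hk s hs.1, mul_assoc]
  · subst h
    simp only [opMinus, opPlus, lt_irrefl, if_false]
    exact hset η
  · rw [integral_opMinus_mul_of_half_lt h h1 ht (measurable_mul_ind hν ht)
      (abs_mul_ind_le hν ⟨ht, le_rfl⟩), hset]

/-! ### The density of the variance function -/

/-- The one-sided convolution at u < t sees only arguments in [0,u], so the truncation at t drops
out. The substitution y = ur gives a power of u times an integral over the fixed interval [0,1]. -/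
theorem posConv_mul_ind {a b : ℝ} {g : ℝ → ℝ} {u : ℝ} (hu : u ∈ Ioo 0 t)
    (hb : b = a + 1) :
    posConv a (fun s => g s * ind 0 t s) u = u ^ b * ∫ r in (0 : ℝ)..1, r ^ a * g (u * (1 - r)) := by
  have e : ∀ y, y ≠ u → posPow a y * (g (u - y) * ind 0 t (u - y)) =
      (Ioc 0 u).indicator (fun y => y ^ a * g (u - y)) y := by
    intro y hyu
    by_cases hy : y ∈ Ioc 0 u
    · rw [indicator_of_mem hy, posPow_of_pos hy.1, ind_of_mem, mul_one]
      exact ⟨by linarith [hy.2], by linarith [hy.1, hu.2]⟩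
    · rw [indicator_of_notMem hy]
      rcases le_or_gt y 0 with h | h
      · rw [posPow_of_nonpos h, zero_mul]
      · rw [ind_of_notMem (by linarith [hu.1, hu.2]), mul_zero, mul_zero]
        intro h2
        exact hy ⟨h, by linarith [h2.1]⟩
  have hne : ∀ᵐ y : ℝ, y ≠ u := by simp [ae_iff]
  rw [posConv, integral_congr_ae (hne.mono e), integral_indicator measurableSet_Ioc,
    ← intervalIntegral.integral_of_le hu.1.le]
  have := intervalIntegral.smul_integral_comp_mul_left (a := 0) (b := 1)
    (fun y : ℝ => y ^ a * g (u - y)) u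
  rw [mul_zero, mul_one] at this
  rw [← this, hb, Real.rpow_add_one hu.1.ne', smul_eq_mul, mul_comm (u ^ a), mul_assoc]
  congr 1
  rw [← intervalIntegral.integral_const_mul]
  refine intervalIntegral.integral_congr (μ := volume) fun (r : ℝ) hr => ?_
  rw [uIcc_of_le zero_le_one] at hr
  rw [Real.mul_rpow hu.1.le hr.1, show u - u * r = u * (1 - r) by ring]
  ring

/-- The variance function is absolutely continuous. -/
theorem exists_density_of_half_lt (h : 1 / 2 < H) (h1 : H < 1) {g : ℝ → ℝ} (hg : Continuous g)
    {N : ℝ} (hN : ∀ s, |g s| ≤ N) :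
    ∃ ρ : ℝ → ℝ, Continuous ρ ∧ ∀ t, 0 ≤ t → varianceFun H g t = ∫ u in (0 : ℝ)..t, ρ u := by
  -- The density at u is g(u) times its one-sided convolution, which involves only the past of u.
  -- Hence one function serves all t.
  set c := (constK H / Real.Gamma (H - 1 / 2)) ^ 2 *
      ((∫ z, posPow (H - 3 / 2) z * posPow (H - 3 / 2) (1 + z)) * 2)
  refine ⟨fun u => c * (g u * (u ^ (2 * H - 1) *
    ∫ r in (0 : ℝ)..1, r ^ (2 * H - 2) * g (u * (1 - r)))), ?_, ?_⟩
  · have hpow : Continuous fun u : ℝ => u ^ (2 * H - 1) :=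
      continuous_id.rpow_const fun _ => Or.inr (by linarith)
    refine continuous_const.mul (hg.mul (hpow.mul ?_))
    refine intervalIntegral.continuous_of_dominated_interval
      (bound := fun r => |r ^ (2 * H - 2)| * N) (fun u => ?_) (fun u => ae_of_all _ fun r _ => ?_)
      ((intervalIntegral.intervalIntegrable_rpow' (by linarith)).abs.mul_const N)
      (ae_of_all _ fun r _ => by fun_prop)
    · exact ((measurable_id.pow_const _).mul
        (hg.measurable.comp (by fun_prop))).aestronglyMeasurable
    · rw [norm_mul]
      exact mul_le_mul_of_nonneg_left (hN _) (abs_nonneg _)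
  · intro t ht
    have hm : Measurable fun s => g s * ind 0 t s := hg.measurable.mul (measurable_ind 0 t)
    have hb : ∀ s, |g s * ind 0 t s| ≤ N * ind 0 t s := by
      intro s
      by_cases hs : s ∈ Ico 0 t
      · rw [ind_of_mem hs, mul_one, mul_one]; exact hN s
      · rw [ind_of_notMem ht hs]; simp
    rw [varianceFun, integral_sq_opMinus_of_half_lt h h1 ht hm hb,
      intervalIntegral.integral_const_mul, intervalIntegral.integral_of_le ht,
      integral_Ioc_eq_integral_Ioo, ← integral_indicator measurableSet_Ioo]
    simp only [c, mul_assoc]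
    congr 3
    have h2 : ∀ᵐ u : ℝ, u ≠ 0 := by simp [ae_iff]
    refine integral_congr_ae (h2.mono fun u hu0 => ?_)
    simp only
    by_cases hu : u ∈ Ioo 0 t
    · rw [indicator_of_mem hu, posConv_mul_ind (b := 2 * H - 1) hu (by ring),
        ind_of_mem ⟨hu.1.le, hu.2⟩, one_mul]
    · rw [indicator_of_notMem hu, ind_of_notMem ht, zero_mul, mul_zero]
      exact fun h3 => hu ⟨lt_of_le_of_ne h3.1 (Ne.symm hu0), h3.2⟩

include h0 h1 hν hk in
-- For H < 1/2 the variance is k² t^(2H), whose derivative is singular at 0 but integrable unless it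
-- vanishes identically. For H = 1/2 the density is ν², for H > 1/2 it is continuous. The statement
-- therefore asks for integrability on [0,T] and for a derivative only inside.
theorem exists_density_varianceFun (hT : 0 < T) :
    ∃ ρ : ℝ → ℝ, IntervalIntegrable ρ volume 0 T ∧
      (∀ t ∈ Icc 0 T, varianceFun H ν t = ∫ u in (0 : ℝ)..t, ρ u) ∧
      ∀ t ∈ Ioo 0 T, HasDerivAt (varianceFun H ν) (ρ t) t := by
  have main : ∀ ρ : ℝ → ℝ, Continuous ρ →
      (∀ t ∈ Icc 0 T, varianceFun H ν t = ∫ u in (0 : ℝ)..t, ρ u) →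
      ∃ ρ : ℝ → ℝ, IntervalIntegrable ρ volume 0 T ∧
      (∀ t ∈ Icc 0 T, varianceFun H ν t = ∫ u in (0 : ℝ)..t, ρ u) ∧
      ∀ t ∈ Ioo 0 T, HasDerivAt (varianceFun H ν) (ρ t) t := by
    intro ρ hρ he
    refine ⟨ρ, hρ.intervalIntegrable _ _, he, fun t ht => ?_⟩
    refine (intervalIntegral.integral_hasDerivAt_right (hρ.intervalIntegrable 0 _)
      (hρ.stronglyMeasurableAtFilter _ _) hρ.continuousAt).congr_of_eventuallyEq ?_
    filter_upwards [Ioo_mem_nhds ht.1 ht.2] with s hs using he s ⟨hs.1.le, hs.2.le⟩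
  rcases lt_trichotomy H (1 / 2) with h | h | h
  · obtain ⟨k, hk⟩ := hk h
    have hv : ∀ t, 0 ≤ t → varianceFun H ν t = k ^ 2 * t ^ (2 * H) := by
      intro t ht
      rw [varianceFun, mul_ind_eq_const hk ht]
      simp_rw [opMinus_const_mul_ind_of_lt_half h0 h ht, mul_pow k]
      rw [integral_const_mul, integral_sq_const_mul_mvnKernel h0 h1 ht]
    refine ⟨fun u => k ^ 2 * (2 * H * u ^ (2 * H - 1)), ?_, fun t ht => ?_, fun t ht => ?_⟩
    · exact ((intervalIntegral.intervalIntegrable_rpow' (by linarith)).const_mul _).const_mul _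
    · rw [hv t ht.1, intervalIntegral.integral_const_mul, intervalIntegral.integral_const_mul,
        integral_rpow (Or.inl (by linarith)), sub_add_cancel, Real.zero_rpow (by linarith), sub_zero,
        mul_div_cancel₀ _ (by linarith)]
    · refine ((Real.hasDerivAt_rpow_const (p := 2 * H) (Or.inl ht.1.ne')).const_mul
        (k ^ 2)).congr_of_eventuallyEq ?_
      filter_upwards [Ioi_mem_nhds ht.1] with s hs using hv s (le_of_lt hs)
  · subst h
    refine main (fun u => clampExt T ν u ^ 2) ((continuous_clampExt hν).pow 2) fun t ht => ?_
    rw [varianceFun, mul_ind_eq_clampExt ht, intervalIntegral.integral_of_le ht.1,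
      integral_Ioc_eq_integral_Ioo, ← integral_Ico_eq_integral_Ioo,
      ← integral_indicator measurableSet_Ico]
    simp only [opMinus, lt_irrefl, if_false]
    refine integral_congr_ae (ae_of_all _ fun s => ?_)
    by_cases hs : s ∈ Ico 0 t
    · simp [ind_of_mem hs, hs]
    · simp [ind_of_notMem ht.1 hs, hs]
  · obtain ⟨ρ, hρ, he⟩ := exists_density_of_half_lt h h1 (continuous_clampExt (T := T) hν)
      (abs_clampExt_le hν hT.le)
    refine main ρ hρ fun t ht => ?_
    rw [← he t ht.1, varianceFun, varianceFun, mul_ind_eq_clampExt ht]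

end integrand


/-! ### Gaussian integrals -/

theorem integrable_gaussianReal_iff {f : ℝ → ℝ} :
    Integrable f (gaussianReal 0 1) ↔ Integrable fun x => gaussianPDFReal 0 1 x * f x := by
  rw [gaussianReal_of_var_ne_zero 0 one_ne_zero, integrable_withDensity_iff_integrable_smul'
    (measurable_gaussianPDF _ _) (ae_of_all _ fun _ => gaussianPDF_lt_top)]
  simp [toReal_gaussianPDF]

theorem integrable_exp_sq_gaussianReal {q : ℝ} (hq : q < 1 / 2) :
    Integrable (fun x => Real.exp (q * x ^ 2)) (gaussianReal 0 1) := by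
  rw [integrable_gaussianReal_iff]
  refine ((integrable_exp_neg_mul_sq (b := 1 / 2 - q) (by linarith)).const_mul
    (√(2 * Real.pi * (1 : NNReal)))⁻¹).congr (ae_of_all _ fun x => ?_)
  simp only [gaussianPDFReal_def]
  rw [mul_assoc (_)⁻¹, ← Real.exp_add]
  congr 2
  simp only [NNReal.coe_one]; ring

/-- Gaussian integration by parts. -/
theorem integral_mul_gaussianReal {ψ ψ' : ℝ → ℝ} {K q : ℝ} (hq : q < 1 / 2)
    (hd : ∀ x, HasDerivAt ψ (ψ' x) x) (hc : Continuous ψ')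
    (hb : ∀ x, (1 + |x|) * |ψ x| ≤ K * Real.exp (q * x ^ 2))
    (hb' : ∀ x, |ψ' x| ≤ K * Real.exp (q * x ^ 2)) :
    ∫ x, x * ψ x ∂gaussianReal 0 1 = ∫ x, ψ' x ∂gaussianReal 0 1 := by
  have hψc : Continuous ψ := continuous_iff_continuousAt.mpr fun x => (hd x).continuousAt
  have hE := (integrable_exp_sq_gaussianReal hq).const_mul K
  have i1 : Integrable (fun x => x * ψ x) (gaussianReal 0 1) := by
    refine hE.mono' (by fun_prop) (ae_of_all _ fun x => le_trans ?_ (hb x))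
    rw [norm_mul, Real.norm_eq_abs, Real.norm_eq_abs]
    exact mul_le_mul_of_nonneg_right (by linarith) (abs_nonneg _)
  have i2 : Integrable ψ (gaussianReal 0 1) := by
    refine hE.mono' (by fun_prop) (ae_of_all _ fun x => le_trans ?_ (hb x))
    exact le_mul_of_one_le_left (abs_nonneg _) (by linarith [abs_nonneg x])
  have i3 : Integrable ψ' (gaussianReal 0 1) := hE.mono' (by fun_prop) (ae_of_all _ hb')
  rw [integrable_gaussianReal_iff] at i1 i2 i3
  have hp : ∀ x, HasDerivAt (gaussianPDFReal 0 1) (-(x * gaussianPDFReal 0 1 x)) x := by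
    intro x
    have h1 : HasDerivAt (fun x : ℝ => -(x - 0) ^ 2 / (2 * ((1 : NNReal) : ℝ))) (-x) x := by
      have := (((hasDerivAt_id x).sub_const 0).pow 2).neg.div_const (2 * ((1 : NNReal) : ℝ))
      refine this.congr_deriv ?_
      simp; ring
    have := h1.exp.const_mul (√(2 * Real.pi * (1 : NNReal)))⁻¹
    rw [gaussianPDFReal_def]
    refine this.congr_deriv ?_
    ring
  -- Integrability of ψ times the density makes the boundary terms at ±∞ vanish.
  have := integral_mul_deriv_eq_deriv_mul_of_integrable (u := ψ) (v := gaussianPDFReal 0 1)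
    (fun x _ => hd x) (fun x _ => hp x) ?_ ?_ ?_
  · rw [integral_gaussianReal_eq_integral_smul one_ne_zero,
      integral_gaussianReal_eq_integral_smul one_ne_zero]
    simp only [smul_eq_mul]
    have e : ∀ x, ψ x * -(x * gaussianPDFReal 0 1 x) = -(gaussianPDFReal 0 1 x * (x * ψ x)) := by
      intro x; ring
    simp_rw [e] at this
    rw [integral_neg, neg_inj] at this
    rw [this]
    simp_rw [mul_comm]
  · exact i1.neg.congr (ae_of_all _ fun x => by simp only [Pi.neg_apply, Pi.mul_apply]; ring)
  · exact i3.congr (ae_of_all _ fun x => by simp only [Pi.mul_apply]; ring)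
  · exact i2.congr (ae_of_all _ fun x => by simp only [Pi.mul_apply]; ring)

/-- A Gaussian envelope for functions of quadratic exponential growth. -/
theorem exists_envelope {l V M : ℝ} (hl : 0 ≤ l) (hlV : l * V < 1 / 2) :
    ∃ e K q : ℝ, 0 < e ∧ 0 ≤ K ∧ q < 1 / 2 ∧ ∀ s m x : ℝ, s ^ 2 ≤ V + e → |m| ≤ M →
      (1 + |x|) * Real.exp (l * (s * x + m) ^ 2) ≤ K * Real.exp (q * x ^ 2) := by
  -- `q₀` lies midway between lV and 1/2. The number `e` absorbs both the cross term of the square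
  -- and a later increase of the variance, and `d` spends half of the remaining gap to 1/2 on the
  -- factor 1 + |x|.
  set q₀ := (l * V + 1 / 2) / 2 with hq₀
  have hcont : Tendsto (fun e : ℝ => l * (1 + e) * (V + e)) (𝓝[>] 0) (𝓝 (l * (1 + 0) * (V + 0))) :=
    tendsto_nhdsWithin_of_tendsto_nhds (Continuous.tendsto (by fun_prop) 0)
  obtain ⟨e, he1, he⟩ := ((hcont.eventually_lt_const (u := q₀) (by rw [hq₀]; linarith)).and
    self_mem_nhdsWithin).exists
  have he0 : 0 < e := he
  set d := (1 / 2 - q₀) / 2 with hd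
  have hd0 : 0 < d := by rw [hd, hq₀]; linarith
  refine ⟨e, (3 / 2 + 1 / (2 * d)) * Real.exp (l * (1 + 1 / e) * M ^ 2), q₀ + d, he0, by positivity,
    by rw [hd]; linarith, fun s m x hs hm => ?_⟩
  have h1 : 1 + |x| ≤ (3 / 2 + 1 / (2 * d)) * Real.exp (d * x ^ 2) := by
    have h2 : 1 ≤ Real.exp (d * x ^ 2) := Real.one_le_exp (by positivity)
    have h3 : d * x ^ 2 ≤ Real.exp (d * x ^ 2) := by linarith [Real.add_one_le_exp (d * x ^ 2)]
    have h4 : 1 + |x| ≤ 3 / 2 + x ^ 2 / 2 := by nlinarith [sq_nonneg (|x| - 1), sq_abs x]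
    have h5 : x ^ 2 / 2 = 1 / (2 * d) * (d * x ^ 2) := by field_simp
    rw [add_mul]
    refine h4.trans (add_le_add (by linarith) ?_)
    rw [h5]
    exact mul_le_mul_of_nonneg_left h3 (by positivity)
  have h6 : (s * x + m) ^ 2 ≤ (1 + e) * (V + e) * x ^ 2 + (1 + 1 / e) * M ^ 2 := by
    have h7 : 2 * (s * x) * m ≤ e * (s * x) ^ 2 + 1 / e * m ^ 2 := by
      have := sq_nonneg (e * (s * x) - m)
      rw [one_div, inv_mul_eq_div, ← sub_nonneg]
      have h8 : e * (s * x) ^ 2 + m ^ 2 / e - 2 * (s * x) * m = (e * (s * x) - m) ^ 2 / e := by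
        field_simp; ring
      rw [h8]; positivity
    have h9 : m ^ 2 ≤ M ^ 2 := sq_le_sq' (by linarith [neg_abs_le m]) ((le_abs_self m).trans hm)
    have h10 : (s * x) ^ 2 ≤ (V + e) * x ^ 2 := by
      rw [mul_pow]; exact mul_le_mul_of_nonneg_right hs (sq_nonneg _)
    calc (s * x + m) ^ 2 = (s * x) ^ 2 + 2 * (s * x) * m + m ^ 2 := by ring
      _ ≤ (1 + e) * (s * x) ^ 2 + (1 + 1 / e) * m ^ 2 := by linarith
      _ ≤ (1 + e) * ((V + e) * x ^ 2) + (1 + 1 / e) * M ^ 2 := by gcongr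
      _ = _ := by ring
  calc (1 + |x|) * Real.exp (l * (s * x + m) ^ 2)
      ≤ ((3 / 2 + 1 / (2 * d)) * Real.exp (d * x ^ 2)) *
        Real.exp (q₀ * x ^ 2 + l * (1 + 1 / e) * M ^ 2) := by
        refine mul_le_mul h1 (Real.exp_le_exp.mpr ?_) (Real.exp_nonneg _) (by positivity)
        calc l * (s * x + m) ^ 2 ≤ l * ((1 + e) * (V + e) * x ^ 2 + (1 + 1 / e) * M ^ 2) :=
              mul_le_mul_of_nonneg_left h6 hl
          _ = (l * (1 + e) * (V + e)) * x ^ 2 + l * (1 + 1 / e) * M ^ 2 := by ring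
          _ ≤ q₀ * x ^ 2 + l * (1 + 1 / e) * M ^ 2 := by gcongr
    _ = _ := by rw [add_mul q₀ d, Real.exp_add, Real.exp_add]; ring

/-! ### The deterministic Itô formula -/

/-- Only partial derivatives are given; their joint continuity near an interior time yields total
differentiability and hence the chain rule. -/
theorem hasDerivAt_comp_partial {T t y' : ℝ} {Φ Φt Φy : ℝ → ℝ → ℝ} {y : ℝ → ℝ}
    (ht : t ∈ Ioo 0 T)
    (ct : ContinuousOn (fun p : ℝ × ℝ => Φt p.1 p.2) (Icc 0 T ×ˢ univ))
    (cy : ContinuousOn (fun p : ℝ × ℝ => Φy p.1 p.2) (Icc 0 T ×ˢ univ))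
    (dt : ∀ t ∈ Icc 0 T, ∀ y, HasDerivWithinAt (fun s => Φ s y) (Φt t y) (Icc 0 T) t)
    (dy : ∀ t ∈ Icc 0 T, ∀ y, HasDerivAt (fun z => Φ t z) (Φy t y) y)
    (hy : HasDerivAt y y' t) :
    HasDerivAt (fun s => Φ s (y s)) (Φt t (y t) + Φy t (y t) * y') t := by
  have hn : ∀ᶠ p : ℝ × ℝ in 𝓝 (t, y t), p.1 ∈ Ioo 0 T :=
    continuousAt_fst.eventually_mem (Ioo_mem_nhds ht.1 ht.2)
  have hmem : Icc 0 T ×ˢ (univ : Set ℝ) ∈ 𝓝 (t, y t) :=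
    prod_mem_nhds (Icc_mem_nhds ht.1 ht.2) univ_mem
  have key := hasStrictFDerivAt_uncurry_coprod (𝕜 := ℝ) (u := (t, y t)) (f := Φ)
    (f₁ := fun a b => ContinuousLinearMap.toSpanSingleton ℝ (Φt a b))
    (f₂ := fun a b => ContinuousLinearMap.toSpanSingleton ℝ (Φy a b)) ?_ ?_ ?_ ?_
  · have h2 : HasDerivAt (fun s => (s, y s)) (1, y') t := (hasDerivAt_id t).prodMk hy
    have h3 := key.hasFDerivAt.comp_hasDerivAt t h2
    refine h3.congr_deriv ?_
    simp [Function.HasUncurry.uncurry, mul_comm]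
  · filter_upwards [hn] with p hp
    exact ((dt p.1 (Ioo_subset_Icc_self hp) p.2).hasDerivAt (Icc_mem_nhds hp.1 hp.2)).hasFDerivAt
  · filter_upwards [hn] with p hp
    exact (dy p.1 (Ioo_subset_Icc_self hp) p.2).hasFDerivAt
  · exact ((ContinuousLinearMap.toSpanSingletonLIE ℝ ℝ).continuous).continuousAt.comp
      (ct.continuousAt hmem)
  · exact ((ContinuousLinearMap.toSpanSingletonLIE ℝ ℝ).continuous).continuousAt.comp
      (cy.continuousAt hmem)

section ito

variable {T : ℝ} (hT : 0 < T) {Φ Φt Φy Φyy : ℝ → ℝ → ℝ}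
  (cΦ : ContinuousOn (fun p : ℝ × ℝ => Φ p.1 p.2) (Icc 0 T ×ˢ univ))
  (ct : ContinuousOn (fun p : ℝ × ℝ => Φt p.1 p.2) (Icc 0 T ×ˢ univ))
  (cy : ContinuousOn (fun p : ℝ × ℝ => Φy p.1 p.2) (Icc 0 T ×ˢ univ))
  (cyy : ContinuousOn (fun p : ℝ × ℝ => Φyy p.1 p.2) (Icc 0 T ×ˢ univ))
  (dt : ∀ t ∈ Icc 0 T, ∀ y, HasDerivWithinAt (fun s => Φ s y) (Φt t y) (Icc 0 T) t)
  (dy : ∀ t ∈ Icc 0 T, ∀ y, HasDerivAt (fun z => Φ t z) (Φy t y) y)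
  (dyy : ∀ t ∈ Icc 0 T, ∀ y, HasDerivAt (fun z => Φy t z) (Φyy t y) y)
  {ρ μ μ' : ℝ → ℝ} (hρ : IntervalIntegrable ρ volume 0 T)
  (hμ : ContinuousOn μ (Icc 0 T)) (hμ' : ContinuousOn μ' (Icc 0 T))
  (hμd : ∀ t ∈ Ioo 0 T, HasDerivAt μ (μ' t) t)
  {σ : ℝ → ℝ} (hσ : ContinuousOn σ (Icc 0 T))

include hμ hσ in
theorem continuousOn_comp_affine {Ψ : ℝ → ℝ → ℝ}
    (hΨ : ContinuousOn (fun p : ℝ × ℝ => Ψ p.1 p.2) (Icc 0 T ×ˢ univ)) :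
    ContinuousOn (fun p : ℝ × ℝ => Ψ p.1 (σ p.1 * p.2 + μ p.1)) (Icc 0 T ×ˢ univ) := by
  have h1 : ContinuousOn (fun p : ℝ × ℝ => (p.1, σ p.1 * p.2 + μ p.1)) (Icc 0 T ×ˢ univ) := by
    have hf : MapsTo (Prod.fst : ℝ × ℝ → ℝ) (Icc 0 T ×ˢ univ) (Icc 0 T) := fun p hp => hp.1
    exact continuousOn_fst.prodMk (((hσ.comp continuousOn_fst hf).mul continuousOn_snd).add
      (hμ.comp continuousOn_fst hf))
  exact hΨ.comp h1 fun p hp => ⟨hp.1, trivial⟩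

theorem aestronglyMeasurable_prod_of_continuousOn {E : Type*} [TopologicalSpace E]
    [MeasurableSpace E] [BorelSpace E] [SecondCountableTopology E] {κ : Measure E} [SFinite κ]
    {f : ℝ × E → ℝ} (hf : ContinuousOn f (Icc 0 T ×ˢ univ)) :
    AEStronglyMeasurable f ((volume.restrict (Ioc 0 T)).prod κ) := by
  have := hf.aestronglyMeasurable (μ := volume.prod κ) (measurableSet_Icc.prod MeasurableSet.univ)
  rw [← Measure.prod_restrict, Measure.restrict_univ] at this
  refine this.mono_measure (Measure.prod_mono ?_ le_rfl)
  exact Measure.restrict_mono Ioc_subset_Icc_self le_rfl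

theorem ae_mem_prod {E : Type*} [MeasurableSpace E] {κ : Measure E} [SFinite κ] :
    ∀ᵐ p : ℝ × E ∂((volume.restrict (Ioc 0 T)).prod κ), p.1 ∈ Ioc 0 T :=
  Measure.quasiMeasurePreserving_fst.ae (ae_restrict_mem measurableSet_Ioc)

end ito


section ito

variable {T : ℝ} (hT : 0 < T) {Φ Φt Φy Φyy : ℝ → ℝ → ℝ}
  (cΦ : ContinuousOn (fun p : ℝ × ℝ => Φ p.1 p.2) (Icc 0 T ×ˢ univ))
  (ct : ContinuousOn (fun p : ℝ × ℝ => Φt p.1 p.2) (Icc 0 T ×ˢ univ))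
  (cy : ContinuousOn (fun p : ℝ × ℝ => Φy p.1 p.2) (Icc 0 T ×ˢ univ))
  (cyy : ContinuousOn (fun p : ℝ × ℝ => Φyy p.1 p.2) (Icc 0 T ×ˢ univ))
  (dt : ∀ t ∈ Icc 0 T, ∀ y, HasDerivWithinAt (fun s => Φ s y) (Φt t y) (Icc 0 T) t)
  (dy : ∀ t ∈ Icc 0 T, ∀ y, HasDerivAt (fun z => Φ t z) (Φy t y) y)
  (dyy : ∀ t ∈ Icc 0 T, ∀ y, HasDerivAt (fun z => Φy t z) (Φyy t y) y)
  {ρ μ μ' : ℝ → ℝ} (hρ : IntervalIntegrable ρ volume 0 T)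
  (hμ : ContinuousOn μ (Icc 0 T)) (hμ' : ContinuousOn μ' (Icc 0 T))
  (hμd : ∀ t ∈ Ioo 0 T, HasDerivAt μ (μ' t) t)
  {K q : ℝ} (hq : q < 1 / 2)

include hq in
theorem integrable_mul_of_gaussian_bound {w : ℝ → ℝ} (hw : IntegrableOn w (Ioc 0 T))
    {g : ℝ × ℝ → ℝ}
    (hg : AEStronglyMeasurable g ((volume.restrict (Ioc 0 T)).prod (gaussianReal 0 1)))
    (hb : ∀ t ∈ Ioc 0 T, ∀ x, |g (t, x)| ≤ K * Real.exp (q * x ^ 2)) :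
    Integrable (fun p => w p.1 * g p) ((volume.restrict (Ioc 0 T)).prod (gaussianReal 0 1)) := by
  refine (hw.norm.mul_prod ((integrable_exp_sq_gaussianReal hq).const_mul K)).mono'
    (hw.1.comp_fst.mul hg) ?_
  filter_upwards [ae_mem_prod (T := T) (κ := gaussianReal 0 1)] with p hp
  rw [norm_mul]
  exact mul_le_mul_of_nonneg_left (hb p.1 hp p.2) (norm_nonneg _)

theorem abs_le_of_one_add_mul_le {x y z : ℝ} (h : (1 + |x|) * |y| ≤ z) : |y| ≤ z :=
  (le_mul_of_one_le_left (abs_nonneg _) (by linarith [abs_nonneg x])).trans h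

include hT cΦ ct cy cyy dt dy dyy hρ hμ hμ' hμd hq in
-- For fixed x the fundamental theorem of calculus applies to t ↦ Φ(t, σ(t)x + μ(t)). The term σ' x
-- Φ_y with σ' = ρ/(2σ) becomes (ρ/2) Φ_yy after Gaussian integration by parts, since
-- differentiation in x produces a factor σ. The factor 1 + |x| in the bounds covers x Φ_y.
theorem gaussian_ito_of_pos {σ : ℝ → ℝ} (hσ : ContinuousOn σ (Icc 0 T))
    (hσ0 : ∀ t ∈ Icc 0 T, 0 < σ t) (hσd : ∀ t ∈ Ioo 0 T, HasDerivAt σ (ρ t / (2 * σ t)) t)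
    (bΦ : ∀ t ∈ Icc 0 T, ∀ x, (1 + |x|) * |Φ t (σ t * x + μ t)| ≤ K * Real.exp (q * x ^ 2))
    (bt : ∀ t ∈ Icc 0 T, ∀ x, (1 + |x|) * |Φt t (σ t * x + μ t)| ≤ K * Real.exp (q * x ^ 2))
    (byy : ∀ t ∈ Icc 0 T, ∀ x, (1 + |x|) * |Φyy t (σ t * x + μ t)| ≤ K * Real.exp (q * x ^ 2))
    (bY : ∀ t ∈ Icc 0 T, ∀ x, (1 + |x|) * |Φy t (σ t * x + μ t)| ≤ K * Real.exp (q * x ^ 2)) :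
    ∫ x, Φ T (σ T * x + μ T) ∂gaussianReal 0 1 - ∫ x, Φ 0 (σ 0 * x + μ 0) ∂gaussianReal 0 1 =
      ∫ p : ℝ × ℝ, (Φt p.1 (σ p.1 * p.2 + μ p.1) + μ' p.1 * Φy p.1 (σ p.1 * p.2 + μ p.1) +
        ρ p.1 / 2 * Φyy p.1 (σ p.1 * p.2 + μ p.1))
        ∂((volume.restrict (Ioc 0 T)).prod (gaussianReal 0 1)) := by
  have hcc := fun {Ψ : ℝ → ℝ → ℝ} (hΨ : ContinuousOn (fun p : ℝ × ℝ => Ψ p.1 p.2)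
    (Icc 0 T ×ˢ univ)) => continuousOn_comp_affine hμ hσ hΨ
  have hm := fun {Ψ : ℝ → ℝ → ℝ} (hΨ : ContinuousOn (fun p : ℝ × ℝ => Ψ p.1 p.2)
    (Icc 0 T ×ˢ univ)) => aestronglyMeasurable_prod_of_continuousOn (κ := gaussianReal 0 1) (hcc hΨ)
  have hsec : ∀ {Ψ : ℝ → ℝ → ℝ}, ContinuousOn (fun p : ℝ × ℝ => Ψ p.1 p.2) (Icc 0 T ×ˢ univ) →
      ∀ x, ContinuousOn (fun t => Ψ t (σ t * x + μ t)) (Icc 0 T) := fun {Ψ} hΨ x =>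
    (hcc hΨ).comp (continuousOn_id.prodMk continuousOn_const) fun t ht => ⟨ht, trivial⟩
  have hρ1 : IntegrableOn ρ (Ioc 0 T) := (intervalIntegrable_iff_integrableOn_Ioc_of_le hT.le).mp hρ
  have hwc : ContinuousOn (fun t => (2 * σ t)⁻¹) (Icc 0 T) :=
    (continuousOn_const.mul hσ).inv₀ fun t ht => (mul_pos two_pos (hσ0 t ht)).ne'
  have hw : IntegrableOn (fun t => ρ t / (2 * σ t)) (Ioc 0 T) := by
    have : IntegrableOn ρ (Icc 0 T) := (integrableOn_Icc_iff_integrableOn_Ioc).mpr hρ1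
    exact (this.mul_continuousOn hwc isCompact_Icc).mono_set Ioc_subset_Icc_self
  have hμ'i : IntegrableOn μ' (Ioc 0 T) :=
    (hμ'.integrableOn_Icc).mono_set Ioc_subset_Icc_self
  have I1 : Integrable (fun p : ℝ × ℝ => Φt p.1 (σ p.1 * p.2 + μ p.1))
      ((volume.restrict (Ioc 0 T)).prod (gaussianReal 0 1)) := by
    simpa using integrable_mul_of_gaussian_bound hq (w := fun _ => 1) (K := K)
      (integrableOn_const (by simp)) (hm ct)
      fun t ht x => abs_le_of_one_add_mul_le (bt t (Ioc_subset_Icc_self ht) x)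
  have I2 := integrable_mul_of_gaussian_bound hq hμ'i (hm cy)
    fun t ht x => abs_le_of_one_add_mul_le (bY t (Ioc_subset_Icc_self ht) x)
  have I4 := integrable_mul_of_gaussian_bound hq (hρ1.div_const 2) (hm cyy)
    fun t ht x => abs_le_of_one_add_mul_le (byy t (Ioc_subset_Icc_self ht) x)
  have I3 := integrable_mul_of_gaussian_bound hq hw (K := K)
    (g := fun p => p.2 * Φy p.1 (σ p.1 * p.2 + μ p.1))
    (measurable_snd.aestronglyMeasurable.mul (hm cy)) (fun t ht x => by
      refine le_trans ?_ (bY t (Ioc_subset_Icc_self ht) x)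
      rw [abs_mul]
      exact mul_le_mul_of_nonneg_right (by linarith) (abs_nonneg _))
  have e3 : ∫ p : ℝ × ℝ, ρ p.1 / (2 * σ p.1) * (p.2 * Φy p.1 (σ p.1 * p.2 + μ p.1))
      ∂((volume.restrict (Ioc 0 T)).prod (gaussianReal 0 1)) =
      ∫ p : ℝ × ℝ, ρ p.1 / 2 * Φyy p.1 (σ p.1 * p.2 + μ p.1)
      ∂((volume.restrict (Ioc 0 T)).prod (gaussianReal 0 1)) := by
    rw [integral_prod _ I3, integral_prod _ I4]
    refine setIntegral_congr_fun measurableSet_Ioc fun t ht => ?_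
    have ht' := Ioc_subset_Icc_self ht
    have hst := hσ0 t ht'
    simp only
    rw [integral_const_mul, integral_const_mul]
    have hcY : Continuous fun z => Φyy t z := by
      refine continuousOn_univ.mp ?_
      exact cyy.comp (continuousOn_const.prodMk continuousOn_id) fun x _ => ⟨ht', trivial⟩
    -- The constant `K * (1 + σ t)` has to bound both the function and its derivative, which carries
    -- the factor σ(t).
    have := integral_mul_gaussianReal (ψ := fun x => Φy t (σ t * x + μ t))
      (ψ' := fun x => Φyy t (σ t * x + μ t) * σ t) (K := K * (1 + σ t)) (q := q) hq (fun x => ?_)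
      (by fun_prop) (fun x => ?_) (fun x => ?_)
    · rw [this, integral_mul_const]; field_simp
    · have h2 : HasDerivAt (fun x => σ t * x + μ t) (σ t) x := by
        simpa using ((hasDerivAt_id x).const_mul (σ t)).add_const (μ t)
      exact (dyy t ht' _).comp x h2
    · refine (bY t ht' x).trans ?_
      have h0 := (abs_nonneg _).trans (abs_le_of_one_add_mul_le (bY t ht' x))
      nlinarith
    · have h1 := abs_le_of_one_add_mul_le (byy t ht' x)
      have h0 := (abs_nonneg _).trans h1
      rw [abs_mul, abs_of_pos hst]
      nlinarith
  -- `D` is the time derivative before integration by parts.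
  let D : ℝ × ℝ → ℝ := fun p => Φt p.1 (σ p.1 * p.2 + μ p.1) +
    μ' p.1 * Φy p.1 (σ p.1 * p.2 + μ p.1) +
    ρ p.1 / (2 * σ p.1) * (p.2 * Φy p.1 (σ p.1 * p.2 + μ p.1))
  have hD : Integrable D ((volume.restrict (Ioc 0 T)).prod (gaussianReal 0 1)) := (I1.add I2).add I3
  have hftc : ∀ x, ∫ t in Ioc 0 T, D (t, x) = Φ T (σ T * x + μ T) - Φ 0 (σ 0 * x + μ 0) := by
    intro x
    rw [← intervalIntegral.integral_of_le hT.le]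
    refine intervalIntegral.integral_eq_sub_of_hasDerivAt_of_le hT.le
      (f := fun t => Φ t (σ t * x + μ t)) (hsec cΦ x) (fun t ht => ?_) ?_
    · have h2 : HasDerivAt (fun t => σ t * x + μ t) (ρ t / (2 * σ t) * x + μ' t) t :=
        ((hσd t ht).mul_const x).add (hμd t ht)
      refine (hasDerivAt_comp_partial ht ct cy dt dy h2).congr_deriv ?_
      simp only [D]; ring
    · rw [intervalIntegrable_iff_integrableOn_Ioc_of_le hT.le]
      have j1 := ((hsec ct x).add (hμ'.mul (hsec cy x))).integrableOn_Icc.mono_set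
        (Ioc_subset_Icc_self (a := (0 : ℝ)) (b := T)) (μ := volume)
      have j2 : IntegrableOn (fun t => ρ t / (2 * σ t) * (x * Φy t (σ t * x + μ t))) (Icc 0 T) :=
        ((integrableOn_Icc_iff_integrableOn_Ioc).mpr hw).mul_continuousOn
          (continuousOn_const.mul (hsec cy x)) isCompact_Icc
      exact j1.add (j2.mono_set Ioc_subset_Icc_self)
  have hi : ∀ t ∈ Icc 0 T, Integrable (fun x => Φ t (σ t * x + μ t)) (gaussianReal 0 1) := by
    intro t ht
    refine ((integrable_exp_sq_gaussianReal hq).const_mul K).mono' ?_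
      (ae_of_all _ fun x => abs_le_of_one_add_mul_le (bΦ t ht x))
    refine Continuous.aestronglyMeasurable (continuousOn_univ.mp ?_)
    exact (hcc cΦ).comp (continuousOn_const.prodMk continuousOn_id) fun x _ => ⟨ht, trivial⟩
  rw [← integral_sub (hi T ⟨hT.le, le_rfl⟩) (hi 0 ⟨le_rfl, hT.le⟩)]
  simp_rw [← hftc]
  rw [← integral_prod_symm _ hD]
  refine (integral_add (I1.add I2) I3).trans ?_
  rw [e3]
  exact (integral_add (I1.add I2) I4).symm

include hT cΦ ct cy cyy dt dy dyy hρ hμ hμ' hμd in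
/-- The Itô formula for Gaussian variables with variance `v` and mean `μ`, where only the variance
is absolutely continuous. -/
theorem gaussian_ito {v : ℝ → ℝ} (hv : ∀ t ∈ Icc 0 T, v t = ∫ u in (0 : ℝ)..t, ρ u)
    (hv0 : ∀ t ∈ Icc 0 T, 0 ≤ v t) (hvd : ∀ t ∈ Ioo 0 T, HasDerivAt v (ρ t) t)
    {V l C : ℝ} (hl : 0 ≤ l) (hvV : ∀ t ∈ Icc 0 T, v t ≤ V) (hlV : l * V < 1 / 2) (hC : 0 ≤ C)
    (bΦ : ∀ t ∈ Icc 0 T, ∀ y, |Φ t y| ≤ C * Real.exp (l * y ^ 2))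
    (bt : ∀ t ∈ Icc 0 T, ∀ y, |Φt t y| ≤ C * Real.exp (l * y ^ 2))
    (bY : ∀ t ∈ Icc 0 T, ∀ y, |Φy t y| ≤ C * Real.exp (l * y ^ 2))
    (byy : ∀ t ∈ Icc 0 T, ∀ y, |Φyy t y| ≤ C * Real.exp (l * y ^ 2)) :
    ∫ x, Φ T (√(v T) * x + μ T) ∂gaussianReal 0 1 - ∫ x, Φ 0 (√(v 0) * x + μ 0) ∂gaussianReal 0 1 =
      ∫ x, (∫ t in Ioc 0 T, (Φt t (√(v t) * x + μ t) + μ' t * Φy t (√(v t) * x + μ t) +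
        ρ t / 2 * Φyy t (√(v t) * x + μ t))) ∂gaussianReal 0 1 := by
  obtain ⟨M, hM⟩ := isCompact_Icc.exists_bound_of_continuousOn hμ
  obtain ⟨M', hM'⟩ := isCompact_Icc.exists_bound_of_continuousOn hμ'
  obtain ⟨e, K, q, he, hK, hq, henv⟩ := exists_envelope (M := M) hl hlV
  have hvc : ContinuousOn v (Icc 0 T) := by
    have := intervalIntegral.continuousOn_primitive_interval' hρ left_mem_uIcc
    rw [uIcc_of_le hT.le] at this
    exact this.congr hv
  have hρ1 : IntegrableOn ρ (Ioc 0 T) := (intervalIntegrable_iff_integrableOn_Ioc_of_le hT.le).mp hρ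
  have hbound : ∀ {Ψ : ℝ → ℝ → ℝ}, (∀ t ∈ Icc 0 T, ∀ y, |Ψ t y| ≤ C * Real.exp (l * y ^ 2)) →
      ∀ d ∈ Icc 0 e, ∀ t ∈ Icc 0 T, ∀ x, (1 + |x|) * |Ψ t (√(v t + d) * x + μ t)| ≤
        C * K * Real.exp (q * x ^ 2) := by
    intro Ψ hΨ d hd t ht x
    have h1 := henv (√(v t + d)) (μ t) x (by
      rw [Real.sq_sqrt (add_nonneg (hv0 t ht) hd.1)]; linarith [hvV t ht, hd.2]) (hM t ht)
    calc (1 + |x|) * |Ψ t (√(v t + d) * x + μ t)|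
        ≤ (1 + |x|) * (C * Real.exp (l * (√(v t + d) * x + μ t) ^ 2)) :=
          mul_le_mul_of_nonneg_left (hΨ t ht _) (by linarith [abs_nonneg x])
      _ = C * ((1 + |x|) * Real.exp (l * (√(v t + d) * x + μ t) ^ 2)) := by ring
      _ ≤ C * (K * Real.exp (q * x ^ 2)) := mul_le_mul_of_nonneg_left h1 hC
      _ = _ := by ring
  have hσc : ∀ d, ContinuousOn (fun t => √(v t + d)) (Icc 0 T) := fun d =>
    (hvc.add continuousOn_const).sqrt
  -- The variance may vanish, and then its square root need not be differentiable. The formula is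
  -- applied to v + d, and d → 0 by dominated convergence; the envelope was chosen uniform for d ≤
  -- e.
  have hpos : ∀ d ∈ Ioc 0 e, _ := fun d hd =>
    gaussian_ito_of_pos hT cΦ ct cy cyy dt dy dyy hρ hμ hμ' hμd hq (hσc d)
      (fun t ht => Real.sqrt_pos.mpr (add_pos_of_nonneg_of_pos (hv0 t ht) hd.1))
      (fun t ht => ((hvd t ht).add_const d).sqrt
        (add_pos_of_nonneg_of_pos (hv0 t (Ioo_subset_Icc_self ht)) hd.1).ne')
      (hbound bΦ d (Ioc_subset_Icc_self hd)) (hbound bt d (Ioc_subset_Icc_self hd))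
      (hbound byy d (Ioc_subset_Icc_self hd)) (hbound bY d (Ioc_subset_Icc_self hd))
  have hlim : ∀ {Ψ : ℝ → ℝ → ℝ}, ContinuousOn (fun p : ℝ × ℝ => Ψ p.1 p.2) (Icc 0 T ×ˢ univ) →
      ∀ t ∈ Icc 0 T, ∀ x, Tendsto (fun d => Ψ t (√(v t + d) * x + μ t)) (𝓝[>] 0)
        (𝓝 (Ψ t (√(v t) * x + μ t))) := by
    intro Ψ hΨ t ht x
    have hc : Continuous fun z => Ψ t z := by
      refine continuousOn_univ.mp ?_
      exact hΨ.comp (continuousOn_const.prodMk continuousOn_id) fun x _ => ⟨ht, trivial⟩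
    have : Continuous fun d => Ψ t (√(v t + d) * x + μ t) := by fun_prop
    have h2 := this.tendsto 0
    rw [add_zero] at h2
    exact tendsto_nhdsWithin_of_tendsto_nhds h2
  have hev : ∀ᶠ d in 𝓝[>] (0 : ℝ), d ∈ Ioc 0 e := Ioc_mem_nhdsGT he
  have hLt : ∀ t ∈ Icc 0 T, Tendsto (fun d => ∫ x, Φ t (√(v t + d) * x + μ t) ∂gaussianReal 0 1)
      (𝓝[>] 0) (𝓝 (∫ x, Φ t (√(v t) * x + μ t) ∂gaussianReal 0 1)) := by
    intro t ht
    have hc : Continuous fun z => Φ t z := by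
      refine continuousOn_univ.mp ?_
      exact cΦ.comp (continuousOn_const.prodMk continuousOn_id) fun x _ => ⟨ht, trivial⟩
    refine tendsto_integral_filter_of_dominated_convergence _
      (Eventually.of_forall fun d => Continuous.aestronglyMeasurable (by fun_prop)) ?_
      ((integrable_exp_sq_gaussianReal hq).const_mul (C * K)) (ae_of_all _ fun x => hlim cΦ t ht x)
    filter_upwards [hev] with d hd
    exact ae_of_all _ fun x =>
      abs_le_of_one_add_mul_le (hbound bΦ d (Ioc_subset_Icc_self hd) t ht x)
  have hmeas : ∀ {Ψ : ℝ → ℝ → ℝ}, ContinuousOn (fun p : ℝ × ℝ => Ψ p.1 p.2) (Icc 0 T ×ˢ univ) →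
      ∀ d, AEStronglyMeasurable (fun p : ℝ × ℝ => Ψ p.1 (√(v p.1 + d) * p.2 + μ p.1))
        ((volume.restrict (Ioc 0 T)).prod (gaussianReal 0 1)) := fun hΨ d =>
    aestronglyMeasurable_prod_of_continuousOn (continuousOn_comp_affine hμ (hσc d) hΨ)
  have hμm : AEStronglyMeasurable (fun p : ℝ × ℝ => μ' p.1)
      ((volume.restrict (Ioc 0 T)).prod (gaussianReal 0 1)) :=
    (hμ'.integrableOn_Icc.mono_set (Ioc_subset_Icc_self)).1.comp_fst
  have hρm : AEStronglyMeasurable (fun p : ℝ × ℝ => ρ p.1 / 2)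
      ((volume.restrict (Ioc 0 T)).prod (gaussianReal 0 1)) := (hρ1.div_const 2).1.comp_fst
  have hbd : ∀ d ∈ Icc 0 e, ∀ p : ℝ × ℝ, p.1 ∈ Ioc 0 T →
      ‖Φt p.1 (√(v p.1 + d) * p.2 + μ p.1) + μ' p.1 * Φy p.1 (√(v p.1 + d) * p.2 + μ p.1) +
        ρ p.1 / 2 * Φyy p.1 (√(v p.1 + d) * p.2 + μ p.1)‖ ≤
      (1 + M' + |ρ p.1 / 2|) * (C * K * Real.exp (q * p.2 ^ 2)) := by
    intro d hd p hp
    have hp' := Ioc_subset_Icc_self hp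
    have b1 := abs_le_of_one_add_mul_le (hbound bt d hd p.1 hp' p.2)
    have b2 := abs_le_of_one_add_mul_le (hbound bY d hd p.1 hp' p.2)
    have b3 := abs_le_of_one_add_mul_le (hbound byy d hd p.1 hp' p.2)
    have b4 := hM' p.1 hp'
    rw [Real.norm_eq_abs] at b4
    have hM0 : 0 ≤ M' := (abs_nonneg _).trans b4
    refine (norm_add₃_le).trans ?_
    rw [norm_mul, norm_mul, Real.norm_eq_abs, Real.norm_eq_abs, Real.norm_eq_abs, Real.norm_eq_abs,
      Real.norm_eq_abs, add_mul, add_mul, one_mul]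
    exact add_le_add (add_le_add b1 (mul_le_mul b4 b2 (abs_nonneg _) hM0))
      (mul_le_mul_of_nonneg_left b3 (abs_nonneg _))
  have hdom : Integrable (fun p : ℝ × ℝ => (1 + M' + |ρ p.1 / 2|) *
      (C * K * Real.exp (q * p.2 ^ 2))) ((volume.restrict (Ioc 0 T)).prod (gaussianReal 0 1)) := by
    refine Integrable.mul_prod (f := fun t => 1 + M' + |ρ t / 2|) ?_
      ((integrable_exp_sq_gaussianReal hq).const_mul (C * K))
    exact (integrable_const _).add (hρ1.div_const 2).abs
  have hR : Tendsto (fun d => ∫ p : ℝ × ℝ, (Φt p.1 (√(v p.1 + d) * p.2 + μ p.1) +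
        μ' p.1 * Φy p.1 (√(v p.1 + d) * p.2 + μ p.1) +
        ρ p.1 / 2 * Φyy p.1 (√(v p.1 + d) * p.2 + μ p.1))
        ∂((volume.restrict (Ioc 0 T)).prod (gaussianReal 0 1))) (𝓝[>] 0)
      (𝓝 (∫ p : ℝ × ℝ, (Φt p.1 (√(v p.1) * p.2 + μ p.1) +
        μ' p.1 * Φy p.1 (√(v p.1) * p.2 + μ p.1) +
        ρ p.1 / 2 * Φyy p.1 (√(v p.1) * p.2 + μ p.1))
        ∂((volume.restrict (Ioc 0 T)).prod (gaussianReal 0 1)))) := by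
    refine tendsto_integral_filter_of_dominated_convergence _
      (Eventually.of_forall fun d => ((hmeas ct d).add (hμm.mul (hmeas cy d))).add
        (hρm.mul (hmeas cyy d))) ?_ hdom ?_
    · filter_upwards [hev] with d hd
      filter_upwards [ae_mem_prod (T := T) (κ := gaussianReal 0 1)] with p hp
      exact hbd d (Ioc_subset_Icc_self hd) p hp
    · filter_upwards [ae_mem_prod (T := T) (κ := gaussianReal 0 1)] with p hp
      have hp' := Ioc_subset_Icc_self hp
      exact ((hlim ct p.1 hp' p.2).add ((hlim cy p.1 hp' p.2).const_mul _)).add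
        ((hlim cyy p.1 hp' p.2).const_mul _)
  have hfin := tendsto_nhds_unique_of_eventuallyEq
    ((hLt T ⟨hT.le, le_rfl⟩).sub (hLt 0 ⟨le_rfl, hT.le⟩)) hR (by
      filter_upwards [hev] with d hd using hpos d hd)
  rw [hfin]
  refine integral_prod_symm (f := fun p : ℝ × ℝ => Φt p.1 (√(v p.1) * p.2 + μ p.1) +
        μ' p.1 * Φy p.1 (√(v p.1) * p.2 + μ p.1) +
        ρ p.1 / 2 * Φyy p.1 (√(v p.1) * p.2 + μ p.1)) (hdom.mono' ?_ ?_)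
  · have := ((hmeas ct 0).add (hμm.mul (hmeas cy 0))).add (hρm.mul (hmeas cyy 0))
    simp only [add_zero] at this
    exact this
  · filter_upwards [ae_mem_prod (T := T) (κ := gaussianReal 0 1)] with p hp
    have := hbd 0 ⟨le_rfl, he.le⟩ p hp
    simpa only [add_zero] using this

end ito


/-! ### The space `L²_A` and Pettis integrals -/

namespace RandomlyScaledFBM

variable {P : Measure Ω} [IsProbabilityMeasure P] {X : RandomlyScaledFBM P} {φ ψ : Ω → ℝ}

theorem MemL2A.congr (h : X.MemL2A φ) (he : φ =ᵐ[P] ψ) : X.MemL2A ψ :=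
  ⟨h.1.congr he, h.2.ae_eq he⟩

theorem MemL2A.sub (h : X.MemL2A φ) (h' : X.MemL2A ψ) : X.MemL2A fun ω => φ ω - ψ ω :=
  ⟨h.1.sub h'.1, h.2.sub h'.2⟩

theorem MemL2A.integrable_mul (h : X.MemL2A φ) (h' : X.MemL2A ψ) :
    Integrable (fun ω => φ ω * ψ ω) P := h.2.integrable_mul h'.2

theorem MemL2A.const_mul (h : X.MemL2A φ) (c : ℝ) : X.MemL2A fun ω => c * φ ω :=
  ⟨h.1.const_mul c, h.2.const_mul c⟩

theorem MemL2A.bdd_mul (h : X.MemL2A φ) (hψ : AEStronglyMeasurable[X.sigmaBA] ψ P) {C : ℝ}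
    (hC : ∀ ω, |ψ ω| ≤ C) : X.MemL2A fun ω => ψ ω * φ ω := by
  refine ⟨hψ.mul h.1, ?_⟩
  refine (h.2.norm.const_mul C).mono' ((hψ.mono X.sigmaBA_le).mul h.2.1) (ae_of_all _ fun ω => ?_)
  rw [norm_mul]
  exact mul_le_mul_of_nonneg_right (hC ω) (norm_nonneg _)

/-- `L²_A` as a subspace of `L²`. -/
abbrev L2A (X : RandomlyScaledFBM P) : Submodule ℝ (Lp ℝ 2 P) := lpMeas ℝ ℝ X.sigmaBA 2 P

theorem isComplete_L2A (X : RandomlyScaledFBM P) : CompleteSpace X.L2A :=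
  have : Fact (X.sigmaBA ≤ ‹MeasurableSpace Ω›) := ⟨X.sigmaBA_le⟩
  inferInstance

/-- The element of `L²_A` defined by a function. -/
def toL2A (h : X.MemL2A ψ) : X.L2A :=
  ⟨h.2.toLp ψ, mem_lpMeas_iff_aestronglyMeasurable.mpr (h.1.congr h.2.coeFn_toLp.symm)⟩

theorem memL2A_coe (φ : X.L2A) : X.MemL2A (φ : Lp ℝ 2 P) :=
  ⟨lpMeas.aestronglyMeasurable φ, Lp.memLp _⟩

theorem toL2A_coe (φ : X.L2A) : toL2A (memL2A_coe φ) = φ :=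
  Subtype.ext (Lp.toLp_coeFn _ (memL2A_coe φ).2)

theorem inner_toL2A (h : X.MemL2A φ) (h' : X.MemL2A ψ) :
    ⟪toL2A h, toL2A h'⟫ = ∫ ω, φ ω * ψ ω ∂P := by
  rw [Submodule.coe_inner, L2.inner_def]
  refine integral_congr_ae ?_
  filter_upwards [h.2.coeFn_toLp, h'.2.coeFn_toLp] with ω h1 h2
  simp only [toL2A]
  rw [h1, h2]; simp [mul_comm]

theorem norm_toL2A_le (h : X.MemL2A φ) {w : ℝ} (hw : 0 ≤ w) (hb : ∫ ω, φ ω ^ 2 ∂P ≤ w ^ 2) :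
    ‖toL2A h‖ ≤ w := by
  refine (sq_le_sq₀ (norm_nonneg _) hw).mp ?_
  rw [← real_inner_self_eq_norm_sq, inner_toL2A]
  simpa [sq] using hb

/-- The Wick exponentials are total in `L²_A`. -/
theorem span_wickExp_dense (X : RandomlyScaledFBM P) (hR : 0 < X.radius) :
    (Submodule.span ℝ (range fun η : X.testFunctions =>
      toL2A (X.memL2A_wickExp η.2))).topologicalClosure = ⊤ := by
  have := X.isComplete_L2A
  rw [Submodule.topologicalClosure_eq_top_iff, Submodule.eq_bot_iff]
  intro φ hφ
  have h0 := X.ae_eq_zero_of_sTransform_eq_zero hR (memL2A_coe φ) fun η hη => by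
    have hmem : toL2A (X.memL2A_wickExp hη) ∈ Submodule.span ℝ (range fun η : X.testFunctions =>
      toL2A (X.memL2A_wickExp η.2)) := Submodule.subset_span ⟨⟨η, hη⟩, rfl⟩
    have := Submodule.inner_left_of_mem_orthogonal hmem hφ
    rw [← toL2A_coe φ, inner_toL2A] at this
    exact this
  refine Subtype.ext ?_
  exact (Lp.eq_zero_iff_ae_eq_zero).mpr h0

/-- A family in `L²_A` is weakly measurable as soon as its pairings with Wick exponentials are. -/
theorem measurable_inner_of_wickExp (hR : 0 < X.radius) {α : Type*}
    [MeasurableSpace α] (f : α → X.L2A)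
    (h : ∀ η (hη : η ∈ X.testFunctions),
      Measurable fun t => ⟪f t, toL2A (X.memL2A_wickExp hη)⟫) (φ : X.L2A) :
    Measurable fun t => ⟪f t, φ⟫ := by
  set V := Submodule.span ℝ (range fun η : X.testFunctions => toL2A (X.memL2A_wickExp η.2))
  have hV : ∀ ψ ∈ V, Measurable fun t => ⟪f t, ψ⟫ := by
    intro ψ hψ
    induction hψ using Submodule.span_induction with
    | mem ψ h1 => obtain ⟨η, rfl⟩ := h1; exact h η.1 η.2
    | zero => simp
    | add ψ χ _ _ h1 h2 => simp_rw [inner_add_right]; exact h1.add h2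
    | smul c ψ _ h1 => simp_rw [real_inner_smul_right]; exact h1.const_mul c
  have hφ : φ ∈ closure (V : Set X.L2A) := by
    rw [← Submodule.topologicalClosure_coe, X.span_wickExp_dense hR]; trivial
  -- The pairing with φ is a pointwise limit of pairings with elements of the span; no separability
  -- enters.
  obtain ⟨u, hu, hlim⟩ := mem_closure_iff_seq_limit.mp hφ
  refine measurable_of_tendsto_metrizable (fun n => hV (u n) (hu n)) ?_
  rw [tendsto_pi_nhds]
  exact fun t => tendsto_const_nhds.inner hlim

/-- The map ψ ↦ ∫⟨f(t), ψ⟩ dt is linear and bounded by the integral of `w`, so the Riesz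
representation theorem provides the integral. Measurability need only be tested on Wick
exponentials, by totality. -/
theorem exists_isPettisIntegral (hR : 0 < X.radius) {M : Set ℝ}
    (hM : MeasurableSet M) {f : ℝ → Ω → ℝ} (hf : ∀ t ∈ M, X.MemL2A (f t)) {w : ℝ → ℝ}
    (hw : IntegrableOn w M) (hw0 : ∀ t ∈ M, 0 ≤ w t)
    (hb : ∀ t ∈ M, ∫ ω, f t ω ^ 2 ∂P ≤ w t ^ 2)
    (hm : ∀ η ∈ X.testFunctions, Measurable fun t : M => ∫ ω, f t ω * X.wickExp η ω ∂P) :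
    ∃ Θ, X.IsPettisIntegral M f Θ := by
  have := X.isComplete_L2A
  let F : M → X.L2A := fun t => toL2A (hf t t.2)
  have hmF : ∀ φ : X.L2A, Measurable fun t => ⟪F t, φ⟫ :=
    measurable_inner_of_wickExp hR F fun η hη => by
      simpa only [F, inner_toL2A] using hm η hη
  have hmeas : ∀ ψ, X.MemL2A ψ → Measurable fun t : M => ∫ ω, f t ω * ψ ω ∂P := by
    intro ψ hψ
    simpa only [F, inner_toL2A] using hmF (toL2A hψ)
  have hFw : ∀ t : M, ‖F t‖ ≤ w t := fun t => norm_toL2A_le _ (hw0 t t.2) (hb t t.2)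
  have hint : ∀ ψ (hψ : X.MemL2A ψ), IntegrableOn (fun t => ∫ ω, f t ω * ψ ω ∂P) M ∧
      |∫ t in M, ∫ ω, f t ω * ψ ω ∂P| ≤ (∫ t in M, w t) * ‖toL2A hψ‖ := by
    intro ψ hψ
    have hae : AEMeasurable (fun t => ∫ ω, f t ω * ψ ω ∂P) (volume.restrict M) :=
      (aemeasurable_restrict_iff_comap_subtype hM).mpr (hmeas ψ hψ).aemeasurable
    have hbd : ∀ᵐ t ∂(volume.restrict M), ‖∫ ω, f t ω * ψ ω ∂P‖ ≤ w t * ‖toL2A hψ‖ := by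
      filter_upwards [ae_restrict_mem hM] with t ht
      rw [← inner_toL2A (hf t ht) hψ]
      exact (norm_inner_le_norm _ _).trans
        (mul_le_mul_of_nonneg_right (hFw ⟨t, ht⟩) (norm_nonneg _))
    refine ⟨(Integrable.mul_const hw ‖toL2A hψ‖).mono' hae.aestronglyMeasurable hbd, ?_⟩
    rw [← integral_mul_const]
    exact norm_integral_le_of_norm_le (Integrable.mul_const hw _) hbd
  let L₀ : X.L2A →ₗ[ℝ] ℝ :=
    { toFun := fun φ => ∫ t in M, ∫ ω, f t ω * (φ : Lp ℝ 2 P) ω ∂P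
      map_add' := fun φ χ => by
        rw [← integral_add (hint _ (memL2A_coe φ)).1 (hint _ (memL2A_coe χ)).1]
        refine setIntegral_congr_fun hM fun t ht => ?_
        rw [← inner_toL2A (hf t ht) (memL2A_coe (φ + χ)), ← inner_toL2A (hf t ht) (memL2A_coe φ),
          ← inner_toL2A (hf t ht) (memL2A_coe χ), toL2A_coe, toL2A_coe, toL2A_coe, inner_add_right]
      map_smul' := fun c φ => by
        rw [RingHom.id_apply, smul_eq_mul, ← integral_const_mul]
        refine setIntegral_congr_fun hM fun t ht => ?_
        rw [← inner_toL2A (hf t ht) (memL2A_coe (c • φ)), ← inner_toL2A (hf t ht) (memL2A_coe φ),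
          toL2A_coe, toL2A_coe]
        exact real_inner_smul_right (toL2A (hf t ht)) φ c }
  let L : X.L2A →L[ℝ] ℝ := L₀.mkContinuous (∫ t in M, w t) fun φ => by
    have := (hint _ (memL2A_coe φ)).2
    rwa [toL2A_coe] at this
  let Θ : X.L2A := (InnerProductSpace.toDual ℝ X.L2A).symm L
  have hΘ : ∀ ψ (hψ : X.MemL2A ψ), ∫ ω, (Θ : Lp ℝ 2 P) ω * ψ ω ∂P =
      ∫ t in M, ∫ ω, f t ω * ψ ω ∂P := by
    intro ψ hψ
    rw [← inner_toL2A (memL2A_coe Θ) hψ, toL2A_coe, InnerProductSpace.toDual_symm_apply]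
    refine setIntegral_congr_fun hM fun t ht => ?_
    rw [← inner_toL2A (hf t ht) hψ]
    refine (inner_toL2A (hf t ht) (memL2A_coe (toL2A hψ))).symm.trans ?_
    rw [toL2A_coe]
  exact ⟨(Θ : Lp ℝ 2 P), hM, hf, hmeas, fun ψ hψ => (hint ψ hψ).1, memL2A_coe Θ, hΘ⟩

/-- A Pettis integral commutes with the multiplication by an unbounded random factor. -/
theorem IsPettisIntegral.mul_ae_eq {M : Set ℝ} {f g : ℝ → Ω → ℝ}
    {I J : Ω → ℝ} {u : ℝ → ℝ} (hu : Continuous u) (hfg : ∀ t ω, g t ω = u (X.A ω) * f t ω)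
    (hI : X.IsPettisIntegral M g I) (hJ : X.IsPettisIntegral M f J) :
    I =ᵐ[P] fun ω => u (X.A ω) * J ω := by
  have hA := X.measurable_A_sigmaBA
  have key : ∀ n : ℕ, ∀ᵐ ω ∂P, |u (X.A ω)| ≤ n → I ω = u (X.A ω) * J ω := by
    intro n
    -- The factor u(A) may lead out of L². On {|u(A)| ≤ n} the cut-offs `c` and `d = c u` are
    -- bounded, and c g = d f pointwise. Testing both integrals against multiples of the difference
    -- `D` then shows that `D` has norm zero.
    let c : ℝ → ℝ := fun a => if |u a| ≤ n then 1 else 0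
    let d : ℝ → ℝ := fun a => if |u a| ≤ n then u a else 0
    have hset : MeasurableSet {a | |u a| ≤ n} :=
      measurableSet_le hu.measurable.abs measurable_const
    have hcm : AEStronglyMeasurable[X.sigmaBA] (fun ω => c (X.A ω)) P :=
      ((Measurable.ite hset measurable_const measurable_const).comp
        hA).stronglyMeasurable.aestronglyMeasurable
    have hdm : AEStronglyMeasurable[X.sigmaBA] (fun ω => d (X.A ω)) P :=
      ((Measurable.ite hset hu.measurable measurable_const).comp
        hA).stronglyMeasurable.aestronglyMeasurable
    have hc1 : ∀ ω, |c (X.A ω)| ≤ 1 := by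
      intro ω; simp only [c]; split_ifs <;> simp
    have hd1 : ∀ ω, |d (X.A ω)| ≤ n := by
      intro ω; simp only [d]; split_ifs with h
      · exact h
      · simp
    let D : Ω → ℝ := fun ω => c (X.A ω) * I ω - d (X.A ω) * J ω
    have hD : X.MemL2A D := (hI.memL2A.bdd_mul hcm hc1).sub (hJ.memL2A.bdd_mul hdm hd1)
    have hcD := hD.bdd_mul hcm hc1
    have hdD := hD.bdd_mul hdm hd1
    have e1 : ∫ ω, I ω * (c (X.A ω) * D ω) ∂P = ∫ ω, J ω * (d (X.A ω) * D ω) ∂P := by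
      rw [hI.inner_eq _ hcD, hJ.inner_eq _ hdD]
      congr 1 with t
      congr 1 with ω
      rw [hfg]
      simp only [c, d]; split_ifs <;> ring
    have e2 : ∫ ω, D ω * D ω ∂P = 0 := by
      have : ∀ ω, D ω * D ω = I ω * (c (X.A ω) * D ω) - J ω * (d (X.A ω) * D ω) := by
        intro ω; simp only [D]; ring
      simp_rw [this]
      rw [integral_sub (hI.memL2A.integrable_mul hcD) (hJ.memL2A.integrable_mul hdD), e1, sub_self]
    have e3 := (integral_eq_zero_iff_of_nonneg (fun ω => mul_self_nonneg (D ω))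
      (hD.integrable_mul hD)).mp e2
    filter_upwards [e3] with ω hω hn
    have hω' : D ω = 0 := mul_self_eq_zero.mp hω
    simp only [D, c, d, if_pos hn, one_mul] at hω'
    linarith
  filter_upwards [ae_all_iff.mpr key] with ω hω
  obtain ⟨n, hn⟩ := exists_nat_ge |u (X.A ω)|
  exact hω n hn

end RandomlyScaledFBM


/-! ### Functionals of exponential growth -/

/-- The functional `(t, a, u) ↦ G(t, √a u, a)`, extended by zero. -/
def scaledComp (T : ℝ) (G : ℝ → ℝ → ℝ → ℝ) : ℝ × ℝ × ℝ → ℝ :=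
  (Icc 0 T ×ˢ Ioi 0 ×ˢ univ).indicator fun q => G q.1 (√q.2.1 * q.2.2) q.2.1

theorem scaledComp_of_mem {T t a u : ℝ} (G : ℝ → ℝ → ℝ → ℝ) (ht : t ∈ Icc 0 T) (ha : 0 < a) :
    scaledComp T G (t, a, u) = G t (√a * u) a := by
  rw [scaledComp, indicator_of_mem]
  exact ⟨ht, ha, trivial⟩

theorem measurable_scaledComp {T : ℝ} {G : ℝ → ℝ → ℝ → ℝ}
    (hG : ContinuousOn (fun p : ℝ × ℝ × ℝ => G p.1 p.2.1 p.2.2) (Icc 0 T ×ˢ univ ×ˢ Ioi 0)) :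
    Measurable (scaledComp T G) := by
  classical
  have hs : MeasurableSet (Icc 0 T ×ˢ Ioi 0 ×ˢ univ : Set (ℝ × ℝ × ℝ)) :=
    measurableSet_Icc.prod (measurableSet_Ioi.prod MeasurableSet.univ)
  rw [scaledComp, ← piecewise_eq_indicator]
  refine ContinuousOn.measurable_piecewise ?_ continuousOn_const hs
  have hc : ContinuousOn (fun q : ℝ × ℝ × ℝ => (q.1, √q.2.1 * q.2.2, q.2.1))
      (Icc 0 T ×ˢ Ioi 0 ×ˢ univ) := Continuous.continuousOn (by fun_prop)
  exact hG.comp hc fun q hq => ⟨hq.1, trivial, hq.2.1⟩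

/-- The functional `scaledComp` after the Girsanov shift. -/
def tilted (T : ℝ) (G : ℝ → ℝ → ℝ → ℝ) (v m : ℝ → ℝ) (c t : ℝ) (p : ℝ × ℝ) : ℝ :=
  scaledComp T G (t, p.1, √(v t) * p.2 + √p.1 * m t) * Real.exp (p.1 * c)

theorem measurable_tilted {T c : ℝ} {G : ℝ → ℝ → ℝ → ℝ} {v m : ℝ → ℝ}
    (hG : ContinuousOn (fun p : ℝ × ℝ × ℝ => G p.1 p.2.1 p.2.2) (Icc 0 T ×ˢ univ ×ˢ Ioi 0))
    (hv : Measurable v) (hm : Measurable m) :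
    Measurable fun q : ℝ × ℝ × ℝ => tilted T G v m c q.1 q.2 := by
  have h1 : Measurable fun q : ℝ × ℝ × ℝ => (q.1, q.2.1, √(v q.1) * q.2.2 + √q.2.1 * m q.1) := by
    fun_prop
  unfold tilted
  exact ((measurable_scaledComp hG).comp h1).mul (by fun_prop)

namespace RandomlyScaledFBM

variable {P : Measure Ω} [IsProbabilityMeasure P] (X : RandomlyScaledFBM P)

/-- The product of the law of `A` and the standard Gaussian law. -/
abbrev lawProd : Measure (ℝ × ℝ) := (P.map X.A).prod (gaussianReal 0 1)

theorem ae_pos_map : ∀ᵐ a ∂(P.map X.A), 0 < a :=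
  (ae_map_iff X.measurable_A.aemeasurable measurableSet_Ioi).mpr (ae_of_all _ X.A_pos)

theorem ae_pos_lawProd : ∀ᵐ p ∂X.lawProd, 0 < p.1 :=
  Measure.quasiMeasurePreserving_fst.ae X.ae_pos_map

/-- Functionals of exponential growth are uniformly bounded in `L²`. -/
theorem exists_memLp_bound {C c l V : ℝ} (hc0 : 0 ≤ c) (hc : ENNReal.ofReal (2 * c) < X.radius)
    (hl : 0 ≤ l) (hlV : 4 * l * V < 1) :
    ∃ B : ℝ, 0 ≤ B ∧ ∀ (g : Lp ℝ 2 (volume : Measure ℝ)) (Ψ : ℝ × ℝ → ℝ), ‖g‖ ^ 2 ≤ V →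
      Measurable Ψ → (∀ a u, 0 < a → |Ψ (a, u)| ≤ C * Real.exp (c * a + l * u ^ 2)) →
      MemLp (fun ω => Ψ (X.A ω, X.wiener g ω)) 2 P ∧
        ∫ ω, Ψ (X.A ω, X.wiener g ω) ^ 2 ∂P ≤ B ^ 2 := by
  have hiA : Integrable (fun a => Real.exp (2 * c * a)) (P.map X.A) := by
    rw [integrable_map_measure (by fun_prop) X.measurable_A.aemeasurable]
    exact integrable_exp_of_lt_radius X (by positivity) hc
  -- Squaring doubles c and l: the exponential moment of order 2c is finite, and 2lV < 1/2 is the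
  -- Gaussian threshold.
  have hdom : Integrable (fun p : ℝ × ℝ => C ^ 2 * (Real.exp (2 * c * p.1) *
      Real.exp (2 * l * V * p.2 ^ 2))) X.lawProd :=
    (hiA.mul_prod (integrable_exp_sq_gaussianReal (by linarith))).const_mul _
  refine ⟨√(∫ p : ℝ × ℝ, C ^ 2 * (Real.exp (2 * c * p.1) *
      Real.exp (2 * l * V * p.2 ^ 2)) ∂X.lawProd), Real.sqrt_nonneg _, fun g Ψ hg hΨ hb => ?_⟩
  have hbd : ∀ᵐ p : ℝ × ℝ ∂X.lawProd, Ψ (p.1, ‖g‖ * p.2) ^ 2 ≤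
      C ^ 2 * (Real.exp (2 * c * p.1) * Real.exp (2 * l * V * p.2 ^ 2)) := by
    filter_upwards [X.ae_pos_lawProd] with p hp
    have h1 := hb p.1 (‖g‖ * p.2) hp
    have h2 := pow_le_pow_left₀ (abs_nonneg _) h1 2
    rw [sq_abs] at h2
    refine h2.trans ?_
    rw [mul_pow, ← Real.exp_add, ← Real.exp_nat_mul]
    refine mul_le_mul_of_nonneg_left (Real.exp_le_exp.mpr ?_) (sq_nonneg _)
    have h3 : l * (‖g‖ ^ 2 * p.2 ^ 2) ≤ l * (V * p.2 ^ 2) :=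
      mul_le_mul_of_nonneg_left (mul_le_mul_of_nonneg_right hg (sq_nonneg _)) hl
    push_cast
    nlinarith
  have hint : Integrable (fun p : ℝ × ℝ => Ψ (p.1, ‖g‖ * p.2) ^ 2) X.lawProd := by
    refine hdom.mono' ?_ ?_
    · exact ((hΨ.comp (by fun_prop : Measurable fun p : ℝ × ℝ => (p.1, ‖g‖ * p.2))).pow_const
        2).aestronglyMeasurable
    · filter_upwards [hbd] with p hp
      rwa [Real.norm_eq_abs, abs_of_nonneg (sq_nonneg _)]
  -- With zero tilt the shift formula is just the joint law of `A` and I(g).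
  have k0 : X.isBrownian.isometry 0 = 0 := map_zero _
  have hzero : ∀ᵐ ω ∂P, Real.exp (√(X.A ω) * X.isBrownian.isometry 0 ω) = 1 := by
    rw [k0]
    filter_upwards [Lp.coeFn_zero ℝ 2 P] with ω hω
    rw [hω]; simp
  have k1 := X.integrable_mul_exp_iff g 0 (G := fun p => Ψ p ^ 2) (hΨ.pow_const 2)
  have k2 := X.integral_mul_exp g 0 (G := fun p => Ψ p ^ 2) (hΨ.pow_const 2)
  simp only [inner_zero_right, mul_zero, add_zero, norm_zero, ne_eq, OfNat.ofNat_ne_zero,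
    not_false_eq_true, zero_pow, zero_div, Real.exp_zero, mul_one] at k1 k2
  have hsq : Integrable (fun ω => Ψ (X.A ω, X.wiener g ω) ^ 2) P := by
    refine (k1.mpr hint).congr ?_
    filter_upwards [hzero] with ω hω
    rw [hω, mul_one]
  have hmeas : AEStronglyMeasurable (fun ω => Ψ (X.A ω, X.wiener g ω)) P :=
    (hΨ.comp_aemeasurable
      (X.measurable_A.aemeasurable.prodMk (X.aemeasurable_wiener g))).aestronglyMeasurable
  refine ⟨(memLp_two_iff_integrable_sq hmeas).mpr hsq, ?_⟩
  rw [Real.sq_sqrt (integral_nonneg fun p => by positivity)]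
  calc ∫ ω, Ψ (X.A ω, X.wiener g ω) ^ 2 ∂P = ∫ p : ℝ × ℝ, Ψ (p.1, ‖g‖ * p.2) ^ 2 ∂X.lawProd := by
        rw [← k2]
        refine integral_congr_ae ?_
        filter_upwards [hzero] with ω hω
        rw [hω, mul_one]
    _ ≤ _ := integral_mono_ae hint hdom hbd

/-! ### Bounds and the shift formula along the kernels M_-^H(ν 1_(0,t)). -/

section integrand

variable {ν : ℝ → ℝ} (hν : X.IsGoodIntegrand ν) {T : ℝ} (hT : 0 < T)

open Classical in
/-- The function `M_-^H(ν 1_(0,t))` as an element of `L²(ℝ)`. -/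
def kernLp (ν : ℝ → ℝ) (t : ℝ) : Lp ℝ 2 (volume : Measure ℝ) :=
  if h : MemLp (opMinus X.H fun s => ν s * ind 0 t s) 2 volume then h.toLp _ else 0

include hν in
theorem coeFn_kernLp {t : ℝ} (ht : 0 ≤ t) :
    X.kernLp ν t =ᵐ[volume] opMinus X.H fun s => ν s * ind 0 t s := by
  have h := memLp_opMinus_mul_ind X.H_pos X.H_lt_one hν.1 hν.2 ht
  rw [kernLp, dif_pos h]
  exact h.coeFn_toLp

include hν in
theorem norm_sq_kernLp {t : ℝ} (ht : 0 ≤ t) : ‖X.kernLp ν t‖ ^ 2 = varianceFun X.H ν t := by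
  rw [← real_inner_self_eq_norm_sq, L2.inner_def, varianceFun]
  refine integral_congr_ae ?_
  filter_upwards [X.coeFn_kernLp hν ht] with x hx
  rw [hx]; simp [sq]

include hν in
theorem norm_kernLp {t : ℝ} (ht : 0 ≤ t) : ‖X.kernLp ν t‖ = √(varianceFun X.H ν t) := by
  rw [← X.norm_sq_kernLp hν ht, Real.sqrt_sq (norm_nonneg _)]

/-- The covariance of `∫_0^t ν dB^H` and `∫ η dB`, as a smooth function of `t`. -/
def meanFun (T : ℝ) (ν : ℝ → ℝ) (η : 𝓢(ℝ, ℝ)) (t : ℝ) : ℝ :=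
  ∫ s in (0 : ℝ)..t, clampExt T ν s * opPlus X.H η s

include hν in
theorem continuous_meanFun_integrand (η : 𝓢(ℝ, ℝ)) :
    Continuous fun s => clampExt T ν s * opPlus X.H η s :=
  (continuous_clampExt hν.1).mul (continuous_opPlus X.H_pos X.H_lt_one η)

include hν in
theorem hasDerivAt_meanFun (η : 𝓢(ℝ, ℝ)) (t : ℝ) :
    HasDerivAt (X.meanFun T ν η) (clampExt T ν t * opPlus X.H η t) t := by
  have h := X.continuous_meanFun_integrand hν (T := T) η
  exact intervalIntegral.integral_hasDerivAt_right (h.intervalIntegrable _ _)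
    (h.stronglyMeasurableAtFilter _ _) h.continuousAt

include hν in
theorem continuous_meanFun (η : 𝓢(ℝ, ℝ)) : Continuous (X.meanFun T ν η) :=
  continuous_iff_continuousAt.mpr fun t => (X.hasDerivAt_meanFun hν η t).continuousAt

theorem meanFun_eq (η : 𝓢(ℝ, ℝ)) {t : ℝ} (ht : t ∈ Icc 0 T) :
    X.meanFun T ν η t = ∫ s in (0 : ℝ)..t, ν s * opPlus X.H η s := by
  refine intervalIntegral.integral_congr fun s hs => ?_
  rw [uIcc_of_le ht.1] at hs
  simp only [clampExt_of_mem ⟨hs.1, hs.2.trans ht.2⟩]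

include hν in
theorem inner_kernLp (η : 𝓢(ℝ, ℝ)) {t : ℝ} (ht : t ∈ Icc 0 T) :
    ⟪X.kernLp ν t, η.toLp 2 volume⟫ = X.meanFun T ν η t := by
  rw [X.meanFun_eq η ht, ← integral_opMinus_mul_schwartz X.H_pos X.H_lt_one hν.1 hν.2 ht.1,
    L2.inner_def]
  refine integral_congr_ae ?_
  filter_upwards [X.coeFn_kernLp hν ht.1, η.coeFn_toLp 2 volume] with x hx hx'
  rw [hx, hx']; simp [mul_comm]

/-- The variance function, extended continuously to the real line. -/
abbrev varExt (T : ℝ) (ν : ℝ → ℝ) : ℝ → ℝ := clampExt T (varianceFun X.H ν)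

include hν hT in
theorem continuous_varExt : Continuous (X.varExt T ν) := by
  obtain ⟨ρ, hρ, hv, -⟩ := exists_density_varianceFun X.H_pos X.H_lt_one hν.1 hν.2 hT
  have : ContinuousOn (varianceFun X.H ν) (Icc 0 T) := by
    have h := intervalIntegral.continuousOn_primitive_interval' hρ left_mem_uIcc
    rw [uIcc_of_le hT.le] at h
    exact h.congr hv
  exact this.comp_continuous (by fun_prop) fun s => ⟨le_max_left _ _, max_le hT.le (min_le_right _ _)⟩

include hν hT in
/-- Functionals of admissible growth are uniformly bounded in `L²`. -/
theorem exists_bound_scaledComp {G : ℝ → ℝ → ℝ → ℝ}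
    (hG : ContinuousOn (fun p : ℝ × ℝ × ℝ => G p.1 p.2.1 p.2.2) (Icc 0 T ×ˢ univ ×ˢ Ioi 0))
    (hadm : X.AdmissibleGrowth ν T G) :
    ∃ B : ℝ, 0 ≤ B ∧ ∀ t ∈ Icc 0 T,
      MemLp (fun ω => scaledComp T G (t, X.A ω, X.wiener (X.kernLp ν t) ω)) 2 P ∧
      ∫ ω, scaledComp T G (t, X.A ω, X.wiener (X.kernLp ν t) ω) ^ 2 ∂P ≤ B ^ 2 := by
  obtain ⟨C, c, l, -, hc0, hl, hc, hlV, hb⟩ := hadm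
  -- The variance bound is (T^H max|ν|)², a quarter of the square in the growth condition.
  obtain ⟨B, hB0, hB⟩ := X.exists_memLp_bound (C := C) hc0 hc hl
    (V := (T ^ X.H * sSup ((fun s => |ν s|) '' Icc 0 T)) ^ 2) (by nlinarith)
  refine ⟨B, hB0, fun t ht => hB (X.kernLp ν t) (fun p => scaledComp T G (t, p)) ?_ ?_ ?_⟩
  · rw [X.norm_sq_kernLp hν ht.1]
    exact varianceFun_le X.H_pos X.H_lt_one hν.1 hν.2 ht
  · exact (measurable_scaledComp hG).comp measurable_prodMk_left
  · intro a u ha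
    rw [scaledComp_of_mem G ht ha]
    exact hb t ht u a ha

include hν in
/-- The Girsanov formula for functionals of `A` and `∫_0^t ν dB^H`. -/
theorem integral_scaledComp_mul_rawExp {G : ℝ → ℝ → ℝ → ℝ}
    (hG : ContinuousOn (fun p : ℝ × ℝ × ℝ => G p.1 p.2.1 p.2.2) (Icc 0 T ×ˢ univ ×ˢ Ioi 0))
    (η : 𝓢(ℝ, ℝ)) {t : ℝ} (ht : t ∈ Icc 0 T) :
    (Integrable (fun ω => scaledComp T G (t, X.A ω, X.wiener (X.kernLp ν t) ω) * X.rawExp η ω) P ↔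
      Integrable (tilted T G (X.varExt T ν) (X.meanFun T ν η) (‖η.toLp 2 volume‖ ^ 2 / 2) t)
        X.lawProd) ∧
    ∫ ω, scaledComp T G (t, X.A ω, X.wiener (X.kernLp ν t) ω) * X.rawExp η ω ∂P =
      ∫ p, tilted T G (X.varExt T ν) (X.meanFun T ν η) (‖η.toLp 2 volume‖ ^ 2 / 2) t p
        ∂X.lawProd := by
  have hm : Measurable fun p : ℝ × ℝ => scaledComp T G (t, p) :=
    (measurable_scaledComp hG).comp measurable_prodMk_left
  have h1 := X.integrable_mul_exp_iff (X.kernLp ν t) (η.toLp 2 volume) hm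
  have h2 := X.integral_mul_exp (X.kernLp ν t) (η.toLp 2 volume) hm
  have e : ∀ p, tilted T G (X.varExt T ν) (X.meanFun T ν η) (‖η.toLp 2 volume‖ ^ 2 / 2) t p =
      scaledComp T G (t, p.1, ‖X.kernLp ν t‖ * p.2 + √p.1 * ⟪X.kernLp ν t, η.toLp 2 volume⟫) *
        Real.exp (p.1 * ‖η.toLp 2 volume‖ ^ 2 / 2) := by
    intro p
    rw [tilted, X.norm_kernLp hν ht.1, X.inner_kernLp hν η ht, varExt, clampExt_of_mem ht,
      mul_div_assoc]
  rw [← funext e] at h1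
  simp_rw [← e] at h2
  exact ⟨h1, h2⟩

include hν hT in
-- The functional and the Wick exponential are bounded in L² uniformly in t, so their product is
-- bounded in L¹. The shift formula for |G| transfers this bound.
theorem exists_bound_tilted {G : ℝ → ℝ → ℝ → ℝ}
    (hG : ContinuousOn (fun p : ℝ × ℝ × ℝ => G p.1 p.2.1 p.2.2) (Icc 0 T ×ˢ univ ×ˢ Ioi 0))
    (hadm : X.AdmissibleGrowth ν T G) {η : 𝓢(ℝ, ℝ)} (hη : η ∈ X.testFunctions) :
    ∃ B : ℝ, ∀ t ∈ Icc 0 T,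
      Integrable (tilted T G (X.varExt T ν) (X.meanFun T ν η) (‖η.toLp 2 volume‖ ^ 2 / 2) t)
        X.lawProd ∧
      ∫ p, ‖tilted T G (X.varExt T ν) (X.meanFun T ν η) (‖η.toLp 2 volume‖ ^ 2 / 2) t p‖
        ∂X.lawProd ≤ B := by
  obtain ⟨B, -, hB⟩ := X.exists_bound_scaledComp hν hT hG hadm
  have hE := X.memLp_rawExp hη
  refine ⟨B ^ 2 + ∫ ω, X.rawExp η ω ^ 2 ∂P, fun t ht => ?_⟩
  obtain ⟨h1, h2⟩ := hB t ht
  have hi := (X.integral_scaledComp_mul_rawExp hν hG η ht).1.mp (h1.integrable_mul hE)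
  refine ⟨hi, ?_⟩
  have habs : ∀ (G' : ℝ → ℝ → ℝ → ℝ) q, |scaledComp T G' q| =
      scaledComp T (fun t z a => |G' t z a|) q := by
    intro G' q
    unfold scaledComp
    by_cases h : q ∈ (Icc 0 T ×ˢ Ioi 0 ×ˢ univ : Set (ℝ × ℝ × ℝ))
    · rw [indicator_of_mem h, indicator_of_mem h]
    · rw [indicator_of_notMem h, indicator_of_notMem h, abs_zero]
  have h3 := (X.integral_scaledComp_mul_rawExp hν (G := fun t z a => |G t z a|) hG.abs η ht).2
  have h4 : ∀ p, ‖tilted T G (X.varExt T ν) (X.meanFun T ν η) (‖η.toLp 2 volume‖ ^ 2 / 2) t p‖ =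
      tilted T (fun t z a => |G t z a|) (X.varExt T ν) (X.meanFun T ν η)
        (‖η.toLp 2 volume‖ ^ 2 / 2) t p := by
    intro p
    rw [tilted, norm_mul, Real.norm_eq_abs, habs, Real.norm_eq_abs, abs_of_pos (Real.exp_pos _),
      tilted]
  simp_rw [h4]
  rw [← h3]
  simp_rw [← habs]
  calc ∫ ω, |scaledComp T G (t, X.A ω, X.wiener (X.kernLp ν t) ω)| * X.rawExp η ω ∂P
      ≤ ∫ ω, (scaledComp T G (t, X.A ω, X.wiener (X.kernLp ν t) ω) ^ 2 + X.rawExp η ω ^ 2) ∂P := by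
        refine integral_mono (h1.abs.integrable_mul hE) (h1.integrable_sq.add hE.integrable_sq)
          fun ω => ?_
        simp only
        nlinarith [sq_nonneg (|scaledComp T G (t, X.A ω, X.wiener (X.kernLp ν t) ω)| -
          X.rawExp η ω), sq_abs (scaledComp T G (t, X.A ω, X.wiener (X.kernLp ν t) ω)),
          sq_nonneg (scaledComp T G (t, X.A ω, X.wiener (X.kernLp ν t) ω)),
          sq_nonneg (X.rawExp η ω)]
    _ ≤ _ := by
        rw [integral_add h1.integrable_sq hE.integrable_sq]
        linarith

include hν hT in
-- A uniform L¹ bound times an integrable weight permits Fubini. The weight must be allowed to be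
-- unbounded, as v' can be near 0.
theorem integrable_mul_tilted {G : ℝ → ℝ → ℝ → ℝ}
    (hG : ContinuousOn (fun p : ℝ × ℝ × ℝ => G p.1 p.2.1 p.2.2) (Icc 0 T ×ˢ univ ×ˢ Ioi 0))
    (hadm : X.AdmissibleGrowth ν T G) {η : 𝓢(ℝ, ℝ)} (hη : η ∈ X.testFunctions) {w : ℝ → ℝ}
    (hw : IntegrableOn w (Ioc 0 T)) :
    Integrable (fun q : ℝ × ℝ × ℝ => w q.1 *
      tilted T G (X.varExt T ν) (X.meanFun T ν η) (‖η.toLp 2 volume‖ ^ 2 / 2) q.1 q.2)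
      ((volume.restrict (Ioc 0 T)).prod X.lawProd) := by
  obtain ⟨B, hB⟩ := X.exists_bound_tilted hν hT hG hadm hη
  have hm := measurable_tilted (c := ‖η.toLp 2 volume‖ ^ 2 / 2) hG
    (X.continuous_varExt hν hT).measurable (X.continuous_meanFun hν (T := T) η).measurable
  have hmeas : AEStronglyMeasurable (fun q : ℝ × ℝ × ℝ => w q.1 *
      tilted T G (X.varExt T ν) (X.meanFun T ν η) (‖η.toLp 2 volume‖ ^ 2 / 2) q.1 q.2)
      ((volume.restrict (Ioc 0 T)).prod X.lawProd) := hw.1.comp_fst.mul hm.aestronglyMeasurable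
  rw [integrable_prod_iff hmeas]
  constructor
  · filter_upwards [ae_restrict_mem measurableSet_Ioc] with t ht
    exact (hB t (Ioc_subset_Icc_self ht)).1.const_mul (w t)
  · refine (hw.norm.mul_const B).mono' hmeas.norm.integral_prod_right' ?_
    filter_upwards [ae_restrict_mem measurableSet_Ioc] with t ht
    simp_rw [norm_mul]
    rw [integral_const_mul, Real.norm_eq_abs, abs_mul, abs_norm]
    refine mul_le_mul_of_nonneg_left ?_ (norm_nonneg _)
    rw [abs_of_nonneg (integral_nonneg fun p => norm_nonneg _)]
    exact (hB t (Ioc_subset_Icc_self ht)).2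

end integrand

end RandomlyScaledFBM


/-! ### The Itô formula for the transforms -/

namespace RandomlyScaledFBM

variable {P : Measure Ω} [IsProbabilityMeasure P] (X : RandomlyScaledFBM P)

/-- The functional `(t, a, u) ↦ G(t, √a u, a)` after the Girsanov shift by `η`. -/
abbrev tilt (T : ℝ) (ν : ℝ → ℝ) (η : 𝓢(ℝ, ℝ)) (G : ℝ → ℝ → ℝ → ℝ) : ℝ → ℝ × ℝ → ℝ :=
  tilted T G (X.varExt T ν) (X.meanFun T ν η) (‖η.toLp 2 volume‖ ^ 2 / 2)

theorem tilt_of_mem {T t a x : ℝ} {ν : ℝ → ℝ} (η : 𝓢(ℝ, ℝ)) (G : ℝ → ℝ → ℝ → ℝ)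
    (ht : t ∈ Icc 0 T) (ha : 0 < a) :
    X.tilt T ν η G t (a, x) =
      G t (√a * (√(X.varExt T ν t) * x + √a * X.meanFun T ν η t)) a *
        Real.exp (a * (‖η.toLp 2 volume‖ ^ 2 / 2)) := by
  rw [tilt, tilted, scaledComp_of_mem G ht ha]

variable {ν : ℝ → ℝ} (hν : X.IsGoodIntegrand ν) {T : ℝ} (hT : 0 < T)
  {F Ft Fz Fzz : ℝ → ℝ → ℝ → ℝ} (hF : IsC120 T F Ft Fz Fzz)
  (hF_adm : X.AdmissibleGrowth ν T F) (hFt_adm : X.AdmissibleGrowth ν T Ft)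
  (hFz_adm : X.AdmissibleGrowth ν T fun t z a => a * Fz t z a)
  (hFzz_adm : X.AdmissibleGrowth ν T fun t z a => a * Fzz t z a)
  {ρ : ℝ → ℝ} (hρ : IntervalIntegrable ρ volume 0 T)
  (hρv : ∀ t ∈ Icc 0 T, varianceFun X.H ν t = ∫ u in (0 : ℝ)..t, ρ u)
  (hρd : ∀ t ∈ Ioo 0 T, HasDerivAt (varianceFun X.H ν) (ρ t) t)

include hν hT hF hF_adm hFt_adm hFz_adm hFzz_adm hρ hρv hρd in
-- For fixed a the Gaussian formula is applied to Φ(t, y) = F(t, √a y, a) with mean √a m(t). Then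
-- Φ_y = √a F_z meets μ' = √a m', and Φ_yy = a F_zz. This is how the factor A enters both the Itô
-- integral and the last term.
theorem tilt_ito_of_pos (η : 𝓢(ℝ, ℝ)) {a : ℝ} (ha : 0 < a) :
    ∫ x, X.tilt T ν η F T (a, x) ∂gaussianReal 0 1 - ∫ x, X.tilt T ν η F 0 (a, x) ∂gaussianReal 0 1 =
      ∫ x, (∫ t in Ioc 0 T, (X.tilt T ν η Ft t (a, x) +
        clampExt T ν t * opPlus X.H η t * X.tilt T ν η (fun t z a => a * Fz t z a) t (a, x) +
        ρ t / 2 * X.tilt T ν η (fun t z a => a * Fzz t z a) t (a, x))) ∂gaussianReal 0 1 := by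
  set E := Real.exp (a * (‖η.toLp 2 volume‖ ^ 2 / 2)) with hE
  set v := X.varExt T ν
  set m := X.meanFun T ν η
  have hsa : 0 < √a := Real.sqrt_pos.mpr ha
  have hcont : ∀ {G : ℝ → ℝ → ℝ → ℝ},
      ContinuousOn (fun p : ℝ × ℝ × ℝ => G p.1 p.2.1 p.2.2) (Icc 0 T ×ˢ univ ×ˢ Ioi 0) →
      ContinuousOn (fun p : ℝ × ℝ => G p.1 (√a * p.2) a) (Icc 0 T ×ˢ univ) := by
    intro G hG
    have hc : ContinuousOn (fun p : ℝ × ℝ => (p.1, √a * p.2, a)) (Icc 0 T ×ˢ univ) :=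
      Continuous.continuousOn (by fun_prop)
    exact hG.comp hc fun p hp => ⟨hp.1, trivial, ha⟩
  obtain ⟨C₁, c₁, l₁, hC₁, -, hl₁, -, hlV₁, hb₁⟩ := hF_adm
  obtain ⟨C₂, c₂, l₂, hC₂, -, hl₂, -, hlV₂, hb₂⟩ := hFt_adm
  obtain ⟨C₃, c₃, l₃, hC₃, -, hl₃, -, hlV₃, hb₃⟩ := hFz_adm
  obtain ⟨C₄, c₄, l₄, hC₄, -, hl₄, -, hlV₄, hb₄⟩ := hFzz_adm
  set l := max (max l₁ l₂) (max l₃ l₄) with hl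
  set V := (T ^ X.H * sSup ((fun s => |ν s|) '' Icc 0 T)) ^ 2 with hV
  -- The third bound concerns a F_z while Φ_y is √a F_z, hence the division by √a. The dependence of
  -- `C` on a is harmless, as a is fixed here.
  set C := C₁ * Real.exp (c₁ * a) + C₂ * Real.exp (c₂ * a) + C₃ * Real.exp (c₃ * a) / √a +
    C₄ * Real.exp (c₄ * a) with hC
  have hle : ∀ {C' c' l' : ℝ}, 0 ≤ C' → l' ≤ l → C' * Real.exp (c' * a) ≤ C → ∀ y : ℝ,
      C' * Real.exp (c' * a + l' * y ^ 2) ≤ C * Real.exp (l * y ^ 2) := by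
    intro C' c' l' hC' hl' h y
    rw [Real.exp_add, ← mul_assoc]
    refine mul_le_mul h (Real.exp_le_exp.mpr (mul_le_mul_of_nonneg_right hl' (sq_nonneg _)))
      (Real.exp_nonneg _) ((by positivity : 0 ≤ C' * Real.exp (c' * a)).trans h)
  have hlV : l * V < 1 / 2 := by
    have h4 : ∀ l', l' * (2 * T ^ X.H * sSup ((fun s => |ν s|) '' Icc 0 T)) ^ 2 < 1 →
        l' * V < 1 / 2 := by
      intro l' h
      have h5 : l' * (2 * T ^ X.H * sSup ((fun s => |ν s|) '' Icc 0 T)) ^ 2 = 4 * (l' * V) := by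
        rw [hV]; ring
      rw [h5] at h
      linarith
    rw [hl]
    rcases max_choice (max l₁ l₂) (max l₃ l₄) with h | h <;> rw [h]
    · rcases max_choice l₁ l₂ with h | h <;> rw [h]
      exacts [h4 _ hlV₁, h4 _ hlV₂]
    · rcases max_choice l₃ l₄ with h | h <;> rw [h]
      exacts [h4 _ hlV₃, h4 _ hlV₄]
  have p1 : 0 ≤ C₁ * Real.exp (c₁ * a) := by positivity
  have p2 : 0 ≤ C₂ * Real.exp (c₂ * a) := by positivity
  have p3 : 0 ≤ C₃ * Real.exp (c₃ * a) / √a := by positivity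
  have p4 : 0 ≤ C₄ * Real.exp (c₄ * a) := by positivity
  have hvm : ∀ t ∈ Icc 0 T, v t = varianceFun X.H ν t := fun t ht => clampExt_of_mem ht _
  have key := gaussian_ito (T := T) (V := V) (l := l) (C := C) (v := v) (ρ := ρ)
    (Φ := fun t y => F t (√a * y) a) (Φt := fun t y => Ft t (√a * y) a)
    (Φy := fun t y => √a * Fz t (√a * y) a) (Φyy := fun t y => a * Fzz t (√a * y) a)
    (μ := fun t => √a * m t) (μ' := fun t => √a * (clampExt T ν t * opPlus X.H η t)) hT
    (hcont hF.continuousOn_F) (hcont hF.continuousOn_Ft)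
    (continuousOn_const.mul (hcont hF.continuousOn_Fz))
    (continuousOn_const.mul (hcont hF.continuousOn_Fzz))
    (fun t ht y => hF.hasDeriv_t t ht _ a ha)
    (fun t ht y => by
      have := (hF.hasDeriv_z t ht (√a * y) a ha).comp y ((hasDerivAt_id y).const_mul √a)
      exact this.congr_deriv (by ring))
    (fun t ht y => by
      have := ((hF.hasDeriv_zz t ht (√a * y) a ha).comp y
        ((hasDerivAt_id y).const_mul √a)).const_mul √a
      refine this.congr_deriv ?_
      rw [mul_one, mul_comm (Fzz _ _ _), ← mul_assoc, Real.mul_self_sqrt ha.le])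
    hρ (continuous_const.mul (X.continuous_meanFun hν η)).continuousOn
    (continuous_const.mul (X.continuous_meanFun_integrand hν η)).continuousOn
    (fun t _ => (X.hasDerivAt_meanFun hν η t).const_mul √a)
    (fun t ht => (hvm t ht).trans (hρv t ht))
    (fun t ht => by rw [hvm t ht]; exact integral_nonneg fun x => sq_nonneg _)
    (fun t ht => (hρd t ht).congr_of_eventuallyEq (by
      filter_upwards [Icc_mem_nhds ht.1 ht.2] with s hs using hvm s hs))
    (le_max_of_le_left (le_max_of_le_left hl₁))
    (fun t ht => by rw [hvm t ht]; exact varianceFun_le X.H_pos X.H_lt_one hν.1 hν.2 ht)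
    hlV (by rw [hC]; positivity)
    (fun t ht y => (hb₁ t ht y a ha).trans
      (hle hC₁ (le_max_of_le_left (le_max_left _ _)) (by rw [hC]; linarith) y))
    (fun t ht y => (hb₂ t ht y a ha).trans
      (hle hC₂ (le_max_of_le_left (le_max_right _ _)) (by rw [hC]; linarith) y))
    (fun t ht y => by
      have h := hb₃ t ht y a ha
      rw [abs_mul, abs_of_pos ha] at h
      have h6 : √a * |Fz t (√a * y) a| ≤ C₃ * Real.exp (c₃ * a) / √a * Real.exp (l₃ * y ^ 2) := by
        rw [div_mul_eq_mul_div, le_div_iff₀ hsa, mul_assoc C₃, ← Real.exp_add]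
        calc √a * |Fz t (√a * y) a| * √a = (√a * √a) * |Fz t (√a * y) a| := by ring
          _ ≤ _ := by rw [Real.mul_self_sqrt ha.le]; exact h
      rw [abs_mul, abs_of_pos hsa]
      refine h6.trans (mul_le_mul (by rw [hC]; linarith) (Real.exp_le_exp.mpr
        (mul_le_mul_of_nonneg_right (le_max_of_le_right (le_max_left _ _)) (sq_nonneg _)))
        (Real.exp_nonneg _) (by rw [hC]; positivity)))
    (fun t ht y => (hb₄ t ht y a ha).trans
      (hle hC₄ (le_max_of_le_right (le_max_right _ _)) (by rw [hC]; linarith) y))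
  have e0 : ∀ t ∈ Icc 0 T, ∫ x, X.tilt T ν η F t (a, x) ∂gaussianReal 0 1 =
      (∫ x, F t (√a * (√(v t) * x + √a * m t)) a ∂gaussianReal 0 1) * E := by
    intro t ht
    rw [← integral_mul_const]
    exact integral_congr_ae (ae_of_all _ fun x => X.tilt_of_mem η F ht ha)
  rw [e0 T ⟨hT.le, le_rfl⟩, e0 0 ⟨le_rfl, hT.le⟩, ← sub_mul]
  refine (congrArg (· * E) key).trans ?_
  rw [← integral_mul_const]
  refine integral_congr_ae (ae_of_all _ fun x => ?_)
  simp only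
  rw [← integral_mul_const]
  refine setIntegral_congr_fun measurableSet_Ioc fun t ht => ?_
  have ht' := Ioc_subset_Icc_self ht
  rw [X.tilt_of_mem η _ ht' ha, X.tilt_of_mem η _ ht' ha, X.tilt_of_mem η _ ht' ha]
  have hs := Real.mul_self_sqrt ha.le
  rw [← hE]
  linear_combination (clampExt T ν t * opPlus X.H η t *
    Fz t (√a * (√(v t) * x + √a * m t)) a * E) * hs

include hν hT hF hF_adm hFt_adm hFz_adm hFzz_adm hρ hρv hρd in
-- The formula for fixed a is integrated over the law of `A`; the joint integrability of each term
-- moves the time integral outside.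
theorem tilt_ito {η : 𝓢(ℝ, ℝ)} (hη : η ∈ X.testFunctions) :
    ∫ p, X.tilt T ν η F T p ∂X.lawProd - ∫ p, X.tilt T ν η F 0 p ∂X.lawProd =
      ∫ t in Ioc 0 T, (∫ p, X.tilt T ν η Ft t p ∂X.lawProd +
        clampExt T ν t * opPlus X.H η t *
          ∫ p, X.tilt T ν η (fun t z a => a * Fz t z a) t p ∂X.lawProd +
        ρ t / 2 * ∫ p, X.tilt T ν η (fun t z a => a * Fzz t z a) t p ∂X.lawProd) := by
  have cz : ContinuousOn (fun p : ℝ × ℝ × ℝ => p.2.2 * Fz p.1 p.2.1 p.2.2)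
      (Icc 0 T ×ˢ univ ×ˢ Ioi 0) :=
    (Continuous.continuousOn (by fun_prop)).mul hF.continuousOn_Fz
  have czz : ContinuousOn (fun p : ℝ × ℝ × ℝ => p.2.2 * Fzz p.1 p.2.1 p.2.2)
      (Icc 0 T ×ˢ univ ×ˢ Ioi 0) :=
    (Continuous.continuousOn (by fun_prop)).mul hF.continuousOn_Fzz
  have hρ1 : IntegrableOn ρ (Ioc 0 T) := (intervalIntegrable_iff_integrableOn_Ioc_of_le hT.le).mp hρ
  have hw2 : IntegrableOn (fun t => clampExt T ν t * opPlus X.H η t) (Ioc 0 T) :=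
    (X.continuous_meanFun_integrand hν η).integrableOn_Icc.mono_set Ioc_subset_Icc_self
  obtain ⟨_, hb⟩ := X.exists_bound_tilted hν hT hF.continuousOn_F hF_adm hη
  obtain ⟨_, hbt⟩ := X.exists_bound_tilted hν hT hF.continuousOn_Ft hFt_adm hη
  obtain ⟨_, hbz⟩ := X.exists_bound_tilted hν hT (G := fun t z a => a * Fz t z a) cz hFz_adm hη
  obtain ⟨_, hbzz⟩ := X.exists_bound_tilted hν hT (G := fun t z a => a * Fzz t z a) czz hFzz_adm hη
  have I1 := X.integrable_mul_tilted hν hT hF.continuousOn_Ft hFt_adm hη (w := fun _ => 1)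
    (integrableOn_const (by simp))
  have I2 := X.integrable_mul_tilted hν hT (G := fun t z a => a * Fz t z a) cz hFz_adm hη hw2
  have I3 := X.integrable_mul_tilted hν hT (G := fun t z a => a * Fzz t z a) czz hFzz_adm hη
    (hρ1.div_const 2)
  simp only [one_mul] at I1
  let S : ℝ → ℝ × ℝ → ℝ := fun t p => X.tilt T ν η Ft t p +
    clampExt T ν t * opPlus X.H η t * X.tilt T ν η (fun t z a => a * Fz t z a) t p +
    ρ t / 2 * X.tilt T ν η (fun t z a => a * Fzz t z a) t p
  have hS : Integrable (Function.uncurry S) ((volume.restrict (Ioc 0 T)).prod X.lawProd) :=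
    (I1.add I2).add I3
  have hT1 := (hb T ⟨hT.le, le_rfl⟩).1
  have hT0 := (hb 0 ⟨le_rfl, hT.le⟩).1
  calc ∫ p, X.tilt T ν η F T p ∂X.lawProd - ∫ p, X.tilt T ν η F 0 p ∂X.lawProd
      = ∫ a, (∫ x, X.tilt T ν η F T (a, x) ∂gaussianReal 0 1 -
          ∫ x, X.tilt T ν η F 0 (a, x) ∂gaussianReal 0 1) ∂(P.map X.A) := by
        rw [integral_prod _ hT1, integral_prod _ hT0,
          ← integral_sub hT1.integral_prod_left hT0.integral_prod_left]
    _ = ∫ a, (∫ x, (∫ t in Ioc 0 T, S t (a, x)) ∂gaussianReal 0 1) ∂(P.map X.A) := by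
        refine integral_congr_ae ?_
        filter_upwards [X.ae_pos_map] with a ha
        exact X.tilt_ito_of_pos hν hT hF hF_adm hFt_adm hFz_adm hFzz_adm hρ hρv hρd η ha
    _ = ∫ p, (∫ t in Ioc 0 T, S t p) ∂X.lawProd :=
        (integral_prod (fun p => ∫ t in Ioc 0 T, S t p) hS.integral_prod_right).symm
    _ = ∫ t in Ioc 0 T, ∫ p, S t p ∂X.lawProd := (integral_integral_swap hS).symm
    _ = _ := by
        refine setIntegral_congr_fun measurableSet_Ioc fun t ht => ?_
        have ht' := Ioc_subset_Icc_self ht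
        have j1 := (hbt t ht').1
        have j2 := (hbz t ht').1.const_mul (clampExt T ν t * opPlus X.H η t)
        have j3 := (hbzz t ht').1.const_mul (ρ t / 2)
        refine (integral_add (j1.add j2) j3).trans ?_
        refine congrArg₂ (· + ·) ((integral_add j1 j2).trans ?_) (integral_const_mul _ _)
        exact congrArg₂ (· + ·) rfl (integral_const_mul _ _)

end RandomlyScaledFBM


/-! ### Functionals of the Gaussian part -/

namespace RandomlyScaledFBM

variable {P : Measure Ω} [IsProbabilityMeasure P] (X : RandomlyScaledFBM P)

theorem sTransform_sub {φ ψ : Ω → ℝ} (hφ : X.MemL2A φ) (hψ : X.MemL2A ψ) {η : 𝓢(ℝ, ℝ)}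
    (hη : η ∈ X.testFunctions) :
    X.sTransform (fun ω => φ ω - ψ ω) η = X.sTransform φ η - X.sTransform ψ η := by
  simp only [sTransform, sub_mul]
  exact integral_sub (hφ.integrable_mul (X.memL2A_wickExp hη))
    (hψ.integrable_mul (X.memL2A_wickExp hη))

theorem sTransform_congr {φ ψ : Ω → ℝ} (h : φ =ᵐ[P] ψ) (η : 𝓢(ℝ, ℝ)) :
    X.sTransform φ η = X.sTransform ψ η :=
  integral_congr_ae (h.mono fun ω hω => by simp only [hω])

theorem sTransform_const_mul (c : ℝ) (φ : Ω → ℝ) (η : 𝓢(ℝ, ℝ)) :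
    X.sTransform (fun ω => c * φ ω) η = c * X.sTransform φ η := by
  simp only [sTransform, mul_assoc]
  exact integral_const_mul _ _

variable {X}

section growth

variable (hR : 0 < X.radius) (ν : ℝ → ℝ) (T : ℝ)

include hR in
-- Positive constants are needed to see the functionals a and z, of polynomial growth, as
-- admissible; through them the transforms of `A` and of the Gaussian part are computed.
theorem exists_growth_constants : ∃ c l : ℝ, 0 < c ∧ 0 < l ∧ ENNReal.ofReal (2 * c) < X.radius ∧
    l * (2 * T ^ X.H * sSup ((fun s => |ν s|) '' Icc 0 T)) ^ 2 < 1 := by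
  obtain ⟨r, hr0, hr⟩ := ENNReal.lt_iff_exists_nnreal_btwn.mp hR
  have hr0' : (0 : ℝ) < r := by exact_mod_cast hr0
  set W := (2 * T ^ X.H * sSup ((fun s => |ν s|) '' Icc 0 T)) ^ 2
  have hW : 0 ≤ W := sq_nonneg _
  refine ⟨r / 2, 1 / (1 + W), by positivity, by positivity, ?_, ?_⟩
  · rw [mul_div_cancel₀ _ two_ne_zero, ENNReal.ofReal_coe_nnreal]; exact hr
  · rw [one_div_mul_eq_div, div_lt_one (by positivity)]; linarith

theorem le_const_mul_exp {c x : ℝ} (hc : 0 < c) (hx : 0 ≤ x) :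
    1 + x ≤ (1 + 1 / c) * Real.exp (c * x) := by
  have h1 : 1 ≤ Real.exp (c * x) := Real.one_le_exp (by positivity)
  have h2 : c * x ≤ Real.exp (c * x) := by linarith [Real.add_one_le_exp (c * x)]
  have h3 : x = 1 / c * (c * x) := by field_simp
  rw [add_mul]
  refine add_le_add (by linarith) ?_
  nth_rewrite 1 [h3]
  exact mul_le_mul_of_nonneg_left h2 (by positivity)

include hR in
theorem admissibleGrowth_scale : X.AdmissibleGrowth ν T fun _ _ a => a := by
  obtain ⟨c, l, hc, hl, hcR, hlV⟩ := exists_growth_constants hR ν T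
  refine ⟨1 + 1 / c, c, l, by positivity, hc.le, hl.le, hcR, hlV, fun t _ z a ha => ?_⟩
  rw [abs_of_pos ha]
  calc a ≤ (1 + 1 / c) * Real.exp (c * a) := (by linarith : a ≤ 1 + a).trans
        (le_const_mul_exp hc ha.le)
    _ ≤ _ := mul_le_mul_of_nonneg_left
        (Real.exp_le_exp.mpr (by linarith [mul_nonneg hl.le (sq_nonneg z)])) (by positivity)

include hR in
theorem admissibleGrowth_space : X.AdmissibleGrowth ν T fun _ z _ => z := by
  obtain ⟨c, l, hc, hl, hcR, hlV⟩ := exists_growth_constants hR ν T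
  refine ⟨(1 + 1 / c) * (1 + 1 / l), c, l, by positivity, hc.le, hl.le, hcR, hlV,
    fun t _ z a ha => ?_⟩
  have h1 : √a ≤ 1 + a := by nlinarith [Real.sq_sqrt ha.le, sq_nonneg (√a - 1)]
  have h2 : |z| ≤ 1 + z ^ 2 := by nlinarith [sq_abs z, sq_nonneg (|z| - 1)]
  rw [abs_mul, abs_of_nonneg (Real.sqrt_nonneg a), Real.exp_add]
  calc √a * |z| ≤ ((1 + 1 / c) * Real.exp (c * a)) * ((1 + 1 / l) * Real.exp (l * z ^ 2)) :=
        mul_le_mul (h1.trans (le_const_mul_exp hc ha.le))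
          (h2.trans (le_const_mul_exp hl (sq_nonneg z))) (abs_nonneg _) (by positivity)
    _ = _ := by ring

end growth

section functional

variable (hR : 0 < X.radius) {ν : ℝ → ℝ} (hν : X.IsGoodIntegrand ν) {T : ℝ} (hT : 0 < T)
  {G : ℝ → ℝ → ℝ → ℝ}
  (hG : ContinuousOn (fun p : ℝ × ℝ × ℝ => G p.1 p.2.1 p.2.2) (Icc 0 T ×ˢ univ ×ˢ Ioi 0))
  (hadm : X.AdmissibleGrowth ν T G)

variable (X) in
/-- The Wiener integral part `√A ∫ M_-^H(ν 1_(0,t)) dB` of the process. -/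
def gaussPart (ν : ℝ → ℝ) (t : ℝ) (ω : Ω) : ℝ := √(X.A ω) * X.wiener (X.kernLp ν t) ω

theorem comp_gaussPart {t : ℝ} (ht : t ∈ Icc 0 T) (G : ℝ → ℝ → ℝ → ℝ) (ω : Ω) :
    G t (X.gaussPart ν t ω) (X.A ω) = scaledComp T G (t, X.A ω, X.wiener (X.kernLp ν t) ω) :=
  (scaledComp_of_mem G ht (X.A_pos ω)).symm

include hG in
theorem aestronglyMeasurable_comp_gaussPart {t : ℝ} (ht : t ∈ Icc 0 T) :
    AEStronglyMeasurable[X.sigmaBA] (fun ω => G t (X.gaussPart ν t ω) (X.A ω)) P := by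
  simp_rw [comp_gaussPart ht]
  obtain ⟨w, hw, hwe⟩ := X.aestronglyMeasurable_wiener (X.kernLp ν t)
  refine ⟨fun ω => scaledComp T G (t, X.A ω, w ω), ?_, ?_⟩
  · have hp : Measurable[X.sigmaBA] fun ω => (X.A ω, w ω) :=
      Measurable.prodMk X.measurable_A_sigmaBA hw.measurable
    exact (((measurable_scaledComp hG).comp measurable_prodMk_left).comp hp).stronglyMeasurable
  · filter_upwards [hwe] with ω hω
    rw [hω]

include hν hT hG hadm in
theorem exists_memL2A_comp_gaussPart : ∃ B : ℝ, 0 ≤ B ∧ ∀ t ∈ Icc 0 T,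
    X.MemL2A (fun ω => G t (X.gaussPart ν t ω) (X.A ω)) ∧
      ∫ ω, G t (X.gaussPart ν t ω) (X.A ω) ^ 2 ∂P ≤ B ^ 2 := by
  obtain ⟨B, hB0, hB⟩ := X.exists_bound_scaledComp hν hT hG hadm
  refine ⟨B, hB0, fun t ht => ?_⟩
  have hm := aestronglyMeasurable_comp_gaussPart (X := X) (ν := ν) hG ht
  obtain ⟨h1, h2⟩ := hB t ht
  simp_rw [← comp_gaussPart ht] at h1 h2
  exact ⟨⟨hm, h1⟩, h2⟩

include hν hG in
theorem sTransform_comp_gaussPart (η : 𝓢(ℝ, ℝ)) {t : ℝ} (ht : t ∈ Icc 0 T) :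
    X.sTransform (fun ω => G t (X.gaussPart ν t ω) (X.A ω)) η =
      (∫ p, X.tilt T ν η G t p ∂X.lawProd) / X.wickConst η := by
  rw [sTransform_eq_div, ← (X.integral_scaledComp_mul_rawExp hν hG η ht).2]
  simp_rw [comp_gaussPart ht]

include hR hν hT in
/-- The transform of the Gaussian part. -/
theorem sTransform_gaussPart {η : 𝓢(ℝ, ℝ)} (hη : η ∈ X.testFunctions) {t : ℝ} (ht : t ∈ Icc 0 T) :
    X.sTransform (X.gaussPart ν t) η = X.meanFun T ν η t * X.sTransform X.A η := by
  have c1 : ContinuousOn (fun p : ℝ × ℝ × ℝ => p.2.1) (Icc 0 T ×ˢ univ ×ˢ Ioi 0) :=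
    Continuous.continuousOn (by fun_prop)
  have c2 : ContinuousOn (fun p : ℝ × ℝ × ℝ => p.2.2) (Icc 0 T ×ˢ univ ×ˢ Ioi 0) :=
    Continuous.continuousOn (by fun_prop)
  have s1 := sTransform_comp_gaussPart hν (G := fun _ z _ => z) c1 η ht
  have s2 := sTransform_comp_gaussPart hν (G := fun _ _ a => a) c2 η ht
  obtain ⟨_, b1⟩ := X.exists_bound_tilted hν hT (G := fun _ z _ => z) c1
    (admissibleGrowth_space hR ν T) hη
  obtain ⟨_, b2⟩ := X.exists_bound_tilted hν hT (G := fun _ _ a => a) c2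
    (admissibleGrowth_scale hR ν T) hη
  have i1 := (b1 t ht).1
  have i2 := (b2 t ht).1.const_mul (X.meanFun T ν η t)
  have i3 : Integrable (fun p => X.tilt T ν η (fun _ z _ => z) t p -
      X.meanFun T ν η t * X.tilt T ν η (fun _ _ a => a) t p) X.lawProd := i1.sub i2
  -- After the shift z becomes √a√v x + a m, so the difference is a multiple of x and has mean zero
  -- for each a.
  have e3 : ∫ p, (X.tilt T ν η (fun _ z _ => z) t p -
      X.meanFun T ν η t * X.tilt T ν η (fun _ _ a => a) t p) ∂X.lawProd = 0 := by
    rw [integral_prod _ i3]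
    refine integral_eq_zero_of_ae ?_
    filter_upwards [X.ae_pos_map] with a ha
    have e4 : ∀ x, X.tilt T ν η (fun _ z _ => z) t (a, x) -
        X.meanFun T ν η t * X.tilt T ν η (fun _ _ a => a) t (a, x) =
        √a * √(X.varExt T ν t) * Real.exp (a * (‖η.toLp 2 volume‖ ^ 2 / 2)) * x := by
      intro x
      rw [X.tilt_of_mem η _ ht ha, X.tilt_of_mem η _ ht ha]
      linear_combination (X.meanFun T ν η t * Real.exp (a * (‖η.toLp 2 volume‖ ^ 2 / 2))) *
        Real.mul_self_sqrt ha.le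
    simp_rw [e4]
    rw [integral_const_mul, integral_id_gaussianReal, mul_zero]; rfl
  rw [integral_sub i1 i2, integral_const_mul, sub_eq_zero] at e3
  rw [show X.gaussPart ν t = fun ω => X.gaussPart ν t ω from rfl,
    show X.A = fun ω => X.A ω from rfl, s1, s2, e3, mul_div_assoc]

include hR hν hT in
/-- The fractional Itô integral of a deterministic function is a scaled Wiener integral. -/
theorem IsFracItoIntegral.ae_eq_gaussPart {t : ℝ} (ht : t ∈ Icc 0 T) {Y : Ω → ℝ}
    (hY : X.IsFracItoIntegral (Ico 0 t) (fun s _ => ν s) Y) : Y =ᵐ[P] X.gaussPart ν t := by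
  have c1 : ContinuousOn (fun p : ℝ × ℝ × ℝ => p.2.1) (Icc 0 T ×ˢ univ ×ˢ Ioi 0) :=
    Continuous.continuousOn (by fun_prop)
  obtain ⟨_, -, hB⟩ := exists_memL2A_comp_gaussPart hν hT (G := fun _ z _ => z) c1
    (admissibleGrowth_space hR ν T)
  have hm : X.MemL2A (X.gaussPart ν t) := (hB t ht).1
  -- The transform of the fractional integral is that of `A` times the integral of ν M_+^H η, which
  -- is exactly the transform of the Gaussian part.
  have h0 := X.ae_eq_zero_of_sTransform_eq_zero hR (hY.memL2A.sub hm) fun η hη => by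
    rw [X.sTransform_sub hY.memL2A hm hη, sTransform_gaussPart hR hν hT hη ht, hY.sTransform_eq η hη,
      X.meanFun_eq η ht, intervalIntegral.integral_of_le ht.1, integral_Ioc_eq_integral_Ioo,
      ← integral_Ico_eq_integral_Ioo, ← integral_mul_const, sub_eq_zero]
    refine setIntegral_congr_fun measurableSet_Ico fun s _ => ?_
    simp_rw [mul_comm (X.A _)]
    rw [sTransform_const_mul]
    ring
  filter_upwards [h0] with ω hω
  exact sub_eq_zero.mp hω

include hν hT in
theorem gaussPart_zero : X.gaussPart ν 0 =ᵐ[P] 0 := by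
  obtain ⟨ρ, -, hv, -⟩ := exists_density_varianceFun X.H_pos X.H_lt_one hν.1 hν.2 hT
  have h1 : ‖X.kernLp ν 0‖ ^ 2 = 0 := by
    rw [X.norm_sq_kernLp hν le_rfl, hv 0 ⟨le_rfl, hT.le⟩, intervalIntegral.integral_same]
  have h2 : X.kernLp ν 0 = 0 := by simpa using h1
  have h3 : X.wiener (X.kernLp ν 0) = 0 := by rw [h2]; exact map_zero _
  filter_upwards [Lp.coeFn_zero ℝ 2 P] with ω hω
  rw [gaussPart, h3, hω]; simp

include hν hT hG hadm in
theorem integrableOn_mul_integral_tilt {η : 𝓢(ℝ, ℝ)} (hη : η ∈ X.testFunctions) {w : ℝ → ℝ}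
    (hw : IntegrableOn w (Ioc 0 T)) :
    IntegrableOn (fun t => w t * ∫ p, X.tilt T ν η G t p ∂X.lawProd) (Ioc 0 T) := by
  have := (X.integrable_mul_tilted hν hT hG hadm hη hw).integral_prod_left
  simp only [integral_const_mul] at this
  exact this

include hν hT hG in
theorem measurable_integral_tilt (η : 𝓢(ℝ, ℝ)) :
    Measurable fun t => ∫ p, X.tilt T ν η G t p ∂X.lawProd :=
  ((measurable_tilted hG (X.continuous_varExt hν hT).measurable
    (X.continuous_meanFun hν η).measurable).stronglyMeasurable.integral_prod_right'
      (ν := X.lawProd)).measurable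

end functional

end RandomlyScaledFBM


/-! ### The Itô formula -/

namespace RandomlyScaledFBM

variable {P : Measure Ω} [IsProbabilityMeasure P] {X : RandomlyScaledFBM P}

/-- Each Z_t is known only up to a null set depending on t, so both kinds of integral must be
insensitive to versions. -/
theorem IsPettisIntegral.congr {M : Set ℝ} {f g : ℝ → Ω → ℝ} {Θ : Ω → ℝ}
    (h : X.IsPettisIntegral M f Θ) (hfg : ∀ t ∈ M, f t =ᵐ[P] g t) : X.IsPettisIntegral M g Θ := by
  have e : ∀ (ψ : Ω → ℝ), ∀ t ∈ M, ∫ ω, f t ω * ψ ω ∂P = ∫ ω, g t ω * ψ ω ∂P := fun ψ t ht =>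
    integral_congr_ae ((hfg t ht).mono fun ω hω => by simp only [hω])
  refine ⟨h.measurableSet, fun t ht => (h.memL2A_fun t ht).congr (hfg t ht), fun ψ hψ => ?_,
    fun ψ hψ => ?_, h.memL2A, fun ψ hψ => ?_⟩
  · exact (funext fun t : M => e ψ t t.2) ▸ h.measurable ψ hψ
  · exact (h.integrableOn ψ hψ).congr_fun (e ψ) h.measurableSet
  · rw [h.inner_eq ψ hψ]; exact setIntegral_congr_fun h.measurableSet (e ψ)

theorem IsFracItoIntegral.congr {M : Set ℝ} {U V : ℝ → Ω → ℝ} {Θ : Ω → ℝ}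
    (h : X.IsFracItoIntegral M U Θ) (hUV : ∀ t ∈ M, U t =ᵐ[P] V t) :
    X.IsFracItoIntegral M V Θ := by
  have e : ∀ (η : 𝓢(ℝ, ℝ)), ∀ t ∈ M,
      X.sTransform (fun ω => X.A ω * U t ω) η * opPlus X.H (fun x => η x) t =
        X.sTransform (fun ω => X.A ω * V t ω) η * opPlus X.H (fun x => η x) t := fun η t ht => by
    rw [X.sTransform_congr (ψ := fun ω => X.A ω * V t ω)
      ((hUV t ht).mono fun ω hω => by simp only [hω])]
  refine ⟨h.measurableSet, fun t ht => (h.measurable t ht).congr (hUV t ht), fun t ht η hη => ?_,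
    fun η hη => ?_, h.memL2A, fun η hη => ?_⟩
  · exact (h.integrable t ht η hη).congr ((hUV t ht).mono fun ω hω => by simp only [hω])
  · exact (h.integrableOn η hη).congr_fun (e η) h.measurableSet
  · rw [h.sTransform_eq η hη]; exact setIntegral_congr_fun h.measurableSet (e η)

theorem IsPettisIntegral.sTransform_eq {M : Set ℝ} {f : ℝ → Ω → ℝ} {Θ : Ω → ℝ}
    (h : X.IsPettisIntegral M f Θ) {η : 𝓢(ℝ, ℝ)} (hη : η ∈ X.testFunctions) :
    X.sTransform Θ η = ∫ t in M, X.sTransform (f t) η :=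
  h.inner_eq _ (X.memL2A_wickExp hη)

section formula

variable (hR : 0 < X.radius) {ν : ℝ → ℝ} (hν : X.IsGoodIntegrand ν) {T : ℝ} (hT : 0 < T)

include hR hν hT in
theorem exists_isPettisIntegral_comp_gaussPart {G : ℝ → ℝ → ℝ → ℝ}
    (hG : ContinuousOn (fun p : ℝ × ℝ × ℝ => G p.1 p.2.1 p.2.2) (Icc 0 T ×ˢ univ ×ˢ Ioi 0))
    (hadm : X.AdmissibleGrowth ν T G) {M : Set ℝ} (hM : MeasurableSet M) (hMT : M ⊆ Icc 0 T)
    {w : ℝ → ℝ} (hwm : Measurable w) (hw : IntegrableOn w M) :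
    ∃ Θ, X.IsPettisIntegral M (fun t ω => w t * G t (X.gaussPart ν t ω) (X.A ω)) Θ := by
  obtain ⟨B, hB0, hB⟩ := exists_memL2A_comp_gaussPart hν hT hG hadm
  refine exists_isPettisIntegral (w := fun t => |w t| * B) hR hM
    (fun t ht => (hB t (hMT ht)).1.const_mul (w t)) (hw.abs.mul_const B)
    (fun t _ => by positivity) (fun t ht => ?_) fun η _ => ?_
  · simp_rw [mul_pow]
    rw [integral_const_mul, sq_abs]
    exact mul_le_mul_of_nonneg_left (hB t (hMT ht)).2 (sq_nonneg _)
  · have hm : Measurable fun t : M => w t *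
        ((∫ p, X.tilt T ν η G t p ∂X.lawProd) / X.wickConst η) :=
      (hwm.mul ((measurable_integral_tilt hν hT hG η).div_const _)).comp measurable_subtype_coe
    convert hm using 2 with t
    rw [← sTransform_comp_gaussPart hν hG η (hMT t.2), ← sTransform_const_mul]
    rfl

variable {F Ft Fz Fzz : ℝ → ℝ → ℝ → ℝ} (hF : IsC120 T F Ft Fz Fzz)
  (hF_adm : X.AdmissibleGrowth ν T F) (hFt_adm : X.AdmissibleGrowth ν T Ft)
  (hFz_adm : X.AdmissibleGrowth ν T (fun t z a => a * Fz t z a))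
  (hFzz_adm : X.AdmissibleGrowth ν T (fun t z a => a * Fzz t z a))

theorem continuousOn_scale_mul {G : ℝ → ℝ → ℝ → ℝ}
    (hG : ContinuousOn (fun p : ℝ × ℝ × ℝ => G p.1 p.2.1 p.2.2) (Icc 0 T ×ˢ univ ×ˢ Ioi 0)) :
    ContinuousOn (fun p : ℝ × ℝ × ℝ => p.2.2 * G p.1 p.2.1 p.2.2) (Icc 0 T ×ˢ univ ×ˢ Ioi 0) :=
  (Continuous.continuousOn (by fun_prop)).mul hG

include hν in
theorem sTransform_scale_mul {G : ℝ → ℝ → ℝ → ℝ}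
    (hG : ContinuousOn (fun p : ℝ × ℝ × ℝ => G p.1 p.2.1 p.2.2) (Icc 0 T ×ˢ univ ×ˢ Ioi 0))
    (η : 𝓢(ℝ, ℝ)) {t : ℝ} (ht : t ∈ Icc 0 T) (c : ℝ) :
    X.sTransform (fun ω => X.A ω * (c * G t (X.gaussPart ν t ω) (X.A ω))) η =
      c * ((∫ p, X.tilt T ν η (fun t z a => a * G t z a) t p ∂X.lawProd) / X.wickConst η) := by
  simp_rw [mul_left_comm (X.A _)]
  rw [sTransform_const_mul, ← sTransform_comp_gaussPart (G := fun t z a => a * G t z a) hν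
    (continuousOn_scale_mul hG) η ht]

include hν hT hF hFz_adm in
theorem integrableOn_sTransform_ito {η : 𝓢(ℝ, ℝ)} (hη : η ∈ X.testFunctions) :
    IntegrableOn (fun t => X.sTransform
      (fun ω => X.A ω * (ν t * Fz t (X.gaussPart ν t ω) (X.A ω))) η *
        opPlus X.H (fun x => η x) t) (Ioc 0 T) := by
  have hc := (X.continuous_meanFun_integrand hν (T := T) η).integrableOn_Ioc (μ := volume)
    (a := 0) (b := T)
  have h := Integrable.div_const (integrableOn_mul_integral_tilt hν hT
    (G := fun t z a => a * Fz t z a) (continuousOn_scale_mul hF.continuousOn_Fz) hFz_adm hη hc)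
    (X.wickConst η)
  refine IntegrableOn.congr_fun h (fun t ht => ?_) measurableSet_Ioc
  have ht' := Ioc_subset_Icc_self ht
  rw [sTransform_scale_mul hν hF.continuousOn_Fz η ht', clampExt_of_mem ht']
  ring

include hν hT hF hF_adm hFt_adm hFz_adm hFzz_adm in
/-- The Itô formula on the level of the transforms. -/
theorem sTransform_ito {η : 𝓢(ℝ, ℝ)} (hη : η ∈ X.testFunctions) :
    X.sTransform (fun ω => F T (X.gaussPart ν T ω) (X.A ω)) η -
        X.sTransform (fun ω => F 0 (X.gaussPart ν 0 ω) (X.A ω)) η =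
      (∫ t in Icc 0 T, X.sTransform (fun ω => Ft t (X.gaussPart ν t ω) (X.A ω)) η) +
      (∫ t in Ico 0 T, X.sTransform
        (fun ω => X.A ω * (ν t * Fz t (X.gaussPart ν t ω) (X.A ω))) η *
          opPlus X.H (fun x => η x) t) +
      ∫ t in Ioo 0 T, X.sTransform (fun ω => X.A ω / 2 *
        (deriv (varianceFun X.H ν) t * Fzz t (X.gaussPart ν t ω) (X.A ω))) η := by
  obtain ⟨ρ, hρ, hρv, hρd⟩ := exists_density_varianceFun X.H_pos X.H_lt_one hν.1 hν.2 hT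
  have key := X.tilt_ito hν hT hF hF_adm hFt_adm hFz_adm hFzz_adm hρ hρv hρd hη
  have cz := continuousOn_scale_mul hF.continuousOn_Fz
  have czz := continuousOn_scale_mul hF.continuousOn_Fzz
  have hρ' : IntegrableOn ρ (Ioc 0 T) := (intervalIntegrable_iff_integrableOn_Ioc_of_le hT.le).mp hρ
  have j1 := (integrableOn_mul_integral_tilt (w := fun _ => 1) hν hT hF.continuousOn_Ft hFt_adm hη
    (integrableOn_const (by simp)))
  have j2 := (integrableOn_mul_integral_tilt hν hT cz hFz_adm hη
    ((X.continuous_meanFun_integrand hν (T := T) η).integrableOn_Ioc (μ := volume)))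
  have j3 := (integrableOn_mul_integral_tilt hν hT czz hFzz_adm hη (hρ'.div_const 2))
  simp only [one_mul] at j1
  have e1 : ∫ t in Icc 0 T, X.sTransform (fun ω => Ft t (X.gaussPart ν t ω) (X.A ω)) η =
      (∫ t in Ioc 0 T, ∫ p, X.tilt T ν η Ft t p ∂X.lawProd) / X.wickConst η := by
    rw [integral_Icc_eq_integral_Ioc, ← integral_div]
    exact setIntegral_congr_fun measurableSet_Ioc fun t ht =>
      sTransform_comp_gaussPart hν hF.continuousOn_Ft η (Ioc_subset_Icc_self ht)
  have e2 : ∫ t in Ico 0 T, X.sTransform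
        (fun ω => X.A ω * (ν t * Fz t (X.gaussPart ν t ω) (X.A ω))) η *
          opPlus X.H (fun x => η x) t =
      (∫ t in Ioc 0 T, clampExt T ν t * opPlus X.H (fun x => η x) t *
        ∫ p, X.tilt T ν η (fun t z a => a * Fz t z a) t p ∂X.lawProd) / X.wickConst η := by
    rw [integral_Ico_eq_integral_Ioo, ← integral_Ioc_eq_integral_Ioo, ← integral_div]
    refine setIntegral_congr_fun measurableSet_Ioc fun t ht => ?_
    have ht' := Ioc_subset_Icc_self ht
    rw [sTransform_scale_mul hν hF.continuousOn_Fz η ht', clampExt_of_mem ht']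
    ring
  have e3 : ∫ t in Ioo 0 T, X.sTransform (fun ω => X.A ω / 2 *
        (deriv (varianceFun X.H ν) t * Fzz t (X.gaussPart ν t ω) (X.A ω))) η =
      (∫ t in Ioc 0 T, ρ t / 2 *
        ∫ p, X.tilt T ν η (fun t z a => a * Fzz t z a) t p ∂X.lawProd) / X.wickConst η := by
    rw [integral_Ioc_eq_integral_Ioo, ← integral_div]
    refine setIntegral_congr_fun measurableSet_Ioo fun t ht => ?_
    have e : ∀ ω, X.A ω / 2 * (deriv (varianceFun X.H ν) t * Fzz t (X.gaussPart ν t ω) (X.A ω)) =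
        X.A ω * (ρ t / 2 * Fzz t (X.gaussPart ν t ω) (X.A ω)) := fun ω => by
      rw [(hρd t ht).deriv]; ring
    simp_rw [e]
    rw [sTransform_scale_mul hν hF.continuousOn_Fzz η (Ioo_subset_Icc_self ht), mul_div_assoc]
  rw [e1, e2, e3, sTransform_comp_gaussPart hν hF.continuousOn_F η ⟨hT.le, le_rfl⟩,
    sTransform_comp_gaussPart hν hF.continuousOn_F η ⟨le_rfl, hT.le⟩, ← sub_div, ← add_div,
    ← add_div, key]
  congr 1
  refine (integral_add (j1.add j2) j3).trans ?_
  congr 1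
  exact integral_add j1 j2

include hR hν hT hF hFzz_adm in
theorem exists_isPettisIntegral_ito : ∃ I₃, X.IsPettisIntegral (Ioo 0 T) (fun t ω => X.A ω / 2 *
    (deriv (varianceFun X.H ν) t * Fzz t (X.gaussPart ν t ω) (X.A ω))) I₃ := by
  obtain ⟨ρ, hρ, hρv, hρd⟩ := exists_density_varianceFun X.H_pos X.H_lt_one hν.1 hν.2 hT
  have hρ' : IntegrableOn ρ (Ioo 0 T) :=
    ((intervalIntegrable_iff_integrableOn_Ioc_of_le hT.le).mp hρ).mono_set Ioo_subset_Ioc_self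
  have hd : IntegrableOn (deriv (varianceFun X.H ν)) (Ioo 0 T) :=
    hρ'.congr_fun (fun t ht => (hρd t ht).deriv.symm) measurableSet_Ioo
  -- The density ρ is only almost everywhere measurable, whereas Pettis integrability asks for Borel
  -- measurable pairings. The derivative itself is Borel measurable and agrees with ρ on (0,T).
  obtain ⟨I, hI⟩ := exists_isPettisIntegral_comp_gaussPart hR hν hT
    (continuousOn_scale_mul hF.continuousOn_Fzz) hFzz_adm measurableSet_Ioo Ioo_subset_Icc_self
    ((measurable_deriv _).div_const 2) (hd.div_const 2)
  exact ⟨I, hI.congr fun t _ => Eventually.of_forall fun ω => by ring⟩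

include hR hν hT hF hF_adm hFt_adm hFz_adm hFzz_adm in
/-- The Itô formula for the Gaussian part. -/
theorem gaussPart_ito {I₁ I₂ I₃ : Ω → ℝ}
    (h₁ : X.IsPettisIntegral (Icc 0 T) (fun t ω => Ft t (X.gaussPart ν t ω) (X.A ω)) I₁)
    (h₂ : X.IsFracItoIntegral (Ico 0 T) (fun t ω => ν t * Fz t (X.gaussPart ν t ω) (X.A ω)) I₂)
    (h₃ : X.IsPettisIntegral (Ioo 0 T) (fun t ω => X.A ω / 2 *
      (deriv (varianceFun X.H ν) t * Fzz t (X.gaussPart ν t ω) (X.A ω))) I₃) :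
    ∀ᵐ ω ∂P, F T (X.gaussPart ν T ω) (X.A ω) =
      F 0 (X.gaussPart ν 0 ω) (X.A ω) + I₁ ω + I₂ ω + I₃ ω := by
  obtain ⟨_, _, hB⟩ := exists_memL2A_comp_gaussPart hν hT hF.continuousOn_F hF_adm
  have mT := (hB T ⟨hT.le, le_rfl⟩).1
  have m0 := (hB 0 ⟨le_rfl, hT.le⟩).1
  have n0 := mT.sub m0
  have n1 := n0.sub h₁.memL2A
  have n2 := n1.sub h₂.memL2A
  have h0 := X.ae_eq_zero_of_sTransform_eq_zero hR (n2.sub h₃.memL2A) fun η hη => by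
    rw [X.sTransform_sub n2 h₃.memL2A hη, X.sTransform_sub n1 h₂.memL2A hη,
      X.sTransform_sub n0 h₁.memL2A hη, X.sTransform_sub mT m0 hη,
      sTransform_ito hν hT hF hF_adm hFt_adm hFz_adm hFzz_adm hη, h₁.sTransform_eq hη,
      h₂.sTransform_eq η hη, h₃.sTransform_eq hη]
    ring
  filter_upwards [h0] with ω hω
  simp only [Pi.zero_apply] at hω
  linarith

include hR hν hT hF hF_adm hFt_adm hFz_adm hFzz_adm in
-- The Itô formula is solved for the integral: F(T, Z_T, A) - F(0, Z_0, A) minus the two Pettis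
-- integrals lies in L²_A, and by `sTransform_ito` it has the transform that defines the fractional
-- integral.
theorem exists_isFracItoIntegral_ito : ∃ I₂, X.IsFracItoIntegral (Ico 0 T)
    (fun t ω => ν t * Fz t (X.gaussPart ν t ω) (X.A ω)) I₂ := by
  obtain ⟨I₁, h₁⟩ := exists_isPettisIntegral_comp_gaussPart hR hν hT hF.continuousOn_Ft hFt_adm
    measurableSet_Icc subset_rfl (measurable_const (a := (1 : ℝ)))
    (integrableOn_const (by simp))
  simp only [one_mul] at h₁
  obtain ⟨I₃, h₃⟩ := exists_isPettisIntegral_ito hR hν hT hF hFzz_adm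
  obtain ⟨_, _, hB⟩ := exists_memL2A_comp_gaussPart hν hT hF.continuousOn_F hF_adm
  obtain ⟨_, _, hBz⟩ := exists_memL2A_comp_gaussPart hν hT
    (continuousOn_scale_mul hF.continuousOn_Fz) hFz_adm
  have mT := (hB T ⟨hT.le, le_rfl⟩).1
  have m0 := (hB 0 ⟨le_rfl, hT.le⟩).1
  have n0 := mT.sub m0
  have n1 := n0.sub h₁.memL2A
  refine ⟨_, measurableSet_Ico, fun t ht => ?_, fun t ht η hη => ?_, fun η hη => ?_,
    n1.sub h₃.memL2A, fun η hη => ?_⟩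
  · exact (aestronglyMeasurable_comp_gaussPart (X := X) hF.continuousOn_Fz
      (Ico_subset_Icc_self ht)).const_mul (ν t)
  -- Only A ∂_z F is controlled in L²; the integrand ∂_z F itself need not be square integrable.
  · refine (((hBz t (Ico_subset_Icc_self ht)).1.const_mul (ν t)).integrable_mul
      (X.memL2A_wickExp hη)).congr (Eventually.of_forall fun ω => ?_)
    simp only; ring
  · exact (integrableOn_sTransform_ito hν hT hF hFz_adm hη).congr_set_ae Ico_ae_eq_Ioc
  · rw [X.sTransform_sub n1 h₃.memL2A hη, X.sTransform_sub n0 h₁.memL2A hη,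
      X.sTransform_sub mT m0 hη, sTransform_ito hν hT hF hF_adm hFt_adm hFz_adm hFzz_adm hη,
      h₁.sTransform_eq hη, h₃.sTransform_eq hη]
    ring

end formula

end RandomlyScaledFBM

end

end ScaledFBM

/-! ### The Itô formula for Z. -/

theorem mainTheorem1 {Ω : Type*} [MeasurableSpace Ω] {P : MeasureTheory.Measure Ω}
    [MeasureTheory.IsProbabilityMeasure P]
    (X : ScaledFBM.RandomlyScaledFBM P) (hR : 0 < X.radius)
    (T : ℝ) (hT : 0 < T) (ν : ℝ → ℝ) (hν : X.IsGoodIntegrand ν)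
    (Z : ℝ → Ω → ℝ)
    (hZ : ∀ t ∈ Set.Icc 0 T, X.IsFracItoIntegral (Set.Ico 0 t) (fun s _ => ν s) (Z t))
    (F Ft Fz Fzz : ℝ → ℝ → ℝ → ℝ) (hF : ScaledFBM.IsC120 T F Ft Fz Fzz)
    (hF_adm : X.AdmissibleGrowth ν T F)
    (hFt_adm : X.AdmissibleGrowth ν T Ft)
    (hFz_adm : X.AdmissibleGrowth ν T (fun t z a => a * Fz t z a))
    (hFzz_adm : X.AdmissibleGrowth ν T (fun t z a => a * Fzz t z a)) :
    -- both sides are elements of `L²_A`, and all integrals on the right exist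
    X.MemL2A (fun ω => F T (Z T ω) (X.A ω)) ∧
    X.MemL2A (fun ω => F 0 0 (X.A ω)) ∧
    (∃ I₁, X.IsPettisIntegral (Set.Icc 0 T) (fun t ω => Ft t (Z t ω) (X.A ω)) I₁) ∧
    (∃ I₂, X.IsFracItoIntegral (Set.Ico 0 T) (fun t ω => ν t * Fz t (Z t ω) (X.A ω)) I₂) ∧
    (∃ I₃, X.IsPettisIntegral (Set.Ioo 0 T)
      (fun t ω => X.A ω / 2 *
        (deriv (ScaledFBM.varianceFun X.H ν) t * Fzz t (Z t ω) (X.A ω))) I₃) ∧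
    -- the Itô formula in `L²_A`
    (∀ I₁ I₂ I₃ : Ω → ℝ,
      X.IsPettisIntegral (Set.Icc 0 T) (fun t ω => Ft t (Z t ω) (X.A ω)) I₁ →
      X.IsFracItoIntegral (Set.Ico 0 T) (fun t ω => ν t * Fz t (Z t ω) (X.A ω)) I₂ →
      X.IsPettisIntegral (Set.Ioo 0 T)
        (fun t ω => X.A ω / 2 *
          (deriv (ScaledFBM.varianceFun X.H ν) t * Fzz t (Z t ω) (X.A ω))) I₃ →
      ∀ᵐ ω ∂P, F T (Z T ω) (X.A ω) = F 0 0 (X.A ω) + I₁ ω + I₂ ω + I₃ ω) ∧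
    -- the factor `A / 2` may stand in front of the last integral whenever that integral exists
    (∀ I₁ I₂ J : Ω → ℝ,
      X.IsPettisIntegral (Set.Icc 0 T) (fun t ω => Ft t (Z t ω) (X.A ω)) I₁ →
      X.IsFracItoIntegral (Set.Ico 0 T) (fun t ω => ν t * Fz t (Z t ω) (X.A ω)) I₂ →
      X.IsPettisIntegral (Set.Ioo 0 T)
        (fun t ω => deriv (ScaledFBM.varianceFun X.H ν) t * Fzz t (Z t ω) (X.A ω)) J →
      ∀ᵐ ω ∂P, F T (Z T ω) (X.A ω) = F 0 0 (X.A ω) + I₁ ω + I₂ ω + X.A ω / 2 * J ω) := by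
  -- Any version of Z_t is the scaled Wiener integral, so everything reduces to the Gaussian part.
  have hξ : ∀ t ∈ Set.Icc 0 T, Z t =ᵐ[P] X.gaussPart ν t := fun t ht =>
    ScaledFBM.RandomlyScaledFBM.IsFracItoIntegral.ae_eq_gaussPart hR hν hT ht (hZ t ht)
  have hG : ∀ (G : ℝ → ℝ → ℝ → ℝ), ∀ t ∈ Set.Icc 0 T,
      (fun ω => G t (Z t ω) (X.A ω)) =ᵐ[P] fun ω => G t (X.gaussPart ν t ω) (X.A ω) :=
    fun G t ht => (hξ t ht).mono fun ω hω => by simp only [hω]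
  have h0 : (fun ω => F 0 (X.gaussPart ν 0 ω) (X.A ω)) =ᵐ[P] fun ω => F 0 0 (X.A ω) :=
    (ScaledFBM.RandomlyScaledFBM.gaussPart_zero hν hT).mono fun ω hω => by
      simp only [hω, Pi.zero_apply]
  have hT0 : T ∈ Set.Icc 0 T := ⟨hT.le, le_rfl⟩
  have g₁ : ∀ t ∈ Set.Icc 0 T, (fun ω => Ft t (Z t ω) (X.A ω)) =ᵐ[P]
      fun ω => Ft t (X.gaussPart ν t ω) (X.A ω) := hG Ft
  have g₂ : ∀ t ∈ Set.Ico 0 T, (fun ω => ν t * Fz t (Z t ω) (X.A ω)) =ᵐ[P]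
      fun ω => ν t * Fz t (X.gaussPart ν t ω) (X.A ω) := fun t ht =>
    (hG Fz t (Set.Ico_subset_Icc_self ht)).mono fun ω hω => congrArg (ν t * ·) hω
  have g₃ : ∀ t ∈ Set.Ioo 0 T, (fun ω => X.A ω / 2 *
      (deriv (ScaledFBM.varianceFun X.H ν) t * Fzz t (Z t ω) (X.A ω))) =ᵐ[P] fun ω => X.A ω / 2 *
      (deriv (ScaledFBM.varianceFun X.H ν) t * Fzz t (X.gaussPart ν t ω) (X.A ω)) := fun t ht =>
    (hG Fzz t (Set.Ioo_subset_Icc_self ht)).mono fun ω hω => by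
      exact congrArg (fun y => X.A ω / 2 * (deriv (ScaledFBM.varianceFun X.H ν) t * y)) hω
  obtain ⟨_, _, hB⟩ := ScaledFBM.RandomlyScaledFBM.exists_memL2A_comp_gaussPart hν hT
    hF.continuousOn_F hF_adm
  obtain ⟨K₁, hK₁⟩ := ScaledFBM.RandomlyScaledFBM.exists_isPettisIntegral_comp_gaussPart hR hν hT
    hF.continuousOn_Ft hFt_adm measurableSet_Icc subset_rfl (measurable_const (a := (1 : ℝ)))
    (integrableOn_const (by simp))
  simp only [one_mul] at hK₁
  obtain ⟨K₂, hK₂⟩ := ScaledFBM.RandomlyScaledFBM.exists_isFracItoIntegral_ito hR hν hT hF hF_adm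
    hFt_adm hFz_adm hFzz_adm
  obtain ⟨K₃, hK₃⟩ := ScaledFBM.RandomlyScaledFBM.exists_isPettisIntegral_ito hR hν hT hF hFzz_adm
  replace hK₃ := hK₃.congr fun t ht => (g₃ t ht).symm
  have formula : ∀ I₁ I₂ I₃ : Ω → ℝ,
      X.IsPettisIntegral (Set.Icc 0 T) (fun t ω => Ft t (Z t ω) (X.A ω)) I₁ →
      X.IsFracItoIntegral (Set.Ico 0 T) (fun t ω => ν t * Fz t (Z t ω) (X.A ω)) I₂ →
      X.IsPettisIntegral (Set.Ioo 0 T)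
        (fun t ω => X.A ω / 2 *
          (deriv (ScaledFBM.varianceFun X.H ν) t * Fzz t (Z t ω) (X.A ω))) I₃ →
      ∀ᵐ ω ∂P, F T (Z T ω) (X.A ω) = F 0 0 (X.A ω) + I₁ ω + I₂ ω + I₃ ω := by
    intro I₁ I₂ I₃ h₁ h₂ h₃
    filter_upwards [ScaledFBM.RandomlyScaledFBM.gaussPart_ito hR hν hT hF hF_adm hFt_adm hFz_adm
      hFzz_adm (h₁.congr g₁) (h₂.congr g₂) (h₃.congr g₃), hG F T hT0, h0] with ω e₁ e₂ e₃
    rw [e₂, e₁, e₃]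
  refine ⟨(hB T hT0).1.congr (hG F T hT0).symm, (hB 0 ⟨le_rfl, hT.le⟩).1.congr h0,
    ⟨K₁, hK₁.congr fun t ht => (g₁ t ht).symm⟩, ⟨K₂, hK₂.congr fun t ht => (g₂ t ht).symm⟩,
    ⟨K₃, hK₃⟩, formula, fun I₁ I₂ J h₁ h₂ hJ => ?_⟩
  have hu : Continuous fun a : ℝ => a / 2 := by fun_prop
  -- The integral with A/2 inside always exists; whenever the one without it exists too, the factor
  -- can be pulled out by truncation.
  filter_upwards [formula I₁ I₂ K₃ h₁ h₂ hK₃,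
    ScaledFBM.RandomlyScaledFBM.IsPettisIntegral.mul_ae_eq hu (fun t ω => rfl) hK₃ hJ]
    with ω e₁ e₂
  rw [e₁, e₂]
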